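/- Work on a word RAM with $w$-bit words: registers and array cells hold integers in $[0,2^w)$; each access to a register or array cell, arithmetic operation ($+,-,\times,\div,\bmod$ modulo $2^w$), comparison, assignment and test takes unit time. Programs are fixed, independent of $n$ and $w$. Nodes are $1,\dots,n$ with $n\ge 1$ and $n<2^w$; the word $0$ is NULL. A \emph{link-cut tree} for a rooted forest on the nodes (given by parent pointers) is the following stored structure. The nodes are partitioned into descending paths (preferred paths). Each path is stored, by left-child, right-child and parent pointers, as a binary tree (its splay tree) whose in-order traversal is the path from top to bottom; the root of this binary tree stores a pointer to the forest parent of the top node of the path (NULL if there is none). There is an absolute constant $C$ such that the following hold for all such $n,w$. (1) \emph{Fully dynamic level ancestors.} There is a data structure (programs for initialization, Update and Query) maintaining a rooted forest on the nodes under the on-line operations Update$(v,x)$: change the parent pointer of $v$ to $x$, where $x$ is a node or NULL and the result must again be a forest; and Query$(v,d)$: return the ancestor of $v$ at depth $d$, where $0\le d\le \mathrm{depth}(v)$ and roots have depth $0$. From any initial forest, initialization takes time at most $Cn(1+\lg n)$, and every legal sequence of $m$ operations is then answered correctly in total time at most $C(m+s)(1+\lg n)$, where $s$ is the number of non-NULL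 parent pointers of the initial forest. After every operation the memory holds a link-cut tree for the current forest, and after each Query$(v,d)$ one of its preferred paths consists exactly of $v$ and all its ancestors. (2) \emph{Dynamic pointer following.} There is a data structure maintaining an arbitrary function $f:\{1,\dots,n\}\to\{1,\dots,n\}$ under the on-line operations Update$(v,u)$: set $f(v):=u$; and Query$(v,k)$: return $f^k(v)$, where $0\le k<2^w$. From any initial function $f_0$, initialization takes time at most $Cn(1+\lg n)$, and every sequence of $m$ operations is then answered correctly in total time at most $C(m+s)(1+\lg n)$, where $s=|\{v: f_0(v)\ne v\}|$. Thus each operation takes amortized time $O(\lg n)$, each initial pointer that is not a self-loop being charged as one operation. After every operation the memory holds a link-cut tree for a rooted forest, together with one extra pointer for the root of each tree of the forest (NULL for all other nodes), such that: $f(v)$ is the parent of $v$ for each non-root $v$; the extra pointer of each root $r$ is $f(r)$, which is a node of the tree of $r$; and the nodes of the tree of $r$ that lie on a cycle of $f$ are exactly those on the tree path from $f(r)$ up to $r$. -/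

import Mathlib

/-! ### The machine: a word RAM

A program is a fixed piece of code over finitely many registers and finitely many arrays. Every
register and every array cell holds one `w`-bit word, a natural number below `2 ^ w`, and
arithmetic is modulo `2 ^ w`. Each evaluated node of an expression and each executed
assignment, store and test costs one unit of time. -/

namespace DPF

/-- The arithmetic and comparison instructions of the word RAM. -/
inductive BinOp where
  | add | sub | mul | div | mod | eq | lt

/-- Word operations: wrap-around arithmetic modulo `2 ^ w`; comparisons return `0` or `1`. -/
def BinOp.apply (w : ℕ) : BinOp → ℕ → ℕ → ℕ
  | .add, x, y => (x + y) % 2 ^ w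
  | .sub, x, y => (x + (2 ^ w - y)) % 2 ^ w
  | .mul, x, y => (x * y) % 2 ^ w
  | .div, x, y => (x / y) % 2 ^ w
  | .mod, x, y => (x % y) % 2 ^ w
  | .eq, x, y => (if x = y then 1 else 0) % 2 ^ w
  | .lt, x, y => (if x < y then 1 else 0) % 2 ^ w

/-- Expressions: literals, registers, array cells, binary operations. Register names and array
names are literals in the code; only the index of an array cell is computed. -/
inductive RExp where
  | const (c : ℕ)
  | reg (r : ℕ)
  | load (a : ℕ) (i : RExp)
  | bin (o : BinOp) (e₁ e₂ : RExp)

/-- Commands. `loop b p` is the while loop with test `b` and body `p`. -/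
inductive Cmd where
  | skip
  | assign (r : ℕ) (e : RExp)
  | store (a : ℕ) (i e : RExp)
  | seq (p q : Cmd)
  | ite (b : RExp) (p q : Cmd)
  | loop (b : RExp) (p : Cmd)

/-- The contents of the registers and of the arrays. -/
structure Store where
  reg : ℕ → ℕ
  arr : ℕ → ℕ → ℕ

def Store.setReg (σ : Store) (r x : ℕ) : Store :=
  { σ with reg := Function.update σ.reg r x }

def Store.setArr (σ : Store) (a i x : ℕ) : Store :=
  { σ with arr := Function.update σ.arr a (Function.update (σ.arr a) i x) }

def RExp.eval (w : ℕ) (σ : Store) : RExp → ℕ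
  | .const c => c % 2 ^ w
  | .reg r => σ.reg r
  | .load a i => σ.arr a (i.eval w σ)
  | .bin o e₁ e₂ => o.apply w (e₁.eval w σ) (e₂.eval w σ)

/-- The time for evaluating an expression: one unit per literal, register access, array access
and arithmetic instruction. -/
def RExp.cost : RExp → ℕ
  | .const _ => 1
  | .reg _ => 1
  | .load _ i => i.cost + 1
  | .bin _ e₁ e₂ => e₁.cost + e₂.cost + 1

/-- `Exec w p σ σ' t`: started in `σ` on the RAM with word size `w`, the program `p` halts in
`σ'` after exactly `t` units of time. -/
inductive Exec (w : ℕ) : Cmd → Store → Store → ℕ → Prop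
  | skip (σ : Store) : Exec w .skip σ σ 1
  | assign (σ : Store) (r : ℕ) (e : RExp) :
      Exec w (.assign r e) σ (σ.setReg r (e.eval w σ)) (e.cost + 1)
  | store (σ : Store) (a : ℕ) (i e : RExp) :
      Exec w (.store a i e) σ (σ.setArr a (i.eval w σ) (e.eval w σ)) (i.cost + e.cost + 1)
  | seq {p q : Cmd} {σ σ₁ σ₂ : Store} {t₁ t₂ : ℕ} :
      Exec w p σ σ₁ t₁ → Exec w q σ₁ σ₂ t₂ → Exec w (.seq p q) σ σ₂ (t₁ + t₂)
  | ite_true {b : RExp} {p q : Cmd} {σ σ₁ : Store} {t : ℕ} :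
      b.eval w σ ≠ 0 → Exec w p σ σ₁ t → Exec w (.ite b p q) σ σ₁ (b.cost + 1 + t)
  | ite_false {b : RExp} {p q : Cmd} {σ σ₁ : Store} {t : ℕ} :
      b.eval w σ = 0 → Exec w q σ σ₁ t → Exec w (.ite b p q) σ σ₁ (b.cost + 1 + t)
  | loop_true {b : RExp} {p : Cmd} {σ σ₁ σ₂ : Store} {t₁ t₂ : ℕ} :
      b.eval w σ ≠ 0 → Exec w p σ σ₁ t₁ → Exec w (.loop b p) σ₁ σ₂ t₂ →
      Exec w (.loop b p) σ σ₂ (b.cost + 1 + t₁ + t₂)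
  | loop_false {b : RExp} {p : Cmd} {σ : Store} :
      b.eval w σ = 0 → Exec w (.loop b p) σ σ (b.cost + 1)

/-! ### Data structures on the word RAM -/

/-- The word that names a node: the nodes are `1, …, n`. -/
def nodeWord {n : ℕ} (v : Fin n) : ℕ := v + 1

/-- The word that names a node or NULL: NULL is `0`. -/
def optWord {n : ℕ} : Option (Fin n) → ℕ
  | none => 0
  | some v => nodeWord v

/-- The input: register `0` holds `n`, cell `i` of array `0` holds the `i`-th pointer
(`1 ≤ i ≤ n`), everything else is `0`. -/
def inputStore {n : ℕ} (g : Fin n → Option (Fin n)) : Store where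
  reg r := if r = 0 then n else 0
  arr a i := if h : a = 0 ∧ 1 ≤ i ∧ i ≤ n then optWord (g ⟨i - 1, by omega⟩) else 0

/-- An operation is called with its two arguments in the registers `0` and `1`; everything else
is as the preceding operation left it. -/
def Store.call (σ : Store) (x y : ℕ) : Store := (σ.setReg 0 x).setReg 1 y

/-- A data structure with two operations: three programs, for the initialization, for Update and
for Query. The answer of Query is returned in register `0`. -/
structure DataStructure where
  build : Cmd
  update : Cmd
  query : Cmd

/-! ### Rooted forests -/

/-- `climb P j v` is the node `j` parent pointers ahead of `v` (`none` if it does not exist),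
where `P` sends a node to its parent and a root to `none`. -/
def climb {n : ℕ} (P : Fin n → Option (Fin n)) : ℕ → Fin n → Option (Fin n)
  | 0, v => some v
  | j + 1, v => (P v).bind (climb P j)

/-- `P` is the parent function of a rooted forest: every upward path ends. -/
def IsForest {n : ℕ} (P : Fin n → Option (Fin n)) : Prop :=
  ∀ v, ∃ j, climb P j v = none

/-- `u` is an ancestor of `v`, where `v` counts as an ancestor of itself. -/
def IsAncestor {n : ℕ} (P : Fin n → Option (Fin n)) (u v : Fin n) : Prop :=
  ∃ j, climb P j v = some u

/-- `v` has depth `d`; roots have depth `0`. -/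
def HasDepth {n : ℕ} (P : Fin n → Option (Fin n)) (v : Fin n) (d : ℕ) : Prop :=
  ∃ r, climb P d v = some r ∧ P r = none

/-! ### Link-cut trees

The nodes of a forest are partitioned into preferred paths, each descending from a node to
a descendant. Each preferred path is stored as a binary search tree (its splay tree) keyed by
depth, so that its in-order traversal is the path from top to bottom, and the root of that splay
tree has a path-parent pointer to the parent of the top of the path. -/

/-- In-order traversal. -/
def inorder {α : Type} : BinaryTree α → List α
  | .nil => []
  | .node v l r => inorder l ++ v :: inorder r

/-- The node at the root of a binary tree. -/
def rootNode {α : Type} : BinaryTree α → Option α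
  | .nil => none
  | .node v _ _ => some v

/-- Array `1` of the store: left children in the splay trees. -/
def Store.left (σ : Store) {n : ℕ} (v : Fin n) : ℕ := σ.arr 1 (nodeWord v)

/-- Array `2` of the store: right children in the splay trees. -/
def Store.right (σ : Store) {n : ℕ} (v : Fin n) : ℕ := σ.arr 2 (nodeWord v)

/-- Array `3` of the store: parents in the splay trees, and path-parents at their roots. -/
def Store.up (σ : Store) {n : ℕ} (v : Fin n) : ℕ := σ.arr 3 (nodeWord v)

/-- Array `4` of the store: the additional pointers of the roots of the forest. -/
def Store.extra (σ : Store) {n : ℕ} (v : Fin n) : ℕ := σ.arr 4 (nodeWord v)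

/-- The binary tree is stored in the arrays of child and parent pointers. -/
def Stored {n : ℕ} (σ : Store) : BinaryTree (Fin n) → Prop
  | .nil => True
  | .node v l r =>
      σ.left v = optWord (rootNode l) ∧ σ.right v = optWord (rootNode r) ∧
      (∀ u, rootNode l = some u → σ.up u = nodeWord v) ∧
      (∀ u, rootNode r = some u → σ.up u = nodeWord v) ∧
      Stored σ l ∧ Stored σ r

/-- The store holds a link-cut tree of the forest `P` with splay trees `ts`. -/
structure IsLinkCut {n : ℕ} (σ : Store) (P : Fin n → Option (Fin n))
    (ts : List (BinaryTree (Fin n))) : Prop where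
  forest : IsForest P
  partition : ∀ v, (ts.flatMap inorder).count v = 1
  stored : ∀ t ∈ ts, Stored σ t
  path : ∀ t ∈ ts, (inorder t).IsChain (fun u v => P v = some u)
  pathParent : ∀ t ∈ ts, ∀ u, rootNode t = some u →
    σ.up u = optWord ((inorder t).head?.bind P)

/-- The path from the root of its tree down to `v` is a preferred path: one of the splay trees
holds exactly `v` and its ancestors. -/
def IsAccessed {n : ℕ} (P : Fin n → Option (Fin n)) (ts : List (BinaryTree (Fin n)))
    (v : Fin n) : Prop :=
  ∃ t ∈ ts, ∀ u, u ∈ inorder t ↔ IsAncestor P u v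

/-! ### Fully dynamic level ancestors -/

/-- `update v x`: change the parent pointer of `v` to `x`, a node or NULL.
`query v d`: return the ancestor of `v` at depth `d`. -/
inductive LevelOp (n : ℕ) where
  | update (v : Fin n) (x : Option (Fin n))
  | query (v : Fin n) (d : ℕ)

/-- The operations can be applied one after another to the forest: after every update the graph
is again a forest, and every query asks for a depth that is at most the depth of the node. -/
def LevelLegal {n : ℕ} : (Fin n → Option (Fin n)) → List (LevelOp n) → Prop
  | _, [] => True
  | P, .update v x :: ops =>
      IsForest (Function.update P v x) ∧ LevelLegal (Function.update P v x) ops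
  | P, .query v d :: ops => (∃ e, HasDepth P v e ∧ d ≤ e) ∧ LevelLegal P ops

/-- `LevelRun D w P σ ops P' σ' t`: started in `σ` with the forest `P`, the data structure
performs the operations `ops` on-line, answers all queries correctly, and after a total time `t`
is in `σ'`, with the forest `P'`. -/
inductive LevelRun (D : DataStructure) (w : ℕ) {n : ℕ} :
    (Fin n → Option (Fin n)) → Store → List (LevelOp n) →
    (Fin n → Option (Fin n)) → Store → ℕ → Prop
  | nil (P : Fin n → Option (Fin n)) (σ : Store) : LevelRun D w P σ [] P σ 0
  | update {P P' : Fin n → Option (Fin n)} {σ σ₁ σ' : Store} {v : Fin n}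
      {x : Option (Fin n)} {ops : List (LevelOp n)} {t₁ t₂ : ℕ} :
      Exec w D.update (σ.call (nodeWord v) (optWord x)) σ₁ t₁ →
      LevelRun D w (Function.update P v x) σ₁ ops P' σ' t₂ →
      LevelRun D w P σ (.update v x :: ops) P' σ' (t₁ + t₂)
  | query {P P' : Fin n → Option (Fin n)} {σ σ₁ σ' : Store} {v u : Fin n} {d : ℕ}
      {ops : List (LevelOp n)} {t₁ t₂ : ℕ} :
      Exec w D.query (σ.call (nodeWord v) d) σ₁ t₁ →
      IsAncestor P u v → HasDepth P u d → σ₁.reg 0 = nodeWord u →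
      LevelRun D w P σ₁ ops P' σ' t₂ →
      LevelRun D w P σ (.query v d :: ops) P' σ' (t₁ + t₂)

/-! ### Dynamic pointer following -/

/-- `update v u`: change the pointer of `v` to `u`. `query v k`: return `f^k(v)`. -/
inductive PointerOp (n : ℕ) where
  | update (v u : Fin n)
  | query (v : Fin n) (k : ℕ)

/-- The exponents of all queries fit into a machine word. -/
def PointerLegal (w : ℕ) {n : ℕ} (ops : List (PointerOp n)) : Prop :=
  ∀ v k, PointerOp.query v k ∈ ops → k < 2 ^ w

/-- `PointerRun D w f σ ops f' σ' t`: started in `σ` with the pointers `f`, the data structure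
performs the operations `ops` on-line, answers all queries correctly, and after a total time `t`
is in `σ'`, with the pointers `f'`. -/
inductive PointerRun (D : DataStructure) (w : ℕ) {n : ℕ} :
    (Fin n → Fin n) → Store → List (PointerOp n) → (Fin n → Fin n) → Store → ℕ → Prop
  | nil (f : Fin n → Fin n) (σ : Store) : PointerRun D w f σ [] f σ 0
  | update {f f' : Fin n → Fin n} {σ σ₁ σ' : Store} {v u : Fin n}
      {ops : List (PointerOp n)} {t₁ t₂ : ℕ} :
      Exec w D.update (σ.call (nodeWord v) (nodeWord u)) σ₁ t₁ →
      PointerRun D w (Function.update f v u) σ₁ ops f' σ' t₂ →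
      PointerRun D w f σ (.update v u :: ops) f' σ' (t₁ + t₂)
  | query {f f' : Fin n → Fin n} {σ σ₁ σ' : Store} {v : Fin n} {k : ℕ}
      {ops : List (PointerOp n)} {t₁ t₂ : ℕ} :
      Exec w D.query (σ.call (nodeWord v) k) σ₁ t₁ →
      σ₁.reg 0 = nodeWord (f^[k] v) →
      PointerRun D w f σ₁ ops f' σ' t₂ →
      PointerRun D w f σ (.query v k :: ops) f' σ' (t₁ + t₂)

/-- The forest `P`, with one additional pointer for the root of each tree, encodes the functional
graph of `f`: the parent pointers are the pointers of the other nodes, the additional pointer of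
a root `r` is `f r`, a node of the tree of `r`, and the nodes of that tree that lie on a cycle
of `f` are exactly the nodes on the tree path from `f r` up to `r`. -/
structure EncodesPointers {n : ℕ} (σ : Store) (P : Fin n → Option (Fin n))
    (f : Fin n → Fin n) : Prop where
  nonroot : ∀ v u, P v = some u → f v = u ∧ σ.extra v = 0
  root : ∀ r, P r = none → σ.extra r = nodeWord (f r) ∧ IsAncestor P r (f r)
  cycle : ∀ r v, P r = none → IsAncestor P r v →
    (v ∈ Function.periodicPts f ↔ IsAncestor P v (f r))

end DPF

/-!
The data structure is the link-cut tree of Sleator and Tarjan, run on the word RAM.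

*Local description.* A link-cut tree is described by `LCState`: children, parents, subtree sizes and
the extreme nodes of the splay subtrees. The predicate `Valid` asks only for acyclicity and for
conditions on neighbouring nodes; in particular the in-order traversal is a path of the forest as
soon as each node is adjacent, in the forest, to the last node of its left and the first node of its
right subtree. So a rotation, a change of a preferred child, a cut or a link can be checked where
the pointers change (`Valid.rot`, `Valid.splice`, `Valid.cut`, `Valid.link`), and the binary
trees required by `IsLinkCut` are recovered at the end (`Valid.isLinkCut`).

*Amortization.* Parents and path-parents together form a forest, whose trees are the virtual trees.
The rank of a node is the binary logarithm of the size of its virtual subtree, and the potential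
is the sum of all ranks. A splay has amortized cost at most three times the gain in rank, plus a
constant (`exec_splayProg`). An access splays along the way to the root, switching preferred children
in between, which does not change the potential; the gains in rank telescope. The number of switches
is bounded by the depth of the accessed node in the last splay tree, and the final splay of that node
pays for it (`exec_accessProg`). So each access, and with it the selection of an ancestor by depth, the
search of the root, each cut and each link, has amortized cost `O(1 + log n)`, as `Amort` records.

*Functional graphs.* A function `f` is encoded by a forest of pointers of `f`, whose roots `r` have
an additional pointer to `f r`, a node of the same tree (`Encodes`). Following pointers from `r` closes
the cycle that consists of the ancestors of `f r`. An update at `v` makes `v` a root: it is cut off,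
and if the old root `r` then points to a node below `v`, its additional pointer becomes a tree edge
(`exec_detachProg`); then `v` is linked to its new target, unless this is in the tree of `v`, so that
the new pointer becomes the additional one (`exec_attachProg`). For a query, the steps beyond the root are
reduced modulo the length of the cycle, and what remains is a level ancestor query
(`exec_pointerQueryProg`).

*Level ancestors* are the special case in which each root points to itself: then the encoding
forest is the given forest (`Encodes.eq_of_parentOrSelf`). Initialization starts from self-loops and
performs an update for each other pointer. Since the potential of the initial state without edges is
zero, it is bounded afterwards by the budget of these updates (`exec_buildProg`).
-/

namespace DPF

open Finset

variable {n : ℕ} {F : Fin n → Option (Fin n)}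

/-! ### Forests -/

theorem isAncestor_iff {a x : Fin n} :
    IsAncestor F a x ↔ a = x ∨ ∃ y, F x = some y ∧ IsAncestor F a y := by
  constructor
  · rintro ⟨j, hj⟩
    cases j with
    | zero => left; simpa [climb] using hj.symm
    | succ j =>
      right
      cases h : F x with
      | none => simp [climb, h] at hj
      | some y => exact ⟨y, rfl, j, by simpa [climb, h] using hj⟩
  · rintro (rfl | ⟨y, hy, j, hj⟩)
    · exact ⟨0, rfl⟩
    · exact ⟨j + 1, by simpa [climb, hy] using hj⟩

theorem IsAncestor.refl (x : Fin n) : IsAncestor F x x := ⟨0, rfl⟩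

theorem isAncestor_of_some {a x y : Fin n} (h : F x = some y) :
    IsAncestor F a x ↔ a = x ∨ IsAncestor F a y := by
  rw [isAncestor_iff]; simp [h]

theorem isAncestor_of_none {a x : Fin n} (h : F x = none) : IsAncestor F a x ↔ a = x := by
  rw [isAncestor_iff]; simp [h]

theorem climb_add (i j : ℕ) (x : Fin n) :
    climb F (i + j) x = (climb F i x).bind (climb F j) := by
  induction i generalizing x with
  | zero => simp [climb]
  | succ i ih =>
    rw [Nat.succ_add]
    cases h : F x with
    | none => simp [climb, h]
    | some y => simp [climb, h, ih]

theorem IsAncestor.trans {a b c : Fin n} (h₁ : IsAncestor F a b) (h₂ : IsAncestor F b c) :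
    IsAncestor F a c := by
  obtain ⟨i, hi⟩ := h₁
  obtain ⟨j, hj⟩ := h₂
  exact ⟨j + i, by simp [climb_add, hj, hi]⟩

theorem IsAncestor.of_parent {x y : Fin n} (h : F x = some y) : IsAncestor F y x :=
  (isAncestor_of_some h).2 (Or.inr (.refl y))

/-- Induction from the roots of a forest downwards. -/
@[elab_as_elim]
theorem IsForest.induction (hF : IsForest F) {p : Fin n → Prop}
    (step : ∀ x, (∀ y, F x = some y → p y) → p x) (x : Fin n) : p x := by
  obtain ⟨j, hj⟩ := hF x
  induction j generalizing x with
  | zero => simp [climb] at hj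
  | succ j ih =>
    refine step x fun y hy => ih y ?_
    simpa [climb, hy] using hj

theorem isForest_of_rank (h : Fin n → ℕ) (hh : ∀ x y, F x = some y → h y < h x) :
    IsForest F := by
  intro x
  induction hx : h x using Nat.strong_induction_on generalizing x with
  | _ k ih =>
    cases hF : F x with
    | none => exact ⟨1, by simp [climb, hF]⟩
    | some y =>
      obtain ⟨j, hj⟩ := ih (h y) (hx ▸ hh x y hF) y rfl
      exact ⟨j + 1, by simp [climb, hF, hj]⟩

theorem IsForest.exists_rank (hF : IsForest F) :
    ∃ h : Fin n → ℕ, ∀ x y, F x = some y → h y < h x := by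
  classical
  refine ⟨fun x => Nat.find (hF x), fun x y hxy => ?_⟩
  have h := Nat.find_spec (hF x)
  obtain ⟨j, hj⟩ : ∃ j, Nat.find (hF x) = j + 1 := by
    rcases Nat.eq_zero_or_eq_succ_pred (Nat.find (hF x)) with h0 | h0
    · rw [h0] at h; simp [climb] at h
    · exact ⟨_, h0⟩
  show Nat.find (hF y) < Nat.find (hF x)
  rw [hj] at h ⊢
  exact Nat.lt_succ_of_le (Nat.find_min' _ (by simpa [climb, hxy] using h))

theorem IsForest.not_isAncestor (hF : IsForest F) {x y : Fin n} (h : F x = some y) :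
    ¬ IsAncestor F x y := by
  obtain ⟨r, hr⟩ := hF.exists_rank
  have key : ∀ a b, IsAncestor F a b → r a ≤ r b := by
    intro a
    refine hF.induction fun b ih hab => ?_
    rcases isAncestor_iff.1 hab with rfl | ⟨c, hc, hac⟩
    · exact le_rfl
    · exact (ih c hc hac).trans (hr b c hc).le
  intro hxy
  exact absurd (key _ _ hxy) (not_le.2 (hr x y h))

theorem IsForest.ne_of_some (hF : IsForest F) {x y : Fin n} (h : F x = some y) : x ≠ y := by
  rintro rfl
  exact hF.not_isAncestor h (.refl x)

theorem IsAncestor.total {a b x : Fin n} (h₁ : IsAncestor F a x) (h₂ : IsAncestor F b x) :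
    IsAncestor F a b ∨ IsAncestor F b a := by
  obtain ⟨i, hi⟩ := h₁
  obtain ⟨j, hj⟩ := h₂
  rcases le_total i j with h | h <;> obtain ⟨k, rfl⟩ := Nat.exists_eq_add_of_le h
  · right; exact ⟨k, by simpa [climb_add, hi] using hj⟩
  · left; exact ⟨k, by simpa [climb_add, hj] using hi⟩

theorem root_unique {a b x : Fin n} (ha : F a = none) (hb : F b = none)
    (h₁ : IsAncestor F a x) (h₂ : IsAncestor F b x) : a = b := by
  rcases h₁.total h₂ with h | h
  · exact (isAncestor_of_none hb).1 h
  · exact ((isAncestor_of_none ha).1 h).symm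

theorem IsForest.exists_hasDepth (hF : IsForest F) (x : Fin n) : ∃ d, HasDepth F x d := by
  refine hF.induction (fun x ih => ?_) x
  cases h : F x with
  | none => exact ⟨0, x, rfl, h⟩
  | some y =>
    obtain ⟨d, r, hr⟩ := ih y h
    exact ⟨d + 1, r, by simpa [climb, h] using hr⟩

theorem HasDepth.zero_iff {x : Fin n} : HasDepth F x 0 ↔ F x = none := by
  simp [HasDepth, climb]

theorem HasDepth.succ_iff {x y : Fin n} {d : ℕ} (h : F x = some y) :
    HasDepth F x (d + 1) ↔ HasDepth F y d := by
  simp [HasDepth, climb, h]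

theorem HasDepth.unique {x : Fin n} {d e : ℕ} (h₁ : HasDepth F x d) (h₂ : HasDepth F x e) :
    d = e := by
  induction d generalizing x e with
  | zero =>
    rw [HasDepth.zero_iff] at h₁
    cases e with
    | zero => rfl
    | succ e => obtain ⟨r, hr, -⟩ := h₂; simp [climb, h₁] at hr
  | succ d ih =>
    cases h : F x with
    | none => obtain ⟨r, hr, -⟩ := h₁; simp [climb, h] at hr
    | some y =>
      cases e with
      | zero => rw [HasDepth.zero_iff, h] at h₂; cases h₂
      | succ e => rw [ih ((HasDepth.succ_iff h).1 h₁) ((HasDepth.succ_iff h).1 h₂)]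

theorem HasDepth.of_climb {x u : Fin n} {j d : ℕ} (h : climb F j x = some u)
    (hu : HasDepth F u d) : HasDepth F x (j + d) := by
  obtain ⟨r, hr, hr'⟩ := hu
  exact ⟨r, by simp [climb_add, h, hr], hr'⟩

/-- Setting the pointer of a root keeps all ancestor relations. -/
theorem IsAncestor.update_root {v a x : Fin n} {o : Option (Fin n)} (hv : F v = none)
    (h : IsAncestor F a x) : IsAncestor (Function.update F v o) a x := by
  obtain ⟨j, hj⟩ := h
  induction j generalizing x with
  | zero => simp only [climb, Option.some.injEq] at hj; subst hj; exact .refl _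
  | succ j ih =>
    cases hx : F x with
    | none => simp [climb, hx] at hj
    | some y =>
      have hxv : x ≠ v := by rintro rfl; simp [hv] at hx
      exact (isAncestor_of_some (by simpa [hxv] using hx)).2
        (Or.inr (ih (by simpa [climb, hx] using hj)))

theorem isForest_update_none (hF : IsForest F) (v : Fin n) :
    IsForest (Function.update F v none) := by
  obtain ⟨r, hr⟩ := hF.exists_rank
  refine isForest_of_rank r fun x y h => ?_
  by_cases hx : x = v
  · subst hx; simp at h
  · exact hr x y (by simpa [hx] using h)

theorem isForest_update_some (hF : IsForest F) {v u : Fin n} (hv : F v = none)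
    (hu : ¬ IsAncestor F v u) : IsForest (Function.update F v (some u)) := by
  classical
  obtain ⟨r, hr⟩ := hF.exists_rank
  refine isForest_of_rank (fun x => if IsAncestor F v x then r x + r u + 1 else r x)
    fun x y h => ?_
  by_cases hx : x = v
  · subst hx
    obtain rfl : u = y := by simpa using h
    simp [hu, IsAncestor.refl]
  · have h' : F x = some y := by simpa [hx] using h
    have := hr x y h'
    have e : IsAncestor F v x ↔ IsAncestor F v y := by
      rw [isAncestor_of_some h']; simp [Ne.symm hx]
    by_cases hy : IsAncestor F v y <;> simp [e, hy] <;> omega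

/-- After the subtree of `v` is cut off, a node below `a` is still below `a`, or it is in the
tree of `v`. -/
theorem IsAncestor.update_none {v a x : Fin n} (h : IsAncestor F a x) :
    IsAncestor (Function.update F v none) a x ∨ IsAncestor (Function.update F v none) v x := by
  obtain ⟨j, hj⟩ := h
  induction j generalizing x with
  | zero => simp only [climb, Option.some.injEq] at hj; subst hj; exact Or.inl (.refl _)
  | succ j ih =>
    by_cases hxv : x = v
    · subst hxv; exact Or.inr (.refl _)
    cases hx : F x with
    | none => simp [climb, hx] at hj
    | some y =>
      have hx' : Function.update F v none x = some y := by simpa [hxv] using hx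
      rw [isAncestor_of_some hx', isAncestor_of_some hx']
      rcases ih (x := y) (by simpa [climb, hx] using hj) with h | h <;> tauto

theorem IsAncestor.of_update_none {v a x : Fin n}
    (h : IsAncestor (Function.update F v none) a x) : IsAncestor F a x := by
  obtain ⟨j, hj⟩ := h
  induction j generalizing x with
  | zero => simp only [climb, Option.some.injEq] at hj; subst hj; exact .refl _
  | succ j ih =>
    cases hx : Function.update F v none x with
    | none => simp [climb, hx] at hj
    | some y =>
      have hxv : x ≠ v := by rintro rfl; simp at hx
      exact (isAncestor_of_some (by simpa [hxv] using hx)).2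
        (Or.inr (ih (by simpa [climb, hx] using hj)))

/-! ### Subtree sizes and the potential -/

open Classical in
/-- The nodes of the subtree of `v`. -/
noncomputable def desc (F : Fin n → Option (Fin n)) (v : Fin n) : Finset (Fin n) :=
  univ.filter (IsAncestor F v)

@[simp] theorem mem_desc {v x : Fin n} : x ∈ desc F v ↔ IsAncestor F v x := by simp [desc]

/-- The rank of a node: the binary logarithm of the size of its subtree. -/
noncomputable def rank (F : Fin n → Option (Fin n)) (v : Fin n) : ℝ :=
  Real.logb 2 (desc F v).card

/-- The potential of a forest: the sum of the ranks. -/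
noncomputable def pot (F : Fin n → Option (Fin n)) : ℝ := ∑ v, rank F v

theorem card_desc_pos (v : Fin n) : 0 < (desc F v).card :=
  card_pos.2 ⟨v, mem_desc.2 (.refl v)⟩

theorem card_desc_le (v : Fin n) : (desc F v).card ≤ n := by
  simpa using (desc F v).card_le_univ

theorem rank_nonneg (v : Fin n) : 0 ≤ rank F v :=
  Real.logb_nonneg (by norm_num) (by exact_mod_cast card_desc_pos v)

theorem rank_le (v : Fin n) : rank F v ≤ Real.logb 2 n :=
  Real.logb_le_logb_of_le (by norm_num) (by exact_mod_cast card_desc_pos v)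
    (by exact_mod_cast card_desc_le v)

theorem pot_nonneg : 0 ≤ pot F := sum_nonneg fun v _ => rank_nonneg v

theorem rank_mono {G : Fin n → Option (Fin n)} {a b : Fin n} (h : desc F a ⊆ desc G b) :
    rank F a ≤ rank G b :=
  Real.logb_le_logb_of_le (by norm_num) (by exact_mod_cast card_desc_pos a)
    (by exact_mod_cast card_le_card h)

theorem desc_subset {a b : Fin n} (h : IsAncestor F b a) : desc F a ⊆ desc F b :=
  fun _ hx => mem_desc.2 (h.trans (mem_desc.1 hx))

theorem IsForest.card_lt (hF : IsForest F) {a b : Fin n} (h : F a = some b) :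
    (desc F a).card < (desc F b).card := by
  refine card_lt_card ⟨desc_subset (.of_parent h), fun hs => ?_⟩
  exact hF.not_isAncestor h (mem_desc.1 (hs (mem_desc.2 (.refl b))))

theorem IsForest.disjoint_desc (hF : IsForest F) {a b c : Fin n} (ha : F a = some c)
    (hb : F b = some c) (hab : a ≠ b) : Disjoint (desc F a) (desc F b) := by
  rw [Finset.disjoint_left]
  intro x hx hx'
  rcases (mem_desc.1 hx).total (mem_desc.1 hx') with h | h
  · rcases (isAncestor_of_some hb).1 h with h | h
    · exact hab h
    · exact hF.not_isAncestor ha h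
  · rcases (isAncestor_of_some ha).1 h with h | h
    · exact hab h.symm
    · exact hF.not_isAncestor hb h

theorem IsForest.card_add_card_lt (hF : IsForest F) {a b c : Fin n} (ha : F a = some c)
    (hb : F b = some c) (hab : a ≠ b) :
    (desc F a).card + (desc F b).card < (desc F c).card := by
  rw [← card_union_of_disjoint (hF.disjoint_desc ha hb hab)]
  refine card_lt_card ⟨union_subset (desc_subset (.of_parent ha)) (desc_subset (.of_parent hb)),
    fun hs => ?_⟩
  rcases mem_union.1 (hs (mem_desc.2 (.refl c))) with h | h
  · exact hF.not_isAncestor ha (mem_desc.1 h)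
  · exact hF.not_isAncestor hb (mem_desc.1 h)

/-- The concavity of the logarithm in the form used for splay trees. -/
theorem logb_add_logb_le {a b c : ℝ} (ha : 0 < a) (hb : 0 < b) (h : a + b ≤ c) :
    Real.logb 2 a + Real.logb 2 b ≤ 2 * Real.logb 2 c - 2 := by
  have hc : 0 < c := by linarith
  have h1 : Real.logb 2 a + Real.logb 2 b + 2 = Real.logb 2 (4 * (a * b)) := by
    rw [Real.logb_mul (by norm_num) (by positivity), Real.logb_mul ha.ne' hb.ne']
    have : Real.logb 2 4 = 2 := by
      rw [show (4 : ℝ) = 2 ^ (2 : ℝ) by norm_num]; exact Real.logb_rpow (by norm_num) (by norm_num)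
    linarith
  have h2 : 2 * Real.logb 2 c = Real.logb 2 (c * c) := by
    rw [Real.logb_mul hc.ne' hc.ne']; ring
  have h3 : Real.logb 2 (4 * (a * b)) ≤ Real.logb 2 (c * c) :=
    Real.logb_le_logb_of_le (by norm_num) (by positivity) (by nlinarith [sq_nonneg (a - b)])
  linarith

/-- Two siblings cannot both have almost the rank of their parent. -/
theorem IsForest.rank_add_rank_le (hF : IsForest F) {a b c : Fin n} (ha : F a = some c)
    (hb : F b = some c) (hab : a ≠ b) : rank F a + rank F b ≤ 2 * rank F c - 2 :=
  logb_add_logb_le (by exact_mod_cast card_desc_pos a) (by exact_mod_cast card_desc_pos b)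
    (by exact_mod_cast (hF.card_add_card_lt ha hb hab).le)

/-! ### Rotations as operations on parent functions -/

/-- The parent function after `v` has been rotated above its parent `p`; `m` is the child
of `v` that moves to `p`. -/
def rotUp (F : Fin n → Option (Fin n)) (v p : Fin n) (m : Option (Fin n)) :
    Fin n → Option (Fin n) :=
  fun x => if x = v then F p else if x = p then some v else if m = some x then some p else F x

theorem isForest_rotUp (hF : IsForest F) {v p : Fin n} {m : Option (Fin n)}
    (hv : F v = some p) (hm : ∀ c, m = some c → F c = some v) : IsForest (rotUp F v p m) := by
  obtain ⟨h, hh⟩ := hF.exists_rank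
  refine isForest_of_rank (fun x => if x = v then 2 * h p else 2 * h x + 1) fun x y hxy => ?_
  have hvp := hh _ _ hv
  have h1 : v ≠ p := hF.ne_of_some hv
  unfold rotUp at hxy
  split_ifs at hxy with hx hx hx
  · have := hh _ _ hxy
    simp only [hx, if_true]
    split_ifs with hy
    · subst hy; omega
    · omega
  · cases hxy; subst hx; simp [h1.symm]
  · cases hxy
    have := hh _ _ (hm _ hx)
    have : x ≠ v := by assumption
    simp [this, h1.symm]; omega
  · have := hh _ _ hxy
    have : x ≠ v := by assumption
    by_cases hy : y = v
    · subst hy; simp [this]; omega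
    · simp [this, hy]; omega

section Rotation

variable {v p : Fin n} {m : Option (Fin n)}

theorem rotUp_desc_of_ne (hF : IsForest F) (hv : F v = some p)
    (hm : ∀ c, m = some c → F c = some v) {x : Fin n} (hxv : x ≠ v) (hxp : x ≠ p) :
    desc (rotUp F v p m) x = desc F x := by
  ext u
  rw [mem_desc, mem_desc]
  have hvp : v ≠ p := hF.ne_of_some hv
  refine (isForest_rotUp hF hv hm).induction (fun u ih => ?_) u
  have ev : IsAncestor F x v ↔ IsAncestor F x p := by simp [isAncestor_of_some hv, hxv]
  have hp' : rotUp F v p m p = some v := by simp [rotUp, hvp.symm]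
  by_cases huv : u = v
  · subst huv
    have h : rotUp F u p m u = F p := by simp [rotUp]
    rw [ev, isAncestor_iff, isAncestor_iff (x := p), h]
    simp only [hxv, hxp, false_or]
    exact exists_congr fun y => and_congr_right fun hy => ih y (h.trans hy)
  by_cases hup : u = p
  · subst hup
    have e : IsAncestor (rotUp F v u m) x v ↔ IsAncestor F x v := ih v hp'
    rw [isAncestor_of_some hp', e, ev]; simp [hxp]
  by_cases hum : m = some u
  · have h : rotUp F v p m u = some p := by simp [rotUp, huv, hup, hum]
    have e : IsAncestor (rotUp F v p m) x p ↔ IsAncestor F x p := ih p h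
    rw [isAncestor_of_some h, e, isAncestor_of_some (hm u hum), ev]
  · have h : rotUp F v p m u = F u := by simp [rotUp, huv, hup, hum]
    rw [isAncestor_iff, isAncestor_iff (x := u), h]
    exact or_congr_right (exists_congr fun y => and_congr_right fun hy => ih y (h.trans hy))

theorem rotUp_desc_self (hF : IsForest F) (hv : F v = some p)
    (hm : ∀ c, m = some c → F c = some v) : desc (rotUp F v p m) v = desc F p := by
  ext u
  rw [mem_desc, mem_desc]
  have hvp : v ≠ p := hF.ne_of_some hv
  refine (isForest_rotUp hF hv hm).induction (fun u ih => ?_) u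
  have hp' : rotUp F v p m p = some v := by simp [rotUp, hvp.symm]
  have hpv : IsAncestor F p v := .of_parent hv
  by_cases huv : u = v
  · subst huv
    simp [IsAncestor.refl, hpv]
  by_cases hup : u = p
  · subst hup
    simp [IsAncestor.refl, IsAncestor.of_parent hp']
  by_cases hum : m = some u
  · have h : rotUp F v p m u = some p := by simp [rotUp, huv, hup, hum]
    have h1 : IsAncestor F p u := hpv.trans (.of_parent (hm u hum))
    have h2 : IsAncestor (rotUp F v p m) v u := (IsAncestor.of_parent hp').trans (.of_parent h)
    simp [h1, h2]
  · have h : rotUp F v p m u = F u := by simp [rotUp, huv, hup, hum]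
    rw [isAncestor_iff, isAncestor_iff (x := u), h]
    simp only [Ne.symm huv, Ne.symm hup, false_or]
    exact exists_congr fun y => and_congr_right fun hy => ih y (h.trans hy)

theorem rotUp_rank_of_ne (hF : IsForest F) (hv : F v = some p)
    (hm : ∀ c, m = some c → F c = some v) {x : Fin n} (hxv : x ≠ v) (hxp : x ≠ p) :
    rank (rotUp F v p m) x = rank F x := by
  rw [rank, rank, rotUp_desc_of_ne hF hv hm hxv hxp]

theorem rotUp_rank_self (hF : IsForest F) (hv : F v = some p)
    (hm : ∀ c, m = some c → F c = some v) : rank (rotUp F v p m) v = rank F p := by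
  rw [rank, rank, rotUp_desc_self hF hv hm]

/-- In a rotation only the ranks of `v` and `p` change, and `v` takes over the rank of `p`. -/
theorem pot_rotUp (hF : IsForest F) (hv : F v = some p)
    (hm : ∀ c, m = some c → F c = some v) :
    pot (rotUp F v p m) = pot F + rank (rotUp F v p m) p - rank F v := by
  have hvp : v ≠ p := hF.ne_of_some hv
  have h : pot (rotUp F v p m) - pot F = ∑ x ∈ {v, p}, (rank (rotUp F v p m) x - rank F x) := by
    rw [pot, pot, ← sum_sub_distrib]
    refine (sum_subset (subset_univ _) fun x _ hx => ?_).symm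
    simp only [mem_insert, mem_singleton, not_or] at hx
    rw [rotUp_rank_of_ne hF hv hm hx.1 hx.2, sub_self]
  rw [sum_pair hvp, rotUp_rank_self hF hv hm] at h
  linarith

/-- Rotating `v` does not change the paths that start outside of the subtree of `p`. -/
theorem climb_rotUp_above (hv : F v = some p)
    (hm : ∀ c, m = some c → F c = some v) {x t : Fin n} {k : ℕ} (hx : ¬ IsAncestor F p x)
    (h : climb F k x = some t) : climb (rotUp F v p m) k x = some t := by
  have hpv : IsAncestor F p v := .of_parent hv
  induction k generalizing x with
  | zero => simpa [climb] using h
  | succ k ih =>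
    cases hFx : F x with
    | none => simp [climb, hFx] at h
    | some y =>
      have h1 : x ≠ v := by rintro rfl; exact hx hpv
      have h2 : x ≠ p := by rintro rfl; exact hx (.refl _)
      have h3 : m ≠ some x := fun e => hx (hpv.trans (.of_parent (hm x e)))
      have h4 : rotUp F v p m x = some y := by simp [rotUp, h1, h2, h3, hFx]
      have := ih (x := y) (fun h => hx (h.trans (.of_parent hFx)))
        (by simpa [climb, hFx] using h)
      simpa [climb, h4] using this

theorem climb_rotUp_self (hF : IsForest F) (hv : F v = some p)
    (hm : ∀ c, m = some c → F c = some v) {t : Fin n} {k : ℕ}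
    (h : climb F (k + 1) p = some t) : climb (rotUp F v p m) (k + 1) v = some t := by
  have hv' : rotUp F v p m v = F p := by simp [rotUp]
  cases hp : F p with
  | none => simp [climb, hp] at h
  | some g =>
    have := climb_rotUp_above hv hm (x := g) (k := k) (t := t) (hF.not_isAncestor hp)
      (by simpa [climb, hp] using h)
    simpa [climb, hv', hp] using this

theorem climb_rotUp_of_not (hv : F v = some p)
    (hm : ∀ c, m = some c → F c = some v) {x t : Fin n} {k : ℕ} (hvt : ¬ IsAncestor F t v) (h : climb F k x = some t) :
    climb (rotUp F v p m) k x = some t := by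
  induction k generalizing x with
  | zero => simpa [climb] using h
  | succ k ih =>
    cases hFx : F x with
    | none => simp [climb, hFx] at h
    | some y =>
      have h0 : climb F k y = some t := by simpa [climb, hFx] using h
      have h1 : x ≠ v := by rintro rfl; exact hvt ⟨_, h⟩
      have h2 : x ≠ p := by
        rintro rfl; exact hvt ((isAncestor_of_some hv).2 (Or.inr ⟨_, h⟩))
      have h3 : m ≠ some x := fun e => hvt (by
        have := hm x e; rw [hFx] at this; cases this; exact ⟨_, h0⟩)
      have h4 : rotUp F v p m x = some y := by simp [rotUp, h1, h2, h3, hFx]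
      simpa [climb, h4] using ih h0

end Rotation

end DPF

namespace DPF

open Finset

variable {n : ℕ}

/-! ### Link-cut trees described by local conditions -/

/-- The pointers of a link-cut tree: `ch false` and `ch true` are the left and right children in
the splay trees, `up` the parents and path-parents, `sz v` is the number of nodes of the splay
subtree of `v`, and `ext false v` and `ext true v` are its leftmost and rightmost nodes. The
component `ext` is not stored on the machine. -/
structure LCState (n : ℕ) where
  ch : Bool → Fin n → Option (Fin n)
  up : Fin n → Option (Fin n)
  sz : Fin n → ℕ
  ext : Bool → Fin n → Fin n

/-- The size of an optional subtree. -/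
def optSize (g : Fin n → ℕ) : Option (Fin n) → ℕ
  | none => 0
  | some v => g v

@[simp] theorem optSize_none (g : Fin n → ℕ) : optSize g none = 0 := rfl
@[simp] theorem optSize_some (g : Fin n → ℕ) (v : Fin n) : optSize g (some v) = g v := rfl

/-- `b` is next to `a` on a path of the forest `P`: below `a` if `d` is `true`, above `a` if `d`
is `false`. -/
def PathAdj (P : Fin n → Option (Fin n)) (d : Bool) (a b : Fin n) : Prop :=
  if d then P b = some a else P a = some b

/-- The pointers form a link-cut tree of the forest `P`. All conditions but acyclicity concern
a node and its neighbours only, so that a rotation has to be checked only where it changes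
pointers; in-order adjacency is expressed by the extreme nodes of the subtrees. -/
structure Valid (S : LCState n) (P : Fin n → Option (Fin n)) : Prop where
  forest : IsForest P
  up_forest : IsForest S.up
  up_ch : ∀ {d p v}, S.ch d p = some v → S.up v = some p
  ch_inj : ∀ {p v d e}, S.ch d p = some v → S.ch e p = some v → d = e
  sz_eq : ∀ v, S.sz v = 1 + optSize S.sz (S.ch false v) + optSize S.sz (S.ch true v)
  ext_none : ∀ {d v}, S.ch d v = none → S.ext d v = v
  ext_some : ∀ {d v c}, S.ch d v = some c → S.ext d v = S.ext d c
  adj : ∀ {d v c}, S.ch d v = some c → PathAdj P d v (S.ext (!d) c)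
  root : ∀ {v}, (∀ d p, S.ch d p ≠ some v) → P (S.ext false v) = S.up v

namespace LCState

variable (S : LCState n)

open Classical in
/-- The parent function of the splay trees: the roots have no parent. -/
noncomputable def sup (v : Fin n) : Option (Fin n) :=
  if ∃ d p, S.ch d p = some v then S.up v else none

/-- The rotation of `v`, the child of `p` on the side `d`, above `p`. -/
def rot (d : Bool) (v p : Fin n) : LCState n where
  ch e x :=
    if e = d ∧ x = p then S.ch (!d) v
    else if e = !d ∧ x = v then some p
    else if S.ch e x = some p then some v
    else S.ch e x
  up := rotUp S.up v p (S.ch (!d) v)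
  sz x :=
    if x = v then S.sz p
    else if x = p then 1 + optSize S.sz (S.ch (!d) v) + optSize S.sz (S.ch (!d) p)
    else S.sz x
  ext e x :=
    if x = v then S.ext e p
    else if x = p then
      if e = d then (match S.ch (!d) v with | none => p | some m => S.ext d m)
      else S.ext e p
    else S.ext e x

end LCState

namespace Valid

variable {S : LCState n} {P : Fin n → Option (Fin n)}

theorem sup_eq_some_iff (h : Valid S P) {v p : Fin n} :
    S.sup v = some p ↔ ∃ d, S.ch d p = some v := by
  unfold LCState.sup
  constructor
  · intro hs
    split_ifs at hs with hc
    obtain ⟨d, q, hq⟩ := hc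
    have := h.up_ch hq
    rw [hs] at this; cases this
    exact ⟨d, hq⟩
  · rintro ⟨d, hd⟩
    rw [if_pos ⟨d, p, hd⟩, h.up_ch hd]

theorem sup_eq_none_iff (h : Valid S P) {v : Fin n} :
    S.sup v = none ↔ ∀ d p, S.ch d p ≠ some v := by
  rw [Option.eq_none_iff_forall_ne_some]
  constructor
  · intro hs d p hd
    exact hs p (h.sup_eq_some_iff.2 ⟨d, hd⟩)
  · intro hs p hp
    obtain ⟨d, hd⟩ := h.sup_eq_some_iff.1 hp
    exact hs d p hd

theorem sup_of_ch (h : Valid S P) {d : Bool} {v p : Fin n} (hc : S.ch d p = some v) :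
    S.sup v = some p := h.sup_eq_some_iff.2 ⟨d, hc⟩

theorem up_of_sup (h : Valid S P) {v p : Fin n} (hs : S.sup v = some p) : S.up v = some p := by
  obtain ⟨d, hd⟩ := h.sup_eq_some_iff.1 hs
  exact h.up_ch hd

theorem sup_forest (h : Valid S P) : IsForest S.sup := by
  obtain ⟨r, hr⟩ := h.up_forest.exists_rank
  exact isForest_of_rank r fun x y hxy => hr x y (h.up_of_sup hxy)

theorem root' (h : Valid S P) {v : Fin n} (hv : S.sup v = none) :
    P (S.ext false v) = S.up v := h.root (h.sup_eq_none_iff.1 hv)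

theorem sz_eq' (h : Valid S P) (d : Bool) (v : Fin n) :
    S.sz v = 1 + optSize S.sz (S.ch d v) + optSize S.sz (S.ch (!d) v) := by
  rw [h.sz_eq v]; cases d <;> simp; omega

/-- The nodes and pointers involved in a rotation: `v` is the child of `p` on the side `d`. -/
theorem rot_ch_cases (h : Valid S P) {d e : Bool} {v p x y : Fin n} (hv : S.ch d p = some v)
    (hxy : (S.rot d v p).ch e x = some y) :
    (e = d ∧ x = p ∧ S.ch (!d) v = some y ∧ y ≠ v ∧ y ≠ p) ∨ (e = !d ∧ x = v ∧ y = p) ∨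
      (S.ch e x = some p ∧ y = v ∧ x ≠ p ∧ x ≠ v) ∨
      (S.ch e x = some y ∧ y ≠ v ∧ y ≠ p ∧ S.ch (!d) v ≠ some y) := by
  have hup := h.up_ch hv
  have hvp : v ≠ p := h.up_forest.ne_of_some hup
  simp only [LCState.rot] at hxy
  split_ifs at hxy with h1 h2 h3
  · obtain ⟨rfl, rfl⟩ := h1
    refine Or.inl ⟨rfl, rfl, hxy, ?_, ?_⟩
    · rintro rfl; exact h.up_forest.ne_of_some (h.up_ch hxy) rfl
    · rintro rfl; exact h.up_forest.not_isAncestor hup (.of_parent (h.up_ch hxy))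
  · obtain ⟨rfl, rfl⟩ := h2
    cases hxy
    exact Or.inr (Or.inl ⟨rfl, rfl, rfl⟩)
  · cases hxy
    refine Or.inr (Or.inr (Or.inl ⟨h3, rfl, ?_, ?_⟩))
    · rintro rfl; exact h.up_forest.ne_of_some (h.up_ch h3) rfl
    · rintro rfl; exact h.up_forest.not_isAncestor hup (.of_parent (h.up_ch h3))
  · refine Or.inr (Or.inr (Or.inr ⟨hxy, ?_, ?_, ?_⟩))
    · rintro rfl
      have e1 := h.up_ch hxy
      rw [hup] at e1; cases e1
      exact h1 ⟨h.ch_inj hxy hv, rfl⟩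
    · rintro rfl; exact h3 hxy
    · intro hm
      have e1 := h.up_ch hxy
      rw [h.up_ch hm] at e1; cases e1
      exact h2 ⟨h.ch_inj hxy hm, rfl⟩

theorem rot_ch_lower (S : LCState n) (d : Bool) (v p : Fin n) :
    (S.rot d v p).ch d p = S.ch (!d) v := by
  simp [LCState.rot]

theorem rot_ch_upper (S : LCState n) (d : Bool) (v p : Fin n) :
    (S.rot d v p).ch (!d) v = some p := by
  simp [LCState.rot]

theorem rot_ch_parent (h : Valid S P) {d e : Bool} {v p x : Fin n} (hv : S.ch d p = some v)
    (hx : S.ch e x = some p) : (S.rot d v p).ch e x = some v := by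
  have h1 : x ≠ p := by rintro rfl; exact h.up_forest.ne_of_some (h.up_ch hx) rfl
  have h2 : x ≠ v := by
    rintro rfl; exact h.up_forest.not_isAncestor (h.up_ch hv) (.of_parent (h.up_ch hx))
  simp [LCState.rot, h1, h2, hx]

theorem rot_ch_other (_ : Valid S P) {d e : Bool} {v p x y : Fin n} (hv : S.ch d p = some v)
    (hx : S.ch e x = some y) (hyv : y ≠ v) (hyp : y ≠ p) (hm : S.ch (!d) v ≠ some y) :
    (S.rot d v p).ch e x = some y := by
  have h1 : ¬ (e = d ∧ x = p) := by
    rintro ⟨rfl, rfl⟩; rw [hv] at hx; cases hx; exact hyv rfl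
  have h2 : ¬ (e = !d ∧ x = v) := by
    rintro ⟨rfl, rfl⟩; exact hm hx
  have h3 : S.ch e x ≠ some p := by rw [hx]; simpa using hyp
  simp only [LCState.rot]
  rw [if_neg h1, if_neg h2, if_neg h3, hx]

/-- A rotation preserves the link-cut tree of `P`. -/
theorem rot (h : Valid S P) {d : Bool} {v p : Fin n} (hv : S.ch d p = some v) :
    Valid (S.rot d v p) P := by
  have hup := h.up_ch hv
  have hvp : v ≠ p := h.up_forest.ne_of_some hup
  have hm : ∀ c, S.ch (!d) v = some c → S.up c = some v := fun c hc => h.up_ch hc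
  have ext_v : ∀ e, (S.rot d v p).ext e v = S.ext e p := fun e => by simp [LCState.rot]
  have ext_x : ∀ e x, x ≠ v → x ≠ p → (S.rot d v p).ext e x = S.ext e x := fun e x h1 h2 => by
    simp [LCState.rot, h1, h2]
  have ext_p : (S.rot d v p).ext (!d) p = S.ext (!d) p := by simp [LCState.rot, hvp.symm]
  have ext_p0 : S.ch (!d) v = none → (S.rot d v p).ext d p = p := fun h0 => by
    simp [LCState.rot, hvp.symm, h0]
  have ext_p1 : ∀ m, S.ch (!d) v = some m → (S.rot d v p).ext d p = S.ext d m :=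
    fun m h0 => by simp [LCState.rot, hvp.symm, h0]
  constructor
  · exact h.forest
  · exact isForest_rotUp h.up_forest hup hm
  · intro e x y hxy
    show rotUp S.up v p (S.ch (!d) v) y = some x
    rcases h.rot_ch_cases hv hxy with ⟨rfl, rfl, h1, h2, h3⟩ | ⟨rfl, rfl, rfl⟩ |
      ⟨h1, rfl, h2, h3⟩ | ⟨h1, h2, h3, h4⟩
    · simp [rotUp, h1, h2, h3]
    · simp [rotUp, hvp.symm]
    · simp [rotUp, h.up_ch h1]
    · simp [rotUp, h2, h3, h4, h.up_ch h1]
  · intro x y e e' h1 h2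
    have h3 := @h.up_ch
    have h4 := @h.ch_inj
    simp only [LCState.rot] at h1 h2
    cases d <;> cases e <;> cases e' <;> grind
  · intro x
    have key : ∀ o, o ≠ some v → o ≠ some p →
        optSize (S.rot d v p).sz o = optSize S.sz o := by
      rintro (_ | y) h1 h2
      · rfl
      · simp only [ne_eq, Option.some.injEq] at h1 h2
        simp [LCState.rot, h1, h2]
    have hnot : ∀ e x y, S.ch e x = some y → y ≠ x := by
      rintro e x _ h1 rfl; exact h.up_forest.ne_of_some (h.up_ch h1) rfl
    have hmp : S.ch (!d) v ≠ some p := fun h1 =>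
      h.up_forest.not_isAncestor hup (.of_parent (h.up_ch h1))
    have hpv : S.ch (!d) p ≠ some v := fun h1 => by
      have := h.ch_inj h1 hv; cases d <;> simp at this
    suffices H : (S.rot d v p).sz x = 1 + optSize (S.rot d v p).sz ((S.rot d v p).ch d x) +
        optSize (S.rot d v p).sz ((S.rot d v p).ch (!d) x) by
      rw [H]; cases d <;> simp; omega
    have hdd : (d = !d) = False := by cases d <;> simp
    have hdd' : ((!d) = d) = False := by cases d <;> simp
    have szv : (S.rot d v p).sz v = S.sz p := by simp [LCState.rot]
    have szp : (S.rot d v p).sz p = 1 + optSize S.sz (S.ch (!d) v) + optSize S.sz (S.ch (!d) p) := by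
      simp [LCState.rot, hvp.symm]
    have chdv : (S.rot d v p).ch d v = S.ch d v := by
      have : S.ch d v ≠ some p := fun h1 =>
        h.up_forest.not_isAncestor hup (.of_parent (h.up_ch h1))
      simp [LCState.rot, hvp, hdd, this]
    have chdp : (S.rot d v p).ch (!d) p = S.ch (!d) p := by
      have : S.ch (!d) p ≠ some p := fun h1 => hnot _ _ _ h1 rfl
      simp [LCState.rot, hvp.symm, this]
    by_cases hxv : x = v
    · subst hxv
      have h5 : S.ch d x ≠ some p := fun h1 =>
        h.up_forest.not_isAncestor hup (.of_parent (h.up_ch h1))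
      have h6 : S.ch d x ≠ some x := fun h1 => hnot _ _ _ h1 rfl
      rw [szv, chdv, rot_ch_upper, key _ h6 h5, optSize_some, szp, h.sz_eq' d p, hv, optSize_some,
        h.sz_eq' d x]
      omega
    by_cases hxp : x = p
    · subst hxp
      rw [szp, chdp, rot_ch_lower, key _ (fun h1 => hnot _ _ _ h1 rfl) hmp,
        key _ hpv (fun h1 => hnot _ _ _ h1 rfl)]
    have hx : (S.rot d v p).sz x = S.sz x := by simp [LCState.rot, hxv, hxp]
    have hc : ∀ e, optSize (S.rot d v p).sz ((S.rot d v p).ch e x) = optSize S.sz (S.ch e x) := by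
      intro e
      by_cases h1 : S.ch e x = some p
      · rw [h.rot_ch_parent hv h1, h1, optSize_some, optSize_some, szv]
      · have h2 : (S.rot d v p).ch e x = S.ch e x := by simp [LCState.rot, hxv, hxp, h1]
        rw [h2]
        refine key _ (fun h3 => hxp ?_) h1
        have := h.up_ch h3
        rw [hup] at this; cases this; rfl
    rw [hx, hc, hc, ← h.sz_eq' d x]
  · intro e x hx
    have h1 := @h.up_ch
    have h2 := @h.ext_none
    have h3 := @h.ext_some
    simp only [LCState.rot] at hx ⊢
    cases d <;> cases e <;> grind
  · intro e x c hx
    have h1 := @h.up_ch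
    have h2 := @h.ext_none
    have h3 := @h.ext_some
    simp only [LCState.rot] at hx ⊢
    cases d <;> cases e <;> grind
  · intro e x c hx
    rcases h.rot_ch_cases hv hx with ⟨rfl, rfl, h1, h2, h3⟩ | ⟨rfl, rfl, rfl⟩ |
      ⟨h1, rfl, h2, h3⟩ | ⟨h1, h2, h3, h4⟩
    · rw [ext_x _ _ h2 h3, ← h.ext_some h1]
      exact h.adj hv
    · rw [Bool.not_not]
      cases hmo : S.ch (!d) x with
      | none =>
        have := h.adj hv
        rw [h.ext_none hmo] at this
        rw [ext_p0 hmo]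
        cases d <;> simpa [PathAdj] using this
      | some m => rw [ext_p1 m hmo]; simpa using h.adj hmo
    · rw [ext_v]; exact h.adj h1
    · rw [ext_x _ _ h2 h3]; exact h.adj h1
  · intro x hx
    by_cases hxv : x = v
    · subst hxv
      rw [ext_v, h.root fun e q hq => hx e q (h.rot_ch_parent hv hq)]
      simp [LCState.rot, rotUp]
    have hxp : x ≠ p := by rintro rfl; exact hx _ _ (rot_ch_upper S d v x)
    have hxm : S.ch (!d) v ≠ some x := fun h1 => hx _ _ ((rot_ch_lower S d v p).trans h1)
    rw [ext_x _ _ hxv hxp, h.root fun e q hq => hx e q (h.rot_ch_other hv hq hxv hxp hxm)]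
    simp [LCState.rot, rotUp, hxv, hxp, hxm]

/-- A rotation acts on the parent function of the splay trees as it does on all parents. -/
theorem rot_sup (h : Valid S P) {d : Bool} {v p : Fin n} (hv : S.ch d p = some v) :
    (S.rot d v p).sup = rotUp S.sup v p (S.ch (!d) v) := by
  have hr := h.rot hv
  have hvp : v ≠ p := h.up_forest.ne_of_some (h.up_ch hv)
  funext x
  by_cases hxv : x = v
  · subst hxv
    have e1 : rotUp S.sup x p (S.ch (!d) x) x = S.sup p := by simp [rotUp]
    rw [e1]
    cases hp : S.sup p with
    | none =>
      rw [hr.sup_eq_none_iff]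
      intro e q hq
      rcases h.rot_ch_cases hv hq with ⟨_, _, _, h2, _⟩ | ⟨_, _, h2⟩ | ⟨h1, _⟩ | ⟨_, h2, _⟩
      · exact h2 rfl
      · exact hvp h2
      · exact h.sup_eq_none_iff.1 hp _ _ h1
      · exact h2 rfl
    | some g =>
      obtain ⟨e, he⟩ := h.sup_eq_some_iff.1 hp
      exact hr.sup_of_ch (h.rot_ch_parent hv he)
  by_cases hxp : x = p
  · subst hxp
    rw [hr.sup_of_ch (rot_ch_upper S d v x)]
    simp [rotUp, hvp.symm]
  by_cases hxm : S.ch (!d) v = some x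
  · rw [hr.sup_of_ch ((rot_ch_lower S d v p).trans hxm)]
    simp [rotUp, hxv, hxp, hxm]
  have e1 : rotUp S.sup v p (S.ch (!d) v) x = S.sup x := by simp [rotUp, hxv, hxp, hxm]
  rw [e1]
  cases hx : S.sup x with
  | none =>
    rw [hr.sup_eq_none_iff]
    intro e q hq
    rcases h.rot_ch_cases hv hq with ⟨_, _, h2, _⟩ | ⟨_, _, h2⟩ | ⟨_, h2, _⟩ | ⟨h2, _⟩
    · exact hxm h2
    · exact hxp h2
    · exact hxv h2
    · exact h.sup_eq_none_iff.1 hx _ _ h2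
  | some g =>
    obtain ⟨e, he⟩ := h.sup_eq_some_iff.1 hx
    exact hr.sup_of_ch (h.rot_ch_other hv he hxv hxp hxm)

end Valid

end DPF

namespace DPF

open Finset

variable {n : ℕ}

namespace Valid

variable {S : LCState n} {P : Fin n → Option (Fin n)}

/-! ### Consequences of the local conditions -/

theorem sz_lt (h : Valid S P) {d : Bool} {v c : Fin n} (hc : S.ch d v = some c) :
    S.sz c < S.sz v := by
  have := h.sz_eq' d v
  rw [hc, optSize_some] at this; omega

theorem sz_pos (h : Valid S P) (v : Fin n) : 0 < S.sz v := by
  have := h.sz_eq v; omega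

/-- Induction from the leaves of the splay trees upwards. -/
@[elab_as_elim]
theorem child_induction (h : Valid S P) {p : Fin n → Prop}
    (step : ∀ v, (∀ d c, S.ch d v = some c → p c) → p v) (v : Fin n) : p v := by
  induction hv : S.sz v using Nat.strong_induction_on generalizing v with
  | _ k ih => exact step v fun d c hc => ih _ (hv ▸ h.sz_lt hc) c rfl

theorem parent_ext (h : Valid S P) {v c : Fin n} (hc : S.ch true v = some c) :
    P (S.ext false c) = some v := by simpa [PathAdj] using h.adj hc

theorem parent_eq_ext (h : Valid S P) {v c : Fin n} (hc : S.ch false v = some c) :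
    P v = some (S.ext true c) := by simpa [PathAdj] using h.adj hc

theorem isAncestor_ext (h : Valid S P) (v : Fin n) :
    IsAncestor P (S.ext false v) v ∧ IsAncestor P v (S.ext true v) := by
  refine h.child_induction (fun v ih => ?_) v
  constructor
  · cases hc : S.ch false v with
    | none => rw [h.ext_none hc]; exact .refl _
    | some c =>
      rw [h.ext_some hc]
      exact ((ih _ _ hc).1.trans (ih _ _ hc).2).trans (.of_parent (h.parent_eq_ext hc))
  · cases hc : S.ch true v with
    | none => rw [h.ext_none hc]; exact .refl _
    | some c =>
      rw [h.ext_some hc]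
      exact (IsAncestor.of_parent (h.parent_ext hc)).trans ((ih _ _ hc).1.trans (ih _ _ hc).2)

/-- The depths of the nodes of a splay subtree are consecutive. -/
theorem hasDepth_ext (h : Valid S P) (v : Fin n) {b : ℕ} (hb : HasDepth P (S.ext false v) b) :
    HasDepth P v (b + optSize S.sz (S.ch false v)) ∧
      HasDepth P (S.ext true v) (b + (S.sz v - 1)) := by
  induction v using h.child_induction generalizing b with
  | step v ih =>
  have h1 : HasDepth P v (b + optSize S.sz (S.ch false v)) := by
    cases hc : S.ch false v with
    | none => rwa [h.ext_none hc] at hb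
    | some c =>
      rw [h.ext_some hc] at hb
      have := (ih _ _ hc hb).2
      have hp := h.sz_pos c
      rw [optSize_some, show b + S.sz c = b + (S.sz c - 1) + 1 by omega,
        HasDepth.succ_iff (h.parent_eq_ext hc)]
      exact this
  refine ⟨h1, ?_⟩
  have hsz := h.sz_eq v
  cases hc : S.ch true v with
  | none =>
    rw [hc, optSize_none] at hsz
    rw [h.ext_none hc, show b + (S.sz v - 1) = b + optSize S.sz (S.ch false v) by omega]
    exact h1
  | some c =>
    rw [hc, optSize_some] at hsz
    have h2 := (ih _ _ hc ((HasDepth.succ_iff (h.parent_ext hc)).2 h1)).2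
    have hp := h.sz_pos c
    rw [h.ext_some hc]
    convert h2 using 1; omega

/-- Splay subtrees are contained in virtual subtrees, and so `sz` fits into a machine word. -/
theorem sz_le_card (h : Valid S P) (v : Fin n) : S.sz v ≤ (desc S.up v).card := by
  refine h.child_induction (fun v ih => ?_) v
  rw [h.sz_eq v]
  cases hl : S.ch false v with
  | none =>
    cases hr : S.ch true v with
    | none => simpa using card_desc_pos v
    | some r =>
      have h1 := h.up_forest.card_lt (h.up_ch hr)
      have h2 := ih _ _ hr
      simp only [optSize_none, optSize_some]; omega
  | some l =>
    cases hr : S.ch true v with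
    | none =>
      have h1 := h.up_forest.card_lt (h.up_ch hl)
      have h2 := ih _ _ hl
      simp only [optSize_none, optSize_some]; omega
    | some r =>
      have hne : l ≠ r := by
        rintro rfl; exact absurd (h.ch_inj hl hr) (by simp)
      have h1 := h.up_forest.card_add_card_lt (h.up_ch hl) (h.up_ch hr) hne
      have h2 := ih _ _ hr
      have h3 := ih _ _ hl
      simp only [optSize_some]; omega

theorem sz_le (h : Valid S P) (v : Fin n) : S.sz v ≤ n := (h.sz_le_card v).trans (card_desc_le v)

theorem root_iff_of_isAncestor {a b r : Fin n} (h : IsAncestor P a b) (hr : P r = none) :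
    IsAncestor P r a ↔ IsAncestor P r b := by
  refine ⟨fun h1 => h1.trans h, fun h1 => ?_⟩
  rcases h1.total h with h2 | h2
  · exact h2
  · rw [(isAncestor_of_none hr).1 h2]; exact .refl _

/-- Nodes of one virtual tree lie in one tree of the forest. -/
theorem root_iff_of_isAncestor_up (h : Valid S P) {a b r : Fin n} (hr : P r = none)
    (hab : IsAncestor S.up a b) : IsAncestor P r a ↔ IsAncestor P r b := by
  induction b using h.up_forest.induction with
  | step b ih =>
  rcases isAncestor_iff.1 hab with rfl | ⟨c, hc, hac⟩
  · rfl
  rw [ih c hc hac]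
  have hb := h.isAncestor_ext b
  have e1 := root_iff_of_isAncestor hb.1 hr
  have e2 := root_iff_of_isAncestor hb.2 hr
  cases hs : S.sup b with
  | none =>
    have h1 := h.root' hs
    rw [hc] at h1
    rw [root_iff_of_isAncestor (.of_parent h1) hr, e1]
  | some c' =>
    have := h.up_of_sup hs
    rw [hc] at this; cases this
    obtain ⟨d, hd⟩ := h.sup_eq_some_iff.1 hs
    cases d with
    | false => rw [← root_iff_of_isAncestor (.of_parent (h.parent_eq_ext hd)) hr, ← e2]
    | true => rw [root_iff_of_isAncestor (.of_parent (h.parent_ext hd)) hr, e1]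

theorem isAncestor_sup_ext (h : Valid S P) (e : Bool) (v : Fin n) :
    IsAncestor S.sup v (S.ext e v) := by
  refine h.child_induction (fun v ih => ?_) v
  cases hc : S.ch e v with
  | none => rw [h.ext_none hc]; exact .refl _
  | some c =>
    rw [h.ext_some hc]
    exact (IsAncestor.of_parent (h.sup_of_ch hc)).trans (ih _ _ hc)

theorem sup_of_up_none (_ : Valid S P) {v : Fin n} (hv : S.up v = none) : S.sup v = none := by
  unfold LCState.sup; split_ifs <;> simp [hv]

theorem isAncestor_up_of_sup (h : Valid S P) {a b : Fin n} (hab : IsAncestor S.sup a b) :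
    IsAncestor S.up a b := by
  induction b using h.sup_forest.induction with
  | step b ih =>
  rcases isAncestor_iff.1 hab with rfl | ⟨c, hc, hac⟩
  · exact .refl _
  · exact (ih c hc hac).trans (.of_parent (h.up_of_sup hc))

theorem exists_sup_root (h : Valid S P) (v : Fin n) :
    ∃ k r, climb S.sup k v = some r ∧ S.sup r = none := h.sup_forest.exists_hasDepth v

end Valid

/-! ### The stored trees -/

/-- The array that holds the children on the side `d`. -/
def sideArr (d : Bool) : ℕ := if d then 2 else 1

/-- The arrays `1`, `2`, `3` and `5` hold the children, the parents and the subtree sizes. The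
cells `0` of the arrays of children and sizes are `0`, so that NULL behaves as an empty
tree; the cell `0` of the array of parents is arbitrary. -/
structure Rep (σ : Store) (S : LCState n) : Prop where
  side : ∀ d v, σ.arr (sideArr d) (nodeWord v) = optWord (S.ch d v)
  up : ∀ v, σ.arr 3 (nodeWord v) = optWord (S.up v)
  sz : ∀ v, σ.arr 5 (nodeWord v) = S.sz v
  side_zero : ∀ d, σ.arr (sideArr d) 0 = 0
  sz_zero : σ.arr 5 0 = 0

theorem mem_inorder_of_isChain {P : Fin n → Option (Fin n)} {l : List (Fin n)}
    (hl : l.IsChain fun u v => P v = some u) (hh : ∀ h, l.head? = some h → P h = none)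
    {x y : Fin n} (hx : x ∈ l) (hxy : P x = some y) : y ∈ l := by
  obtain ⟨i, hi, rfl⟩ := List.getElem_of_mem hx
  cases i with
  | zero =>
    rw [hh l[0] (by rw [List.head?_eq_getElem?, List.getElem?_eq_getElem hi])] at hxy
    cases hxy
  | succ i =>
    have := List.isChain_iff_getElem.1 hl i hi
    rw [hxy] at this; cases this
    exact List.getElem_mem _

theorem isAncestor_getLast_of_isChain {P : Fin n → Option (Fin n)} {l : List (Fin n)}
    (hl : l.IsChain fun u v => P v = some u) {x z : Fin n} (hx : x ∈ l)
    (hz : l.getLast? = some z) : IsAncestor P x z := by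
  induction l generalizing x with
  | nil => cases hx
  | cons a l ih =>
    cases l with
    | nil =>
      simp only [List.mem_singleton, List.getLast?_singleton, Option.some.injEq] at hx hz
      subst hx; subst hz; exact .refl _
    | cons b l =>
      rw [List.isChain_cons_cons] at hl
      rw [List.getLast?_cons_cons] at hz
      rcases List.mem_cons.1 hx with rfl | hx
      · exact (IsAncestor.of_parent hl.1).trans (ih hl.2 (by simp) hz)
      · exact ih hl.2 hx hz

theorem IsForest.nodup_of_isChain {P : Fin n → Option (Fin n)} (hP : IsForest P)
    {l : List (Fin n)} (hl : l.IsChain fun u v => P v = some u) : l.Nodup := by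
  obtain ⟨r, hr⟩ := hP.exists_rank
  have h1 : l.IsChain fun u v => r u < r v := hl.imp fun u v h => hr v u h
  have : IsTrans (Fin n) fun u v => r u < r v := ⟨fun _ _ _ => lt_trans⟩
  refine h1.pairwise.imp fun h e => ?_
  rw [e] at h; exact lt_irrefl _ h

namespace Valid

variable {S : LCState n} {P : Fin n → Option (Fin n)}

/-- The splay subtree of `v` as a binary tree. -/
theorem exists_tree (h : Valid S P) {σ : Store} (hσ : Rep σ S) (v : Fin n) :
    ∃ t : BinaryTree (Fin n), rootNode t = some v ∧ Stored σ t ∧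
      (inorder t).IsChain (fun u v => P v = some u) ∧ (inorder t).head? = some (S.ext false v) ∧
      (inorder t).getLast? = some (S.ext true v) ∧
      ∀ u, u ∈ inorder t ↔ IsAncestor S.sup v u := by
  refine h.child_induction (fun v ih => ?_) v
  have side : ∀ d, ∃ t : BinaryTree (Fin n), rootNode t = S.ch d v ∧ Stored σ t ∧
      (inorder t).IsChain (fun u v => P v = some u) ∧
      (∀ x, x ∈ (inorder t).head? ↔ ∃ c, S.ch d v = some c ∧ S.ext false c = x) ∧
      (∀ x, x ∈ (inorder t).getLast? ↔ ∃ c, S.ch d v = some c ∧ S.ext true c = x) ∧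
      ∀ u, u ∈ inorder t ↔ ∃ c, S.ch d v = some c ∧ IsAncestor S.sup c u := by
    intro d
    cases hc : S.ch d v with
    | none => exact ⟨.nil, by simp [rootNode, Stored, inorder]⟩
    | some c =>
      obtain ⟨t, h1, h2, h3, h4, h5, h6⟩ := ih d c hc
      refine ⟨t, h1, h2, h3, ?_, ?_, ?_⟩ <;> simp [h4, h5, h6]
  obtain ⟨l, l1, l2, l3, l4, l5, l6⟩ := side false
  obtain ⟨r, r1, r2, r3, r4, r5, r6⟩ := side true
  have key : ∀ d c, S.ch d v = some c → σ.up c = nodeWord v := fun d c hc => by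
    have := hσ.up c
    rw [h.up_ch hc] at this; exact this
  refine ⟨.node v l r, rfl, ⟨?_, ?_, ?_, ?_, l2, r2⟩, ?_, ?_, ?_, ?_⟩
  · rw [l1]; exact hσ.side false v
  · rw [r1]; exact hσ.side true v
  · intro u hu; exact key false u (l1 ▸ hu)
  · intro u hu; exact key true u (r1 ▸ hu)
  · rw [inorder, List.isChain_append]
    refine ⟨l3, ?_, ?_⟩
    · rw [List.isChain_cons]
      refine ⟨fun y hy => ?_, r3⟩
      obtain ⟨c, hc, rfl⟩ := (r4 y).1 hy
      exact h.parent_ext hc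
    · intro x hx y hy
      obtain ⟨c, hc, rfl⟩ := (l5 x).1 hx
      simp only [List.head?_cons, Option.mem_some_iff] at hy
      subst hy
      exact h.parent_eq_ext hc
  · rw [inorder, List.head?_append]
    cases hc : S.ch false v with
    | none =>
      have : (inorder l).head? = none := by
        rw [Option.eq_none_iff_forall_not_mem]; intro x; rw [l4]; simp [hc]
      simp [this, h.ext_none hc]
    | some c =>
      have : (inorder l).head? = some (S.ext false c) := (l4 _).2 ⟨c, hc, rfl⟩
      simp [this, h.ext_some hc]
  · rw [inorder, List.getLast?_append, List.getLast?_cons]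
    cases hc : S.ch true v with
    | none =>
      have : (inorder r).getLast? = none := by
        rw [Option.eq_none_iff_forall_not_mem]; intro x; rw [r5]; simp [hc]
      simp [this, h.ext_none hc]
    | some c =>
      have : (inorder r).getLast? = some (S.ext true c) := (r5 _).2 ⟨c, hc, rfl⟩
      simp [this, h.ext_some hc]
  · intro u
    rw [inorder, List.mem_append, List.mem_cons, l6, r6]
    constructor
    · rintro (⟨c, hc, hu⟩ | rfl | ⟨c, hc, hu⟩)
      · exact (IsAncestor.of_parent (h.sup_of_ch hc)).trans hu
      · exact .refl _
      · exact (IsAncestor.of_parent (h.sup_of_ch hc)).trans hu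
    · intro hu
      induction u using h.sup_forest.induction with
      | step u ihu =>
      rcases isAncestor_iff.1 hu with rfl | ⟨y, hy, hvy⟩
      · exact Or.inr (Or.inl rfl)
      · have hyu : IsAncestor S.sup y u := .of_parent hy
        rcases ihu y hy hvy with ⟨c, hc, hcy⟩ | rfl | ⟨c, hc, hcy⟩
        · exact Or.inl ⟨c, hc, hcy.trans hyu⟩
        · obtain ⟨d, hd⟩ := h.sup_eq_some_iff.1 hy
          cases d
          · exact Or.inl ⟨u, hd, .refl _⟩
          · exact Or.inr (Or.inr ⟨u, hd, .refl _⟩)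
        · exact Or.inr (Or.inr ⟨c, hc, hcy.trans hyu⟩)

/-- The store holds a link-cut tree; the path from the root to a node that is the last one of the
topmost path is a preferred path. -/
theorem isLinkCut (h : Valid S P) {σ : Store} (hσ : Rep σ S) :
    ∃ ts : List (BinaryTree (Fin n)), IsLinkCut σ P ts ∧
      ∀ x, S.up x = none → IsAccessed P ts (S.ext true x) := by
  classical
  choose T hT using fun v => h.exists_tree hσ v
  refine ⟨((List.finRange n).filter fun v => S.sup v = none).map T, ⟨h.forest, ?_, ?_, ?_, ?_⟩, ?_⟩
  · intro v
    refine List.count_eq_one_of_mem ?_ ?_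
    · rw [List.flatMap_map, List.nodup_flatMap]
      refine ⟨fun x _ => h.forest.nodup_of_isChain (hT x).2.2.1, ?_⟩
      refine List.Pairwise.imp_of_mem ?_ ((List.nodup_finRange n).filter _)
      intro a b ha hb hab x hxa hxb
      simp only [List.mem_filter, List.mem_finRange, true_and, decide_eq_true_eq] at ha hb
      exact hab (root_unique ha hb (((hT a).2.2.2.2.2 x).1 hxa) (((hT b).2.2.2.2.2 x).1 hxb))
    · obtain ⟨k, r, hr, hr'⟩ := h.exists_sup_root v
      rw [List.flatMap_map, List.mem_flatMap]
      exact ⟨r, by simp [hr'], ((hT r).2.2.2.2.2 v).2 ⟨k, hr⟩⟩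
  · intro t ht
    obtain ⟨v, -, rfl⟩ := List.mem_map.1 ht
    exact (hT v).2.1
  · intro t ht
    obtain ⟨v, -, rfl⟩ := List.mem_map.1 ht
    exact (hT v).2.2.1
  · intro t ht u hu
    obtain ⟨v, hv, rfl⟩ := List.mem_map.1 ht
    simp only [List.mem_filter, List.mem_finRange, true_and, decide_eq_true_eq] at hv
    rw [(hT v).1] at hu; cases hu
    rw [(hT u).2.2.2.1, Option.bind_some, h.root' hv]
    exact hσ.up u
  · intro x hx
    have hx' := h.sup_of_up_none hx
    refine ⟨T x, List.mem_map.2 ⟨x, by simp [hx'], rfl⟩, fun u => ?_⟩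
    obtain ⟨-, -, h3, h4, h5, -⟩ := hT x
    refine ⟨fun hu => isAncestor_getLast_of_isChain h3 hu h5, ?_⟩
    have hlast : S.ext true x ∈ inorder (T x) := List.mem_of_getLast? h5
    have hhead : ∀ y, (inorder (T x)).head? = some y → P y = none := by
      intro y hy; rw [h4] at hy; cases hy; rw [h.root' hx', hx]
    generalize S.ext true x = z at hlast
    induction z using h.forest.induction with
    | step z ih =>
    intro hu
    rcases isAncestor_iff.1 hu with rfl | ⟨y, hy, huy⟩
    · exact hlast
    · exact ih y hy (mem_inorder_of_isChain h3 hhead hlast hy) huy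

end Valid

end DPF

namespace DPF

open Finset

variable {n : ℕ} {S S' : LCState n} {P : Fin n → Option (Fin n)}

/-! ### Splaying -/

/-- `S'` arises from `S` by rotations in the splay tree with the root `r`, whose new root
is `r'`. -/
structure Reshaped (S S' : LCState n) (P : Fin n → Option (Fin n)) (r r' : Fin n) : Prop where
  valid : Valid S' P
  sup_root : S'.sup r' = none
  up_root : S'.up r' = S.up r
  desc_root : desc S'.up r' = desc S.up r
  ext_root : ∀ e, S'.ext e r' = S.ext e r
  sz_root : S'.sz r' = S.sz r
  other : ∀ t, S.sup t = none → t ≠ r → t ≠ r' ∧ S'.sup t = none ∧ S'.up t = S.up t ∧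
    (∀ e, S'.ext e t = S.ext e t) ∧ S'.sz t = S.sz t ∧ desc S'.up t = desc S.up t ∧
    ∀ k x, climb S.sup k x = some t → climb S'.sup k x = some t

theorem Reshaped.refl (h : Valid S P) {r : Fin n} (hr : S.sup r = none) : Reshaped S S P r r :=
  ⟨h, hr, rfl, rfl, fun _ => rfl, rfl, fun _ ht htr =>
    ⟨htr, ht, rfl, fun _ => rfl, rfl, rfl, fun _ _ h => h⟩⟩

theorem Reshaped.trans {S₁ S₂ : LCState n} {r r₁ r₂ : Fin n} (h₁ : Reshaped S S₁ P r r₁)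
    (h₂ : Reshaped S₁ S₂ P r₁ r₂) : Reshaped S S₂ P r r₂ := by
  refine ⟨h₂.valid, h₂.sup_root, h₂.up_root.trans h₁.up_root, h₂.desc_root.trans h₁.desc_root,
    fun e => (h₂.ext_root e).trans (h₁.ext_root e), h₂.sz_root.trans h₁.sz_root,
    fun t ht htr => ?_⟩
  obtain ⟨a1, a2, a3, a4, a5, a6, a7⟩ := h₁.other t ht htr
  obtain ⟨b1, b2, b3, b4, b5, b6, b7⟩ := h₂.other t a2 a1
  exact ⟨b1, b2, b3.trans a3, fun e => (b4 e).trans (a4 e), b5.trans a5, b6.trans a6,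
    fun k x hx => b7 k x (a7 k x hx)⟩

theorem Reshaped.rank_root {r r' : Fin n} (h : Reshaped S S' P r r') :
    rank S'.up r' = rank S.up r := by
  rw [rank, rank, h.desc_root]

theorem climb_succ_of_some {F : Fin n → Option (Fin n)} {x y : Fin n} (h : F x = some y) (k : ℕ) :
    climb F (k + 1) x = climb F k y := by simp [climb, h]

namespace Valid

/-- The rotation of a node `v` of splay depth `k + 1` reshapes its splay tree and leaves `v` at depth
`k`. -/
theorem rot_reshaped (h : Valid S P) {d : Bool} {v p r : Fin n} (hv : S.ch d p = some v)
    (hr : S.sup r = none) {k : ℕ} (hk : climb S.sup k p = some r) :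
    ∃ r', Reshaped S (S.rot d v p) P r r' ∧ climb (S.rot d v p).sup k v = some r' := by
  have hup := h.up_ch hv
  have hvp : v ≠ p := h.up_forest.ne_of_some hup
  have hm : ∀ c, S.ch (!d) v = some c → S.up c = some v := fun c hc => h.up_ch hc
  have hms : ∀ c, S.ch (!d) v = some c → S.sup c = some v := fun c hc => h.sup_of_ch hc
  have hsv := h.sup_of_ch hv
  have hrs := h.rot_sup hv
  have hrp : IsAncestor S.sup r p := ⟨k, hk⟩
  have hrv : IsAncestor S.sup r v := hrp.trans (.of_parent hsv)
  have other : ∀ t, S.sup t = none → t ≠ v → t ≠ p → (S.rot d v p).sup t = none ∧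
      (S.rot d v p).up t = S.up t ∧ (∀ e, (S.rot d v p).ext e t = S.ext e t) ∧
      (S.rot d v p).sz t = S.sz t ∧ desc (S.rot d v p).up t = desc S.up t := by
    intro t ht htv htp
    have htm : S.ch (!d) v ≠ some t := fun e => by simp [hms t e] at ht
    refine ⟨?_, ?_, ?_, ?_, ?_⟩
    · rw [hrs]; simp [rotUp, htv, htp, htm, ht]
    · simp [LCState.rot, rotUp, htv, htp, htm]
    · intro e; simp [LCState.rot, htv, htp]
    · simp [LCState.rot, htv, htp]
    · exact rotUp_desc_of_ne h.up_forest hup hm htv htp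
  have other' : ∀ t, S.sup t = none → t ≠ r → t ≠ v ∧ t ≠ p ∧
      ∀ k x, climb S.sup k x = some t → climb (S.rot d v p).sup k x = some t := by
    intro t ht htr
    refine ⟨?_, ?_, ?_⟩
    · rintro rfl; simp [hsv] at ht
    · rintro rfl; exact htr ((isAncestor_of_none ht).1 hrp).symm
    · intro k x hx
      rw [hrs]
      exact climb_rotUp_of_not hsv hms (fun hc => htr (root_unique ht hr hc hrv)) hx
  by_cases hpr : p = r
  · subst hpr
    have hk0 : k = 0 := by
      cases k with
      | zero => rfl
      | succ k => simp [climb, hr] at hk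
    subst hk0
    refine ⟨v, ⟨h.rot hv, ?_, ?_, ?_, ?_, ?_, ?_⟩, rfl⟩
    · rw [hrs]; simp [rotUp, hr]
    · simp [LCState.rot, rotUp]
    · exact rotUp_desc_self h.up_forest hup hm
    · intro e; simp [LCState.rot]
    · simp [LCState.rot]
    · intro t ht htr
      obtain ⟨a, b, c⟩ := other' t ht htr
      obtain ⟨d1, d2, d3, d4, d5⟩ := other t ht a b
      exact ⟨a, d1, d2, d3, d4, d5, c⟩
  · have hvr : r ≠ v := by rintro rfl; simp [hsv] at hr
    obtain ⟨d1, d2, d3, d4, d5⟩ := other r hr hvr (Ne.symm hpr)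
    refine ⟨r, ⟨h.rot hv, d1, d2, d5, d3, d4, ?_⟩, ?_⟩
    · intro t ht htr
      obtain ⟨a, b, c⟩ := other' t ht htr
      obtain ⟨d1, d2, d3, d4, d5⟩ := other t ht a b
      exact ⟨htr, d1, d2, d3, d4, d5, c⟩
    · cases k with
      | zero => simp only [climb, Option.some.injEq] at hk; exact absurd hk hpr
      | succ k => rw [hrs]; exact climb_rotUp_self h.sup_forest hsv hms hk

theorem rot_pot (h : Valid S P) {d : Bool} {v p : Fin n} (hv : S.ch d p = some v) :
    pot (S.rot d v p).up = pot S.up + rank (S.rot d v p).up p - rank S.up v :=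
  pot_rotUp h.up_forest (h.up_ch hv) fun _ hc => h.up_ch hc

theorem rot_rank_self (h : Valid S P) {d : Bool} {v p : Fin n} (hv : S.ch d p = some v) :
    rank (S.rot d v p).up v = rank S.up p :=
  rotUp_rank_self h.up_forest (h.up_ch hv) fun _ hc => h.up_ch hc

theorem rot_rank_of_ne (h : Valid S P) {d : Bool} {v p x : Fin n} (hv : S.ch d p = some v)
    (hxv : x ≠ v) (hxp : x ≠ p) : rank (S.rot d v p).up x = rank S.up x :=
  rotUp_rank_of_ne h.up_forest (h.up_ch hv) (fun _ hc => h.up_ch hc) hxv hxp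

theorem rank_le_parent (h : Valid S P) {d : Bool} {v p : Fin n} (hv : S.ch d p = some v) :
    rank S.up v ≤ rank S.up p := rank_mono (desc_subset (.of_parent (h.up_ch hv)))

/-- The single rotation that ends a splay. -/
theorem zig (h : Valid S P) {d : Bool} {v p : Fin n} (hv : S.ch d p = some v) :
    pot (S.rot d v p).up ≤ pot S.up + 3 * (rank S.up p - rank S.up v) := by
  have h1 := h.rot_pot hv
  have h2 := (h.rot hv).rank_le_parent (rot_ch_upper S d v p)
  have h3 := h.rot_rank_self hv
  have h4 := h.rank_le_parent hv
  linarith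

theorem zigzig_ch (h : Valid S P) {d : Bool} {v p g : Fin n} (hv : S.ch d p = some v)
    (hp : S.ch d g = some p) : (S.rot d p g).ch d p = some v := by
  have h1 : p ≠ g := h.up_forest.ne_of_some (h.up_ch hp)
  have h2 : v ≠ p := h.up_forest.ne_of_some (h.up_ch hv)
  have h3 : v ≠ g := by
    rintro rfl; exact h.up_forest.not_isAncestor (h.up_ch hv) (.of_parent (h.up_ch hp))
  refine h.rot_ch_other hp hv h2 h3 fun h4 => ?_
  have := h.ch_inj hv h4
  cases d <;> simp at this

/-- The double rotation in the case that `v` and its parent are children on the same side. -/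
theorem zigzig (h : Valid S P) {d : Bool} {v p g r : Fin n} (hv : S.ch d p = some v)
    (hp : S.ch d g = some p) (hr : S.sup r = none) {k : ℕ}
    (hk : climb S.sup (k + 2) v = some r) :
    ∃ r', Reshaped S ((S.rot d p g).rot d v p) P r r' ∧
      climb ((S.rot d p g).rot d v p).sup k v = some r' ∧
      pot ((S.rot d p g).rot d v p).up + 2 ≤ pot S.up + 3 * (rank S.up g - rank S.up v) ∧
      rank ((S.rot d p g).rot d v p).up v = rank S.up g := by
  have hv₁ := h.zigzig_ch hv hp
  have h₁ := h.rot hp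
  have h1 : p ≠ g := h.up_forest.ne_of_some (h.up_ch hp)
  have h2 : v ≠ p := h.up_forest.ne_of_some (h.up_ch hv)
  have h3 : v ≠ g := by
    rintro rfl; exact h.up_forest.not_isAncestor (h.up_ch hv) (.of_parent (h.up_ch hp))
  rw [climb_succ_of_some (h.sup_of_ch hv), climb_succ_of_some (h.sup_of_ch hp)] at hk
  obtain ⟨r₁, hr₁, hk₁⟩ := h.rot_reshaped hp hr hk
  obtain ⟨r₂, hr₂, hk₂⟩ := h₁.rot_reshaped hv₁ hr₁.sup_root hk₁
  refine ⟨r₂, hr₁.trans hr₂, hk₂, ?_, ?_⟩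
  · have a1 := h.rot_pot hp
    have a2 := h₁.rot_pot hv₁
    have a3 := h.rot_rank_of_ne hp h2 h3
    have a4 := h.rot_rank_self hp
    have a5 := h₁.rot_rank_self hv₁
    have a6 := (h₁.rot hv₁).rank_le_parent (rot_ch_upper _ d v p)
    have a7 := h.rank_le_parent hv
    have a8 := h₁.up_forest.rank_add_rank_le (h₁.up_ch hv₁)
      (h₁.up_ch (rot_ch_upper S d p g)) h3
    linarith
  · rw [h₁.rot_rank_self hv₁, h.rot_rank_self hp]

/-- The double rotation in the case that `v` and its parent are children on different sides. -/
theorem zigzag (h : Valid S P) {d : Bool} {v p g r : Fin n} (hv : S.ch d p = some v)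
    (hp : S.ch (!d) g = some p) (hr : S.sup r = none) {k : ℕ}
    (hk : climb S.sup (k + 2) v = some r) :
    ∃ r', Reshaped S ((S.rot d v p).rot (!d) v g) P r r' ∧
      climb ((S.rot d v p).rot (!d) v g).sup k v = some r' ∧
      pot ((S.rot d v p).rot (!d) v g).up + 2 ≤ pot S.up + 3 * (rank S.up g - rank S.up v) ∧
      rank ((S.rot d v p).rot (!d) v g).up v = rank S.up g := by
  have hv₁ := h.rot_ch_parent hv hp
  have h₁ := h.rot hv
  have h1 : p ≠ g := h.up_forest.ne_of_some (h.up_ch hp)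
  have h2 : v ≠ p := h.up_forest.ne_of_some (h.up_ch hv)
  have h3 : v ≠ g := by
    rintro rfl; exact h.up_forest.not_isAncestor (h.up_ch hv) (.of_parent (h.up_ch hp))
  rw [climb_succ_of_some (h.sup_of_ch hv)] at hk
  obtain ⟨r₁, hr₁, hk₁⟩ := h.rot_reshaped hv hr hk
  rw [climb_succ_of_some (h₁.sup_of_ch hv₁)] at hk₁
  obtain ⟨r₂, hr₂, hk₂⟩ := h₁.rot_reshaped hv₁ hr₁.sup_root hk₁
  have h₂ := h₁.rot hv₁
  have hpv : (S.rot d v p).ch (!d) v = some p := rot_ch_upper S d v p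
  have hgv : ((S.rot d v p).rot (!d) v g).ch d v = some g := by
    simpa using rot_ch_upper (S.rot d v p) (!d) v g
  have hpv₂ : ((S.rot d v p).rot (!d) v g).ch (!d) v = some p := by
    refine h₁.rot_ch_other hv₁ hpv h2.symm h1 fun h4 => ?_
    have := h₁.ch_inj hpv h4
    cases d <;> simp at this
  refine ⟨r₂, hr₁.trans hr₂, hk₂, ?_, ?_⟩
  · have a1 := h.rot_pot hv
    have a2 := h₁.rot_pot hv₁
    have a3 := h₁.rot_rank_of_ne hv₁ h2.symm h1
    have a4 := h.rot_rank_self hv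
    have a5 := h₁.rot_rank_self hv₁
    have a6 := h.rot_rank_of_ne hv h3.symm h1.symm
    have a7 := h.rank_le_parent hv
    have a8 := h₂.up_forest.rank_add_rank_le (h₂.up_ch hpv₂) (h₂.up_ch hgv) h1
    have a9 := h.rank_le_parent hp
    linarith
  · rw [h₁.rot_rank_self hv₁, h.rot_rank_of_ne hv h3.symm h1.symm]

end Valid

/-! ### Changes of preferred children, cuts and links -/

namespace LCState

variable (S : LCState n)

/-- The right subtree of the splay root `y` becomes a path of its own, and the path with the splay
tree `o` is appended to the path of `y`. -/
def splice (y : Fin n) (o : Option (Fin n)) : LCState n where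
  ch e x := if e = true ∧ x = y then o else S.ch e x
  up := S.up
  sz x := if x = y then 1 + optSize S.sz (S.ch false y) + optSize S.sz o else S.sz x
  ext e x := if e = true ∧ x = y then (match o with | none => y | some c => S.ext true c)
    else S.ext e x

/-- The left subtree of the splay root `v` is cut off. -/
def cut (v : Fin n) : LCState n where
  ch e x := if e = false ∧ x = v then none else S.ch e x
  up x := if S.ch false v = some x then none else S.up x
  sz x := if x = v then 1 + optSize S.sz (S.ch true v) else S.sz x
  ext e x := if e = false ∧ x = v then v else S.ext e x

/-- The splay root `a` gets the path-parent `b`. -/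
def link (a b : Fin n) : LCState n where
  ch := S.ch
  up := Function.update S.up a (some b)
  sz := S.sz
  ext := S.ext

end LCState

namespace Valid

/-- The change of the preferred child of `y` does not affect `up`, and so the potential is the same. -/
theorem splice (h : Valid S P) {y : Fin n} {o : Option (Fin n)} (hy : S.sup y = none)
    (ho : ∀ c, o = some c → S.sup c = none ∧ S.up c = some y) : Valid (S.splice y o) P := by
  have hny : ∀ e x, S.ch e x ≠ some y := h.sup_eq_none_iff.1 hy
  have hoy : o ≠ some y := fun e => h.up_forest.ne_of_some (ho y e).2 rfl
  have hoc : ∀ c, o = some c → ∀ e x, S.ch e x ≠ some c := fun c hc =>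
    h.sup_eq_none_iff.1 (ho c hc).1
  have hch : ∀ {e x c}, (S.splice y o).ch e x = some c →
      (e = true ∧ x = y ∧ o = some c) ∨ (¬ (e = true ∧ x = y) ∧ S.ch e x = some c) := by
    intro e x c hc
    simp only [LCState.splice] at hc
    split_ifs at hc with h1
    · exact Or.inl ⟨h1.1, h1.2, hc⟩
    · exact Or.inr ⟨h1, hc⟩
  have hext : ∀ e x, x ≠ y → (S.splice y o).ext e x = S.ext e x := fun e x hx => by
    simp [LCState.splice, hx]
  have hcy : ∀ {e x c}, (S.splice y o).ch e x = some c → c ≠ y := by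
    intro e x c hc
    rcases hch hc with ⟨_, _, h1⟩ | ⟨_, h1⟩
    · rintro rfl; exact hoy h1
    · rintro rfl; exact hny _ _ h1
  have hszo : ∀ e x, optSize (S.splice y o).sz ((S.splice y o).ch e x) =
      optSize S.sz ((S.splice y o).ch e x) := by
    intro e x
    cases hc : (S.splice y o).ch e x with
    | none => rfl
    | some c => simp [LCState.splice, hcy hc]
  constructor
  · exact h.forest
  · exact h.up_forest
  · intro e x c hc
    rcases hch hc with ⟨rfl, rfl, h1⟩ | ⟨_, h1⟩
    · exact (ho c h1).2
    · exact h.up_ch h1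
  · intro x c e e' h1 h2
    rcases hch h1 with ⟨e1, _, h1⟩ | ⟨_, h1⟩ <;> rcases hch h2 with ⟨e2, _, h2⟩ | ⟨_, h2⟩
    · exact e1.trans e2.symm
    · exact absurd h2 (hoc c h1 _ _)
    · exact absurd h1 (hoc c h2 _ _)
    · exact h.ch_inj h1 h2
  · intro x
    rw [hszo, hszo]
    by_cases hx : x = y
    · subst hx; simp [LCState.splice]
    · simpa [LCState.splice, hx] using h.sz_eq x
  · intro e x hx
    simp only [LCState.splice] at hx ⊢
    split_ifs at hx ⊢ with h1
    · subst hx; exact h1.2.symm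
    · exact h.ext_none hx
  · intro e x c hx
    rw [hext _ _ (hcy hx)]
    rcases hch hx with ⟨rfl, rfl, h1⟩ | ⟨h1', h1⟩
    · simp [LCState.splice, h1]
    · simpa [LCState.splice, h1'] using h.ext_some h1
  · intro e x c hx
    rw [hext _ _ (hcy hx)]
    rcases hch hx with ⟨rfl, rfl, h1⟩ | ⟨h1', h1⟩
    · have := h.root' (ho c h1).1
      rw [(ho c h1).2] at this
      simpa [PathAdj] using this
    · exact h.adj h1
  · intro x hx
    have e1 : (S.splice y o).ext false x = S.ext false x := by simp [LCState.splice]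
    rw [e1]
    show _ = S.up x
    by_cases hxy : S.ch true y = some x
    · rw [h.parent_ext hxy, h.up_ch hxy]
    · refine h.root fun e q hq => hx e q ?_
      have : ¬ (e = true ∧ q = y) := by rintro ⟨rfl, rfl⟩; exact hxy hq
      simpa [LCState.splice, this] using hq

theorem splice_sup_self (h : Valid S P) {y : Fin n} {o : Option (Fin n)} (hy : S.sup y = none)
    (ho : ∀ c, o = some c → S.sup c = none ∧ S.up c = some y) : (S.splice y o).sup y = none := by
  rw [(h.splice hy ho).sup_eq_none_iff]
  intro e q hq
  simp only [LCState.splice] at hq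
  split_ifs at hq
  · exact h.up_forest.ne_of_some (ho y hq).2 rfl
  · exact h.sup_eq_none_iff.1 hy _ _ hq

/-- The nodes of the appended path keep their splay depth, increased by one. -/
theorem climb_splice (h : Valid S P) {y c x : Fin n} (hy : S.sup y = none)
    (hc : S.sup c = none) (hcy : S.up c = some y) {k : ℕ} (hk : climb S.sup k x = some c) :
    climb (S.splice y (some c)).sup (k + 1) x = some y := by
  have ho : ∀ c', some c = some c' → S.sup c' = none ∧ S.up c' = some y := by
    rintro _ ⟨⟩; exact ⟨hc, hcy⟩
  have h' := h.splice hy ho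
  have hsc : (S.splice y (some c)).sup c = some y :=
    h'.sup_of_ch (d := true) (by simp [LCState.splice])
  induction k generalizing x with
  | zero =>
    simp only [climb, Option.some.injEq] at hk
    subst hk
    rw [climb_succ_of_some hsc]; rfl
  | succ k ih =>
    cases hx : S.sup x with
    | none => simp [climb, hx] at hk
    | some z =>
      rw [climb_succ_of_some hx] at hk
      obtain ⟨e, he⟩ := h.sup_eq_some_iff.1 hx
      have hne : ¬ (e = true ∧ z = y) := by
        rintro ⟨-, rfl⟩
        cases k with
        | zero =>
          simp only [climb, Option.some.injEq] at hk
          exact h.up_forest.ne_of_some hcy hk.symm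
        | succ k => simp [climb, hy] at hk
      have hsx : (S.splice y (some c)).sup x = some z :=
        h'.sup_of_ch (d := e) (by simpa [LCState.splice, hne] using he)
      rw [climb_succ_of_some hsx]
      exact ih hk

theorem cut (h : Valid S P) {v : Fin n} (hv : S.up v = none) :
    Valid (S.cut v) (Function.update P v none) := by
  have hsv := h.sup_of_up_none hv
  have hnv : ∀ e x, S.ch e x ≠ some v := h.sup_eq_none_iff.1 hsv
  have hch : ∀ {e x c}, (S.cut v).ch e x = some c →
      ¬ (e = false ∧ x = v) ∧ S.ch e x = some c := by
    intro e x c hc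
    simp only [LCState.cut] at hc
    split_ifs at hc with h1
    exact ⟨h1, hc⟩
  have hext : ∀ e x, x ≠ v → (S.cut v).ext e x = S.ext e x := fun e x hx => by
    simp [LCState.cut, hx]
  have hcv : ∀ {e x c}, (S.cut v).ch e x = some c → c ≠ v := by
    rintro e x c hc rfl; exact hnv _ _ (hch hc).2
  have hszo : ∀ e x, optSize (S.cut v).sz ((S.cut v).ch e x) =
      optSize S.sz ((S.cut v).ch e x) := by
    intro e x
    cases hc : (S.cut v).ch e x with
    | none => rfl
    | some c => simp [LCState.cut, hcv hc]
  -- the only splay subtree whose leftmost node is `v` is the one of `v`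
  have hev : ∀ e c, S.ext e c = v → c = v := fun e c hc =>
    (isAncestor_of_none hsv).1 (hc ▸ h.isAncestor_sup_ext e c)
  constructor
  · exact isForest_update_none h.forest v
  · obtain ⟨r, hr⟩ := h.up_forest.exists_rank
    refine isForest_of_rank r fun x y hxy => hr x y ?_
    simp only [LCState.cut] at hxy
    split_ifs at hxy
    exact hxy
  · intro e x c hc
    obtain ⟨h1, h2⟩ := hch hc
    have h3 : S.ch false v ≠ some c := fun h3 => by
      have e1 := h.up_ch h3
      rw [h.up_ch h2] at e1; cases e1
      exact h1 ⟨h.ch_inj h2 h3, rfl⟩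
    simp only [LCState.cut, if_neg h3]
    exact h.up_ch h2
  · intro x c e e' h1 h2
    exact h.ch_inj (hch h1).2 (hch h2).2
  · intro x
    rw [hszo, hszo]
    by_cases hx : x = v
    · subst hx; simp [LCState.cut]
    · simpa [LCState.cut, hx] using h.sz_eq x
  · intro e x hx
    simp only [LCState.cut] at hx ⊢
    split_ifs at hx ⊢ with h1
    · exact h1.2.symm
    · exact h.ext_none hx
  · intro e x c hx
    rw [hext _ _ (hcv hx)]
    obtain ⟨h1, h2⟩ := hch hx
    simpa [LCState.cut, h1] using h.ext_some h2
  · intro e x c hx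
    rw [hext _ _ (hcv hx)]
    obtain ⟨h1, h2⟩ := hch hx
    cases e with
    | false =>
      have hxv : x ≠ v := fun hxv => h1 ⟨rfl, hxv⟩
      simpa [PathAdj, hxv] using h.parent_eq_ext h2
    | true =>
      have : S.ext false c ≠ v := fun hc => hcv hx (hev _ _ hc)
      simpa [PathAdj, this] using h.parent_ext h2
  · intro x hx
    by_cases hxv : x = v
    · subst hxv
      have h1 : S.ch false x ≠ some x := hnv _ _
      simp [LCState.cut, hv]
    · rw [hext _ _ hxv]
      by_cases hl : S.ch false v = some x
      · have h1 : P (S.ext false x) = none := by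
          rw [← h.ext_some hl, h.root' hsv, hv]
        simp [LCState.cut, hl, Function.update_apply, h1]
      · have h1 : S.ext false x ≠ v := fun hc => hxv (hev _ _ hc)
        have h2 := h.root fun e q hq => hx e q (by
          have : ¬ (e = false ∧ q = v) := by rintro ⟨rfl, rfl⟩; exact hl hq
          simpa [LCState.cut, this] using hq)
        simpa [LCState.cut, hl, h1] using h2

theorem cut_pot_le (S : LCState n) (v : Fin n) : pot (S.cut v).up ≤ pot S.up := by
  refine sum_le_sum fun x _ => rank_mono fun u hu => ?_
  rw [mem_desc] at hu ⊢
  obtain ⟨j, hj⟩ := hu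
  induction j generalizing u with
  | zero => simp only [climb, Option.some.injEq] at hj; subst hj; exact .refl _
  | succ j ih =>
    cases hu : (S.cut v).up u with
    | none => simp [climb, hu] at hj
    | some y =>
      rw [climb_succ_of_some hu] at hj
      have : S.up u = some y := by
        simp only [LCState.cut] at hu
        split_ifs at hu
        exact hu
      exact (ih y hj).trans (.of_parent this)

theorem link (h : Valid S P) {a b : Fin n} (hPa : P a = none) (ha : S.up a = none)
    (hb : S.up b = none) (hab : ¬ IsAncestor P a b) :
    Valid (S.link a b) (Function.update P a (some b)) := by
  have hsa := h.sup_of_up_none ha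
  have hne : a ≠ b := by rintro rfl; exact hab (.refl _)
  have hea : S.ext false a = a := by
    have := (h.isAncestor_ext a).1
    rwa [isAncestor_of_none hPa] at this
  have hev : ∀ c, S.ext false c = a → c = a := fun c hc =>
    (isAncestor_of_none hsa).1 (hc ▸ h.isAncestor_sup_ext false c)
  have hadj : ∀ {x c}, P x = some c → Function.update P a (some b) x = some c := by
    intro x c hx
    have : x ≠ a := by rintro rfl; simp [hPa] at hx
    simpa [this] using hx
  constructor
  · exact isForest_update_some h.forest hPa hab
  · exact isForest_update_some h.up_forest ha
      fun h1 => hne ((isAncestor_of_none hb).1 h1)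
  · intro e x c hc
    have h1 := h.up_ch hc
    have : c ≠ a := by rintro rfl; simp [ha] at h1
    simpa [LCState.link, this] using h1
  · exact h.ch_inj
  · exact h.sz_eq
  · exact h.ext_none
  · exact h.ext_some
  · intro e x c hc
    have := h.adj hc
    unfold PathAdj at this ⊢
    split_ifs at this ⊢
    · exact hadj this
    · exact hadj this
  · intro x hx
    have h1 := h.root hx
    by_cases hxa : x = a
    · subst hxa; simp [LCState.link, hea]
    · have : S.ext false x ≠ a := fun hc => hxa (hev _ hc)
      simpa [LCState.link, hxa, this] using h1

/-- Only the rank of `b` grows, since `b` is the root of its virtual tree. -/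
theorem link_pot_le (S : LCState n) {a b : Fin n} (ha : S.up a = none) (hb : S.up b = none)
    (hab : a ≠ b) : pot (S.link a b).up ≤ pot S.up + Real.logb 2 n := by
  have hb' : (S.link a b).up b = none := by simp [LCState.link, hab.symm, hb]
  have key : ∀ x ≠ b, rank (S.link a b).up x ≤ rank S.up x := by
    intro x hx
    refine rank_mono fun u hu => ?_
    rw [mem_desc] at hu ⊢
    obtain ⟨j, hj⟩ := hu
    induction j generalizing u with
    | zero => simp only [climb, Option.some.injEq] at hj; subst hj; exact .refl _
    | succ j ih =>
      cases hu : (S.link a b).up u with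
      | none => simp [climb, hu] at hj
      | some y =>
        rw [climb_succ_of_some hu] at hj
        have hua : u ≠ a := by
          rintro rfl
          have : b = y := by simpa [LCState.link] using hu
          subst this
          have h1 : IsAncestor (S.link u b).up x b := ⟨j, hj⟩
          exact hx ((isAncestor_of_none hb').1 h1)
        have : S.up u = some y := by simpa [LCState.link, hua] using hu
        exact (ih y hj).trans (.of_parent this)
  rw [pot, pot, ← add_sum_erase _ _ (mem_univ b),
    ← add_sum_erase univ (fun x => rank S.up x) (mem_univ b)]
  have h1 := sum_le_sum fun x (hx : x ∈ univ.erase b) => key x (ne_of_mem_erase hx)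
  have h2 := rank_le (F := (S.link a b).up) b
  have h3 := rank_nonneg (F := S.up) b
  linarith

end Valid

end DPF

namespace DPF

/-! ### Running programs -/

namespace Cmd

/-- A sequence of commands. -/
def block : List Cmd → Cmd
  | [] => .skip
  | c :: cs => .seq c (block cs)

/-- The registers that a program assigns. -/
def regs : Cmd → List ℕ
  | .skip => []
  | .assign r _ => [r]
  | .store _ _ _ => []
  | .seq p q => p.regs ++ q.regs
  | .ite _ p q => p.regs ++ q.regs
  | .loop _ p => p.regs

/-- The arrays into which a program stores. -/
def arrs : Cmd → List ℕ
  | .skip => []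
  | .assign _ _ => []
  | .store a _ _ => [a]
  | .seq p q => p.arrs ++ q.arrs
  | .ite _ p q => p.arrs ++ q.arrs
  | .loop _ p => p.arrs

/-- The program has no loops. -/
def loopFree : Cmd → Bool
  | .seq p q => p.loopFree && q.loopFree
  | .ite _ p q => p.loopFree && q.loopFree
  | .loop _ _ => false
  | _ => true

/-- The final store of a program without loops. -/
def run (w : ℕ) : Cmd → Store → Store
  | .assign r e, σ => σ.setReg r (e.eval w σ)
  | .store a i e, σ => σ.setArr a (i.eval w σ) (e.eval w σ)
  | .seq p q, σ => q.run w (p.run w σ)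
  | .ite b p q, σ => if b.eval w σ = 0 then q.run w σ else p.run w σ
  | _, σ => σ

/-- A bound for the running time of a program without loops. -/
def maxTime : Cmd → ℕ
  | .skip => 1
  | .assign _ e => e.cost + 1
  | .store _ i e => i.cost + e.cost + 1
  | .seq p q => p.maxTime + q.maxTime
  | .ite b p q => b.cost + 1 + (p.maxTime + q.maxTime)
  | .loop _ _ => 0

end Cmd

variable {w : ℕ}

/-- A program without loops is executed by computing its final store; this is how the pieces of
straight-line code are verified. -/
theorem exec_run (w : ℕ) {c : Cmd} (hc : c.loopFree = true) (σ : Store) :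
    ∃ t ≤ c.maxTime, Exec w c σ (c.run w σ) t := by
  induction c generalizing σ with
  | skip => exact ⟨_, le_rfl, .skip σ⟩
  | assign r e => exact ⟨_, le_rfl, .assign σ r e⟩
  | store a i e => exact ⟨_, le_rfl, .store σ a i e⟩
  | seq p q ihp ihq =>
    simp only [Cmd.loopFree, Bool.and_eq_true] at hc
    obtain ⟨t₁, h₁, e₁⟩ := ihp hc.1 σ
    obtain ⟨t₂, h₂, e₂⟩ := ihq hc.2 (p.run w σ)
    exact ⟨_, Nat.add_le_add h₁ h₂, .seq e₁ e₂⟩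
  | ite b p q ihp ihq =>
    simp only [Cmd.loopFree, Bool.and_eq_true] at hc
    obtain ⟨t₁, h₁, e₁⟩ := ihp hc.1 σ
    obtain ⟨t₂, h₂, e₂⟩ := ihq hc.2 σ
    by_cases hb : b.eval w σ = 0
    · refine ⟨_, ?_, by simpa only [Cmd.run, if_pos hb] using Exec.ite_false hb e₂⟩
      simp only [Cmd.maxTime]; omega
    · refine ⟨_, ?_, by simpa only [Cmd.run, if_neg hb] using Exec.ite_true hb e₁⟩
      simp only [Cmd.maxTime]; omega
  | loop b p => simp [Cmd.loopFree] at hc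

theorem Exec.cons {c : Cmd} {cs : List Cmd} {σ σ₁ σ' : Store} {t₁ t : ℕ}
    (h₁ : Exec w c σ σ₁ t₁) (h : Exec w (Cmd.block cs) σ₁ σ' t) :
    Exec w (Cmd.block (c :: cs)) σ σ' (t₁ + t) := .seq h₁ h

theorem Exec.assign_cons {r x : ℕ} {e : RExp} {cs : List Cmd} {σ σ' : Store} {t : ℕ}
    (hx : e.eval w σ = x) (h : Exec w (Cmd.block cs) (σ.setReg r x) σ' t) :
    Exec w (Cmd.block (.assign r e :: cs)) σ σ' (e.cost + 1 + t) :=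
  .seq (.assign σ r e) (hx ▸ h)

theorem Exec.store_cons {a j x : ℕ} {i e : RExp} {cs : List Cmd} {σ σ' : Store} {t : ℕ}
    (hi : i.eval w σ = j) (hx : e.eval w σ = x)
    (h : Exec w (Cmd.block cs) (σ.setArr a j x) σ' t) :
    Exec w (Cmd.block (.store a i e :: cs)) σ σ' (i.cost + e.cost + 1 + t) :=
  .seq (.store σ a i e) (hi ▸ hx ▸ h)

theorem Exec.nil (σ : Store) : Exec w (Cmd.block []) σ σ 1 := .skip σ

theorem Exec.reg_eq {c : Cmd} {σ σ' : Store} {t r : ℕ} (h : Exec w c σ σ' t)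
    (hr : r ∉ c.regs) : σ'.reg r = σ.reg r := by
  induction h with
  | skip => rfl
  | assign σ r' e =>
    have : r ≠ r' := by simpa [Cmd.regs] using hr
    simp [Store.setReg, this]
  | store => rfl
  | seq _ _ ih₁ ih₂ =>
    simp only [Cmd.regs, List.mem_append, not_or] at hr
    rw [ih₂ hr.2, ih₁ hr.1]
  | ite_true _ _ ih =>
    simp only [Cmd.regs, List.mem_append, not_or] at hr
    exact ih hr.1
  | ite_false _ _ ih =>
    simp only [Cmd.regs, List.mem_append, not_or] at hr
    exact ih hr.2
  | loop_true _ _ _ ih₁ ih₂ => rw [ih₂ hr, ih₁ hr]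
  | loop_false => rfl

theorem Exec.arr_eq {c : Cmd} {σ σ' : Store} {t a : ℕ} (h : Exec w c σ σ' t)
    (ha : a ∉ c.arrs) : σ'.arr a = σ.arr a := by
  induction h with
  | skip => rfl
  | assign => rfl
  | store σ a' i e =>
    have : a ≠ a' := by simpa [Cmd.arrs] using ha
    simp [Store.setArr, this]
  | seq _ _ ih₁ ih₂ =>
    simp only [Cmd.arrs, List.mem_append, not_or] at ha
    rw [ih₂ ha.2, ih₁ ha.1]
  | ite_true _ _ ih =>
    simp only [Cmd.arrs, List.mem_append, not_or] at ha
    exact ih ha.1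
  | ite_false _ _ ih =>
    simp only [Cmd.arrs, List.mem_append, not_or] at ha
    exact ih ha.2
  | loop_true _ _ _ ih₁ ih₂ => rw [ih₂ ha, ih₁ ha]
  | loop_false => rfl

@[simp] theorem Store.setReg_reg (σ : Store) (r x r' : ℕ) :
    (σ.setReg r x).reg r' = if r' = r then x else σ.reg r' := by
  simp [Store.setReg, Function.update_apply]

@[simp] theorem Store.setReg_arr (σ : Store) (r x : ℕ) : (σ.setReg r x).arr = σ.arr := rfl

@[simp] theorem Store.setArr_reg (σ : Store) (a i x : ℕ) : (σ.setArr a i x).reg = σ.reg := rfl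

@[simp] theorem Store.setArr_arr (σ : Store) (a i x a' i' : ℕ) :
    (σ.setArr a i x).arr a' i' = if a' = a ∧ i' = i then x else σ.arr a' i' := by
  by_cases ha : a' = a
  · subst ha
    by_cases hi : i' = i <;> simp [Store.setArr, hi]
  · simp [Store.setArr, ha]

variable {n : ℕ}

@[simp] theorem nodeWord_inj {u v : Fin n} : nodeWord u = nodeWord v ↔ u = v := by
  simp [nodeWord, Fin.ext_iff]

@[simp] theorem nodeWord_ne_zero (v : Fin n) : nodeWord v ≠ 0 := by simp [nodeWord]

@[simp] theorem optWord_none : optWord (none : Option (Fin n)) = 0 := rfl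

@[simp] theorem optWord_some (v : Fin n) : optWord (some v) = nodeWord v := rfl

@[simp] theorem optWord_eq_nodeWord {o : Option (Fin n)} {v : Fin n} :
    optWord o = nodeWord v ↔ o = some v := by
  cases o with
  | none => simpa using (nodeWord_ne_zero v).symm
  | some u => simp

@[simp] theorem nodeWord_eq_optWord {o : Option (Fin n)} {v : Fin n} :
    nodeWord v = optWord o ↔ o = some v := by rw [eq_comm, optWord_eq_nodeWord]

theorem nodeWord_le (v : Fin n) : nodeWord v ≤ n := v.2

theorem apply_eq (hw : 1 < 2 ^ w) (a b : ℕ) :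
    BinOp.eq.apply w a b = if a = b then 1 else 0 := by
  simp only [BinOp.apply]
  split_ifs
  · exact Nat.mod_eq_of_lt hw
  · simp

theorem apply_lt (hw : 1 < 2 ^ w) (a b : ℕ) :
    BinOp.lt.apply w a b = if a < b then 1 else 0 := by
  simp only [BinOp.apply]
  split_ifs
  · exact Nat.mod_eq_of_lt hw
  · simp

theorem apply_add {a b : ℕ} (h : a + b < 2 ^ w) : BinOp.add.apply w a b = a + b :=
  Nat.mod_eq_of_lt h

theorem apply_sub {a b : ℕ} (h : b ≤ a) (ha : a < 2 ^ w) : BinOp.sub.apply w a b = a - b := by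
  simp only [BinOp.apply]
  rw [show a + (2 ^ w - b) = a - b + 2 ^ w by omega, Nat.add_mod_right]
  exact Nat.mod_eq_of_lt (by omega)

/-! ### Rotations and splaying on the machine -/

open RExp Cmd

/-- The number of nodes of the splay subtree of the node `e`, computed from its children. -/
def sizeExp (e : RExp) : RExp :=
  .bin .add (.bin .add (.const 1) (.load 5 (.load 1 e))) (.load 5 (.load 2 e))

/-- The pointers between `p`, `v` and the inner child of `v`, if `v` is the child of `p` on the
side `d`. -/
def rotInner (d : Bool) : Cmd := block [
  .assign 5 (.load (sideArr (!d)) (.reg 2)),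
  .store (sideArr d) (.reg 3) (.reg 5),
  .store (sideArr (!d)) (.reg 2) (.reg 3)]

/-- The pointer from the parent of `p` to `p`, if `p` is not a splay root, goes to `v`. -/
def rotOuter : Cmd :=
  .ite (.bin .eq (.load 1 (.reg 4)) (.reg 3)) (.store 1 (.reg 4) (.reg 2))
    (.ite (.bin .eq (.load 2 (.reg 4)) (.reg 3)) (.store 2 (.reg 4) (.reg 2)) .skip)

/-- The parent pointers of the inner child of `v`, of `p` and of `v` after the rotation. -/
def rotParents : Cmd := block [
  .store 3 (.reg 5) (.reg 3),
  .store 3 (.reg 3) (.reg 2),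
  .store 3 (.reg 2) (.reg 4)]

/-- The subtree sizes of `v` and `p` after the rotation. -/
def rotSizes : Cmd := block [
  .store 5 (.reg 2) (.load 5 (.reg 3)),
  .store 5 (.reg 3) (sizeExp (.reg 3))]

/-- The node `v` in register `2`, not a splay root, is rotated above its parent `p`. -/
def rotateProg : Cmd := block [
  .assign 3 (.load 3 (.reg 2)),
  .assign 4 (.load 3 (.reg 3)),
  .ite (.bin .eq (.load 1 (.reg 3)) (.reg 2)) (rotInner false) (rotInner true),
  rotParents, rotOuter, rotSizes]

variable {S : LCState n} {P : Fin n → Option (Fin n)}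

theorem one_lt_of_node (hw : n < 2 ^ w) (v : Fin n) : 1 < 2 ^ w := by
  have := v.pos; omega

theorem eval_sizeExp (hw : n < 2 ^ w) {σ : Store} {e : RExp} {v : Fin n}
    (he : e.eval w σ = nodeWord v) {a b : ℕ} (ha : σ.arr 5 (σ.arr 1 (nodeWord v)) = a)
    (hb : σ.arr 5 (σ.arr 2 (nodeWord v)) = b) (hab : 1 + a + b ≤ n) :
    (sizeExp e).eval w σ = 1 + a + b := by
  have h1 : (1 : ℕ) % 2 ^ w = 1 := Nat.mod_eq_of_lt (one_lt_of_node hw v)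
  simp only [sizeExp, RExp.eval, BinOp.apply, he, ha, hb, h1]
  rw [Nat.mod_eq_of_lt (a := 1 + a) (by omega), Nat.mod_eq_of_lt (by omega)]

theorem Rep.sz_opt {σ : Store} (h : Rep σ S) (o : Option (Fin n)) :
    σ.arr 5 (optWord o) = optSize S.sz o := by
  cases o with
  | none => exact h.sz_zero
  | some v => exact h.sz v

theorem Rep.left {σ : Store} (h : Rep σ S) (v : Fin n) :
    σ.arr 1 (nodeWord v) = optWord (S.ch false v) := h.side false v

theorem Rep.right {σ : Store} (h : Rep σ S) (v : Fin n) :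
    σ.arr 2 (nodeWord v) = optWord (S.ch true v) := h.side true v

@[simp] theorem sideArr_inj {d e : Bool} : sideArr d = sideArr e ↔ d = e := by
  cases d <;> cases e <;> simp [sideArr]

@[simp] theorem sideArr_ne_three (d : Bool) : sideArr d ≠ 3 := by cases d <;> simp [sideArr]

@[simp] theorem sideArr_ne_five (d : Bool) : sideArr d ≠ 5 := by cases d <;> simp [sideArr]

@[simp] theorem three_ne_sideArr (d : Bool) : 3 ≠ sideArr d := (sideArr_ne_three d).symm

@[simp] theorem five_ne_sideArr (d : Bool) : 5 ≠ sideArr d := (sideArr_ne_five d).symm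

theorem run_rotInner (σ : Store) (d : Bool) :
    (rotInner d).run w σ = ((σ.setReg 5 (σ.arr (sideArr (!d)) (σ.reg 2))).setArr (sideArr d)
      (σ.reg 3) (σ.arr (sideArr (!d)) (σ.reg 2))).setArr (sideArr (!d)) (σ.reg 2) (σ.reg 3) := by
  simp [rotInner, block, run, RExp.eval]

theorem run_rotParents (σ : Store) :
    rotParents.run w σ = ((σ.setArr 3 (σ.reg 5) (σ.reg 3)).setArr 3 (σ.reg 3) (σ.reg 2)).setArr 3
      (σ.reg 2) (σ.reg 4) := by
  simp [rotParents, block, run, RExp.eval]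

theorem run_rotOuter (hw : 1 < 2 ^ w) (σ : Store)
    (h : σ.arr 1 (σ.reg 4) = σ.reg 3 → σ.arr 2 (σ.reg 4) ≠ σ.reg 3) :
    (rotOuter.run w σ).reg = σ.reg ∧ (∀ a, a ≠ 1 → a ≠ 2 → (rotOuter.run w σ).arr a = σ.arr a) ∧
      ∀ e i, (rotOuter.run w σ).arr (sideArr e) i =
        if i = σ.reg 4 ∧ σ.arr (sideArr e) i = σ.reg 3 then σ.reg 2 else σ.arr (sideArr e) i := by
  refine ⟨?_, ?_, ?_⟩
  · simp only [rotOuter, run]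
    split_ifs <;> rfl
  · intro a h1 h2
    funext i
    simp only [rotOuter, run]
    split_ifs <;> simp [h1, h2]
  · intro e i
    simp only [rotOuter, run, RExp.eval, apply_eq hw]
    by_cases h1 : σ.arr 1 (σ.reg 4) = σ.reg 3
    · cases e <;> by_cases hi : i = σ.reg 4 <;> simp [h1, sideArr, hi, h]
    · by_cases h2 : σ.arr 2 (σ.reg 4) = σ.reg 3 <;>
      cases e <;> by_cases hi : i = σ.reg 4 <;> simp [h1, h2, sideArr, hi]

theorem exec_rotateProg (hw : n < 2 ^ w) (h : Valid S P) {d : Bool} {v p : Fin n}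
    (hv : S.ch d p = some v) {σ : Store} (hσ : Rep σ S) (h2 : σ.reg 2 = nodeWord v) :
    ∃ σ', ∃ t ≤ 100, Exec w rotateProg σ σ' t ∧ Rep σ' (S.rot d v p) := by
  obtain ⟨t, ht, he⟩ := exec_run w (c := rotateProg) rfl σ
  refine ⟨_, t, ht.trans (by decide), he, ?_⟩
  have h1 := h.up_ch hv
  have hvp : v ≠ p := h.up_forest.ne_of_some h1
  have hw1 := one_lt_of_node hw v
  have e3 : σ.arr 3 (nodeWord v) = nodeWord p := by rw [hσ.up, h1]; rfl
  have hr := h.rot hv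
  -- the store after the first half
  set σ₀ := (σ.setReg 3 (nodeWord p)).setReg 4 (optWord (S.up p)) with hσ₀
  set σ₁ := (rotInner d).run w σ₀ with hσ₁
  have run_eq : rotateProg.run w σ = rotSizes.run w (rotOuter.run w (rotParents.run w σ₁)) := by
    have : rotateProg.run w σ = rotSizes.run w (rotOuter.run w (rotParents.run w
        (if (RExp.bin .eq (.load 1 (.reg 3)) (.reg 2)).eval w σ₀ = 0 then (rotInner true).run w σ₀
          else (rotInner false).run w σ₀))) := by
      simp [rotateProg, block, run, RExp.eval, h2, e3, hσ.up, hσ₀]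
    rw [this]
    congr 3
    cases d with
    | false => simp [RExp.eval, hσ₀, hσ.left, hv, h2, apply_eq hw1, hσ₁]
    | true =>
      have : S.ch false p ≠ some v := fun h3 => by simpa using h.ch_inj h3 hv
      simp [RExp.eval, hσ₀, hσ.left, h2, apply_eq hw1, this, hσ₁]
  rw [run_eq]
  rw [run_rotInner] at hσ₁
  simp [hσ₀, h2, hσ.side] at hσ₁
  set σ₂ := rotParents.run w σ₁ with hσ₂
  rw [run_rotParents] at hσ₂
  set m := S.ch (!d) v with hm
  have hs2 : ∀ e i, σ₂.arr (sideArr e) i = if e = !d ∧ i = nodeWord v then nodeWord p else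
      if e = d ∧ i = nodeWord p then optWord m else σ.arr (sideArr e) i := by
    intro e i; rw [hσ₂, hσ₁]; simp
  have hu2 : ∀ i, σ₂.arr 3 i = if i = nodeWord v then optWord (S.up p) else
      if i = nodeWord p then nodeWord v else if i = optWord m then nodeWord p else σ.arr 3 i := by
    intro i; rw [hσ₂, hσ₁]; simp [h2]
  have hz2 : ∀ i, σ₂.arr 5 i = σ.arr 5 i := by
    intro i; rw [hσ₂, hσ₁]; simp
  have r2 : σ₂.reg 2 = nodeWord v := by rw [hσ₂, hσ₁]; simp [h2]
  have r3 : σ₂.reg 3 = nodeWord p := by rw [hσ₂, hσ₁]; simp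
  have r4 : σ₂.reg 4 = optWord (S.up p) := by rw [hσ₂, hσ₁]; simp
  clear_value σ₂
  have hup : S.up p ≠ some p := fun h3 => h.up_forest.ne_of_some h3 rfl
  have huv : S.up p ≠ some v := fun h3 => h.up_forest.not_isAncestor h1 (.of_parent h3)
  have hnot : ¬ (σ₂.arr 1 (optWord (S.up p)) = nodeWord p ∧
      σ₂.arr 2 (optWord (S.up p)) = nodeWord p) := by
    rintro ⟨h3, h4⟩
    rw [show (1 : ℕ) = sideArr false from rfl, hs2] at h3
    rw [show (2 : ℕ) = sideArr true from rfl, hs2] at h4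
    cases hg : S.up p with
    | none =>
      rw [hg] at h3
      simp [(nodeWord_ne_zero _).symm, hσ.side_zero] at h3
    | some g =>
      have hgp : g ≠ p := fun h5 => hup (hg.trans (congrArg some h5))
      have hgv : g ≠ v := fun h5 => huv (hg.trans (congrArg some h5))
      simp [hg, hgp, hgv, hσ.side] at h3 h4
      simpa using h.ch_inj h3 h4
  obtain ⟨o1, o2, o3⟩ := run_rotOuter hw1 σ₂ (by
    rw [r3, r4]; intro h3 h4; exact hnot ⟨h3, h4⟩)
  set σ₃ := rotOuter.run w σ₂ with hσ₃
  rw [r2, r3, r4] at o3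
  clear_value σ₃
  have hs3 : ∀ e x, σ₃.arr (sideArr e) (nodeWord x) = optWord ((S.rot d v p).ch e x) := by
    intro e x
    rw [o3, hs2]
    simp only [nodeWord_eq_optWord, nodeWord_inj, LCState.rot]
    by_cases c1 : e = d ∧ x = p
    · obtain ⟨rfl, rfl⟩ := c1
      simp [hup, hvp.symm, hm]
    by_cases c2 : e = !d ∧ x = v
    · obtain ⟨rfl, rfl⟩ := c2
      simp [huv, hvp]
    rw [if_neg c1, if_neg c2, if_neg c1, if_neg c2, hσ.side]
    simp only [optWord_eq_nodeWord]
    by_cases c3 : S.ch e x = some p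
    · simp [c3, h.up_ch c3]
    · simp [c3]
  have hs30 : ∀ e, σ₃.arr (sideArr e) 0 = 0 := by
    intro e
    have h3 : σ₂.arr (sideArr e) 0 = 0 := by
      rw [hs2]; simp [(nodeWord_ne_zero _).symm, hσ.side_zero]
    rw [o3, h3]; simp [(nodeWord_ne_zero _).symm]
  have hz3 : σ₃.arr 5 = σ.arr 5 := by
    rw [o2 5 (by decide) (by decide)]; exact funext hz2
  have hu3 : ∀ x, σ₃.arr 3 (nodeWord x) = optWord ((S.rot d v p).up x) := by
    intro x
    rw [o2 3 (by decide) (by decide), hu2]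
    simp only [nodeWord_inj, nodeWord_eq_optWord, LCState.rot, rotUp, hσ.up]
    split_ifs <;> rfl
  have q2 : σ₃.reg 2 = nodeWord v := by rw [o1, r2]
  have q3 : σ₃.reg 3 = nodeWord p := by rw [o1, r3]
  set σ₄ := σ₃.setArr 5 (nodeWord v) (S.sz p) with hσ₄
  have hz4 : ∀ o : Option (Fin n), o ≠ some p →
      σ₄.arr 5 (optWord o) = optSize (S.rot d v p).sz o := by
    rintro (_ | x) hx
    · simp [hσ₄, hz3, hσ.sz_zero, (nodeWord_ne_zero _).symm]
    · have hx' : x ≠ p := fun h3 => hx (congrArg some h3)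
      by_cases hxv : x = v
      · subst hxv; simp [hσ₄, LCState.rot]
      · simp [hσ₄, LCState.rot, hxv, hx', hz3, hσ.sz]
  have hpp : ∀ e, (S.rot d v p).ch e p ≠ some p := fun e h3 =>
    hr.up_forest.ne_of_some (hr.up_ch h3) rfl
  have hsz : (sizeExp (.reg 3)).eval w σ₄ = (S.rot d v p).sz p := by
    rw [hr.sz_eq p]
    refine eval_sizeExp hw (v := p) (by simp [RExp.eval, hσ₄, q3]) ?_ ?_ ?_
    · rw [← hz4 _ (hpp false)]
      congr 1
      simpa [hσ₄, sideArr] using hs3 false p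
    · rw [← hz4 _ (hpp true)]
      congr 1
      simpa [hσ₄, sideArr] using hs3 true p
    · rw [← hr.sz_eq p]; exact hr.sz_le p
  have hfin : rotSizes.run w σ₃ = σ₄.setArr 5 (nodeWord p) ((S.rot d v p).sz p) := by
    simp only [rotSizes, block, run]
    rw [← hsz]
    simp [RExp.eval, q2, q3, hz3, hσ.sz, hσ₄]
  rw [hfin]
  constructor
  · intro e x; simpa [hσ₄] using hs3 e x
  · intro x; simpa [hσ₄] using hu3 x
  · intro x
    by_cases hx : x = p
    · simp [hx]
    · have := hz4 (some x) (by simpa using hx)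
      simpa [hx] using this
  · intro e; simpa [hσ₄] using hs30 e
  · simp [hσ₄, hz3, hσ.sz_zero, (nodeWord_ne_zero _).symm]

end DPF

namespace DPF

open RExp Cmd

variable {n w : ℕ} {S : LCState n} {P : Fin n → Option (Fin n)}

theorem Rep.of_arr {σ σ' : Store} (h : Rep σ S) (ha : σ'.arr = σ.arr) : Rep σ' S := by
  constructor
  · rw [ha]; exact h.side
  · rw [ha]; exact h.up
  · rw [ha]; exact h.sz
  · rw [ha]; exact h.side_zero
  · rw [ha]; exact h.sz_zero

theorem Rep.setReg {σ : Store} (h : Rep σ S) (r x : ℕ) : Rep (σ.setReg r x) S := h.of_arr rfl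

/-- Is the node in register `r` a child in its splay tree? -/
def nonrootExp (r : ℕ) : RExp :=
  .bin .add (.bin .eq (.load 1 (.load 3 (.reg r))) (.reg r))
    (.bin .eq (.load 2 (.load 3 (.reg r))) (.reg r))

theorem eval_nonrootExp (hw : n < 2 ^ w) (h : Valid S P) {σ : Store} (hσ : Rep σ S) {r : ℕ}
    {v : Fin n} (hr : σ.reg r = nodeWord v) :
    (nonrootExp r).eval w σ = 0 ↔ S.sup v = none := by
  have hw1 := one_lt_of_node hw v
  have key : ∀ d, σ.arr (sideArr d) (σ.arr 3 (nodeWord v)) = nodeWord v ↔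
      ∃ p, S.up v = some p ∧ S.ch d p = some v := by
    intro d
    rw [hσ.up]
    cases hu : S.up v with
    | none => simp [hσ.side_zero, (nodeWord_ne_zero v).symm]
    | some p => simp [hσ.side]
  have k1 := key false
  have k2 := key true
  simp only [sideArr, Bool.false_eq_true, if_false, if_true] at k1 k2
  simp only [nonrootExp, RExp.eval, apply_eq hw1, hr]
  cases hs : S.sup v with
  | none =>
    rw [h.sup_eq_none_iff] at hs
    rw [if_neg (by rw [k1]; rintro ⟨p, -, hp⟩; exact hs _ _ hp),
      if_neg (by rw [k2]; rintro ⟨p, -, hp⟩; exact hs _ _ hp), apply_add (by omega)]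
    simp
  | some p =>
    obtain ⟨d, hd⟩ := h.sup_eq_some_iff.1 hs
    have hp := h.up_ch hd
    cases d with
    | false =>
      rw [if_pos (k1.2 ⟨p, hp, hd⟩), if_neg, apply_add (by omega)]
      · simp
      · rw [k2]
        rintro ⟨q, hq, hq'⟩
        rw [hp] at hq; cases hq
        simpa using h.ch_inj hd hq'
    | true =>
      rw [if_pos (k2.2 ⟨p, hp, hd⟩), if_neg, apply_add (by omega)]
      · simp
      · rw [k1]
        rintro ⟨q, hq, hq'⟩
        rw [hp] at hq; cases hq
        simpa using h.ch_inj hd hq'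

/-- Are the node in register `6` and its parent in register `7` children on the same side? -/
def sameSideExp : RExp :=
  .bin .eq (.bin .eq (.load 1 (.reg 7)) (.reg 6))
    (.bin .eq (.load 1 (.load 3 (.reg 7))) (.reg 7))

/-- If the parent in register `7` is not a splay root: the first of the two rotations. -/
def splayFirst : Cmd :=
  .ite (nonrootExp 7)
    (block [.ite sameSideExp (.assign 2 (.reg 7)) (.assign 2 (.reg 6)), rotateProg]) .skip

/-- One step of splaying the node in register `6`: two rotations, or one below the splay root. -/
def splayStep : Cmd := block [.assign 7 (.load 3 (.reg 6)), splayFirst,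
  .assign 2 (.reg 6), rotateProg]

/-- The node in register `6` is splayed to the root of its splay tree. -/
def splayProg : Cmd := .loop (nonrootExp 6) splayStep

theorem exec_splayStep_of_first {σ σ₁ : Store} {t : ℕ} {S₁ : LCState n} {d : Bool} {v p : Fin n}
    (hw : n < 2 ^ w) (h₁ : Valid S₁ P) (hv : S₁.ch d p = some v)
    (he : Exec w splayFirst (σ.setReg 7 (σ.arr 3 (σ.reg 6))) σ₁ t) (hσ₁ : Rep σ₁ S₁)
    (h6 : σ₁.reg 6 = nodeWord v) (ht : t ≤ 150) :
    ∃ σ', ∃ t ≤ 270, Exec w splayStep σ σ' t ∧ Rep σ' (S₁.rot d v p) ∧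
      σ'.reg 6 = nodeWord v := by
  obtain ⟨σ', t', ht', he', hσ'⟩ := exec_rotateProg hw h₁ hv (hσ₁.setReg 2 (nodeWord v)) (by simp)
  have h6' : σ'.reg 6 = nodeWord v := by rw [he'.reg_eq (by decide)]; simp [h6]
  rw [← h6] at he'
  have e1 : Exec w splayStep σ σ' _ :=
    .seq (.assign σ 7 (.load 3 (.reg 6))) (.seq he (.seq (.assign σ₁ 2 (.reg 6))
      (.seq he' (.skip _))))
  refine ⟨σ', _, ?_, e1, hσ', h6'⟩
  simp only [RExp.cost]; omega

theorem exec_splayFirst_of_rot {σ σ₁ : Store} {x : ℕ} {t : ℕ}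
    (hn : (nonrootExp 7).eval w σ ≠ 0)
    (hx : (if sameSideExp.eval w σ = 0 then σ.reg 6 else σ.reg 7) = x)
    (he : Exec w rotateProg (σ.setReg 2 x) σ₁ t) (ht : t ≤ 100) :
    ∃ t ≤ 150, Exec w splayFirst σ σ₁ t := by
  by_cases hs : sameSideExp.eval w σ = 0
  · rw [if_pos hs] at hx
    subst hx
    refine ⟨_, ?_, .ite_true hn (.seq (.ite_false hs (.assign σ 2 (.reg 6)))
      (.seq he (.skip _)))⟩
    simp only [RExp.cost, nonrootExp, sameSideExp]; omega
  · rw [if_neg hs] at hx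
    subst hx
    refine ⟨_, ?_, .ite_true hn (.seq (.ite_true hs (.assign σ 2 (.reg 7)))
      (.seq he (.skip _)))⟩
    simp only [RExp.cost, nonrootExp, sameSideExp]; omega

/-- Splaying a node of splay depth `k`: the second to last bound says that the potential pays for
the depth. -/
theorem exec_splayProg (hw : n < 2 ^ w) {k : ℕ} {S : LCState n} (h : Valid S P) {v r : Fin n}
    {σ : Store} (hσ : Rep σ S) (h6 : σ.reg 6 = nodeWord v)
    (hk : climb S.sup k v = some r) (hr : S.sup r = none) :
    ∃ σ' t S', Exec w splayProg σ σ' t ∧ t ≤ 300 * (k + 1) ∧ Rep σ' S' ∧ Reshaped S S' P r v ∧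
      (k : ℝ) + pot S'.up ≤ pot S.up + 3 * (rank S.up r - rank S.up v) + 1 ∧
      pot S'.up ≤ pot S.up + 3 * (rank S.up r - rank S.up v) := by
  induction k using Nat.strong_induction_on generalizing S r σ with
  | _ k ih =>
  have hw1 := one_lt_of_node hw v
  match k, hk with
  | 0, hk =>
    simp only [climb, Option.some.injEq] at hk
    subst hk
    refine ⟨σ, _, S, .loop_false ((eval_nonrootExp hw h hσ h6).2 hr), ?_, hσ, .refl h hr, ?_, ?_⟩
    · simp [RExp.cost, nonrootExp]
    · simp
    · simp
  | 1, hk =>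
    cases hp : S.sup v with
    | none => simp [climb, hp] at hk
    | some p =>
      rw [climb_succ_of_some hp] at hk
      simp only [climb, Option.some.injEq] at hk
      subst hk
      obtain ⟨d, hd⟩ := h.sup_eq_some_iff.1 hp
      obtain ⟨r', hr', hk'⟩ := h.rot_reshaped hd hr (k := 0) rfl
      simp only [climb, Option.some.injEq] at hk'
      subst hk'
      have e7 : σ.arr 3 (σ.reg 6) = nodeWord p := by rw [h6, hσ.up, h.up_ch hd]; rfl
      have e1 : Exec w splayFirst (σ.setReg 7 (σ.arr 3 (σ.reg 6)))
          (σ.setReg 7 (σ.arr 3 (σ.reg 6))) _ :=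
        .ite_false ((eval_nonrootExp hw h (v := p) (hσ.setReg _ _) (by simp [e7])).2 hr) (.skip _)
      obtain ⟨σ', t', ht', e2, hσ', h6'⟩ := exec_splayStep_of_first hw h hd e1 (hσ.setReg _ _)
        (by simpa using h6) (by simp [RExp.cost, nonrootExp])
      have hz := h.zig hd
      have hne : (nonrootExp 6).eval w σ ≠ 0 := by
        rw [Ne, eval_nonrootExp hw h hσ h6, hp]; simp
      refine ⟨σ', _, _, .loop_true hne e2
        (.loop_false ((eval_nonrootExp hw hr'.valid hσ' h6').2 hr'.sup_root)), ?_, hσ', hr', ?_, hz⟩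
      · simp only [RExp.cost, nonrootExp]; omega
      · push_cast; linarith
  | k + 2, hk =>
    cases hp : S.sup v with
    | none => simp [climb, hp] at hk
    | some p =>
    cases hg : S.sup p with
    | none => simp [climb, hp, hg] at hk
    | some g =>
      obtain ⟨d, hd⟩ := h.sup_eq_some_iff.1 hp
      obtain ⟨e, he⟩ := h.sup_eq_some_iff.1 hg
      have e7 : σ.arr 3 (σ.reg 6) = nodeWord p := by rw [h6, hσ.up, h.up_ch hd]; rfl
      set σ₀ := σ.setReg 7 (σ.arr 3 (σ.reg 6)) with hσ₀
      have hσ₀' : Rep σ₀ S := hσ.setReg _ _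
      have r6 : σ₀.reg 6 = nodeWord v := by simpa [hσ₀] using h6
      have r7 : σ₀.reg 7 = nodeWord p := by simp [hσ₀, e7]
      have hn7 : (nonrootExp 7).eval w σ₀ ≠ 0 := by
        rw [Ne, eval_nonrootExp hw h hσ₀' r7, hg]; simp
      have hne : (nonrootExp 6).eval w σ ≠ 0 := by
        rw [Ne, eval_nonrootExp hw h hσ h6, hp]; simp
      have hside : ∀ {e : Bool} {x y : Fin n}, S.ch e x = some y →
          (S.ch false x = some y ↔ e = false) := by
        intro e x y hxy
        constructor
        · intro h3; exact h.ch_inj hxy h3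
        · rintro rfl; exact hxy
      have hss : sameSideExp.eval w σ₀ = 0 ↔ e ≠ d := by
        simp only [sameSideExp, RExp.eval, apply_eq hw1, r6, r7, hσ₀'.up, h.up_ch he,
          optWord_some, hσ₀'.left, optWord_eq_nodeWord, hside hd, hside he]
        cases d <;> cases e <;> simp
      have main : ∃ σ', ∃ t ≤ 270, ∃ S₂ r', Exec w splayStep σ σ' t ∧ Rep σ' S₂ ∧
          σ'.reg 6 = nodeWord v ∧ Reshaped S S₂ P r r' ∧ climb S₂.sup k v = some r' ∧
          pot S₂.up + 2 ≤ pot S.up + 3 * (rank S.up g - rank S.up v) ∧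
          rank S₂.up v = rank S.up g := by
        by_cases hed : e = d
        · subst hed
          obtain ⟨r', a1, a2, a3, a4⟩ := h.zigzig hd he hr hk
          obtain ⟨σ₁, t₁, ht₁, x₁, hσ₁⟩ := exec_rotateProg hw h he
            (hσ₀'.setReg 2 (nodeWord p)) (by simp)
          obtain ⟨t₂, ht₂, x₂⟩ := exec_splayFirst_of_rot hn7
            (by rw [if_neg (by rw [hss]; simp), r7]) x₁ ht₁
          obtain ⟨σ', t', ht', x', hσ', h6'⟩ := exec_splayStep_of_first hw (h.rot he)
            (h.zigzig_ch hd he) x₂ hσ₁ (by rw [x₁.reg_eq (by decide)]; simpa using r6) ht₂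
          exact ⟨σ', t', ht', _, r', x', hσ', h6', a1, a2, a3, a4⟩
        · obtain rfl : e = !d := by cases d <;> cases e <;> simp_all
          obtain ⟨r', a1, a2, a3, a4⟩ := h.zigzag hd he hr hk
          obtain ⟨σ₁, t₁, ht₁, x₁, hσ₁⟩ := exec_rotateProg hw h hd
            (hσ₀'.setReg 2 (nodeWord v)) (by simp)
          obtain ⟨t₂, ht₂, x₂⟩ := exec_splayFirst_of_rot hn7
            (by rw [if_pos (by rw [hss]; exact hed), r6]) x₁ ht₁
          obtain ⟨σ', t', ht', x', hσ', h6'⟩ := exec_splayStep_of_first hw (h.rot hd)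
            (h.rot_ch_parent hd he) x₂ hσ₁ (by rw [x₁.reg_eq (by decide)]; simpa using r6) ht₂
          exact ⟨σ', t', ht', _, r', x', hσ', h6', a1, a2, a3, a4⟩
      obtain ⟨σ₁, t₁, ht₁, S₂, r', x₁, hσ₁, h6₁, a1, a2, a3, a4⟩ := main
      obtain ⟨σ', t', S', x', ht', hσ', b1, b2, b3⟩ :=
        ih k (by omega) a1.valid hσ₁ h6₁ a2 a1.sup_root
      rw [a1.rank_root, a4] at b2 b3
      refine ⟨σ', _, S', .loop_true hne x₁ x', ?_, hσ', a1.trans b1, ?_, ?_⟩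
      · simp only [RExp.cost, nonrootExp]; omega
      · push_cast; linarith
      · linarith

end DPF

namespace DPF

open RExp Cmd

variable {n w : ℕ} {S : LCState n} {P : Fin n → Option (Fin n)}

/-! ### Access -/

theorem rep_splice (hw : n < 2 ^ w) (h : Valid S P) {y : Fin n} {o : Option (Fin n)}
    (hy : S.sup y = none) (ho : ∀ c, o = some c → S.sup c = none ∧ S.up c = some y)
    {σ : Store} (hσ : Rep σ S) {e : RExp}
    (he : e.eval w (σ.setArr 2 (nodeWord y) (optWord o)) = nodeWord y) :
    Rep ((σ.setArr 2 (nodeWord y) (optWord o)).setArr 5 (nodeWord y)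
      ((sizeExp e).eval w (σ.setArr 2 (nodeWord y) (optWord o)))) (S.splice y o) := by
  have h' := h.splice hy ho
  have hsz : 1 + optSize S.sz (S.ch false y) + optSize S.sz o ≤ n := by
    have := h'.sz_le y
    simpa [LCState.splice] using this
  rw [eval_sizeExp hw he (a := optSize S.sz (S.ch false y)) (b := optSize S.sz o)
    (by simp [hσ.left, hσ.sz_opt]) (by simp [hσ.sz_opt]) hsz]
  constructor
  · intro d x
    by_cases hx : x = y <;> cases d <;> simp [sideArr, hσ.left, hσ.right, LCState.splice, hx]
  · intro x; simpa [LCState.splice] using hσ.up x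
  · intro x; by_cases hx : x = y <;> simp [hσ.sz, LCState.splice, hx]
  · intro d; simp [hσ.side_zero, (nodeWord_ne_zero y).symm]
  · simp [hσ.sz_zero, (nodeWord_ne_zero y).symm]

/-- The node in register `9` is splayed, and the path with the splay tree in register `10`
replaces the part of its path below it. -/
def accessStep : Cmd := block [
  .assign 6 (.reg 9),
  splayProg,
  .store 2 (.reg 9) (.reg 10),
  .store 5 (.reg 9) (sizeExp (.reg 9)),
  .assign 10 (.reg 9),
  .assign 9 (.load 3 (.reg 9))]

/-- The preferred path is extended upwards until it reaches the root; register `9` holds the next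
node above it. -/
def accessLoop : Cmd := .loop (.reg 9) accessStep

/-- The path from the root to the node in register `8` becomes a preferred path, and the node
becomes the root of its splay tree. -/
def accessProg : Cmd := block [
  .assign 9 (.reg 8),
  .assign 10 (.const 0),
  accessLoop,
  .assign 6 (.reg 8),
  splayProg]

/-- The state of an access to `v` before a node is attached to the preferred path: `o` is the
splay tree of the preferred path built so far, and `v` has depth `j - 1` in it; nothing has
been built if `j = 0`. -/
def AccessInv (S : LCState n) (v : Fin n) (y o : Option (Fin n)) (j : ℕ) : Prop :=
  (o = none ∧ y = some v ∧ j = 0) ∨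
    ∃ c k, o = some c ∧ S.sup c = none ∧ S.up c = y ∧ S.ext true c = v ∧
      climb S.sup k v = some c ∧ j = k + 1

/-- `S'` has the roots of virtual trees that `S` has outside of the virtual tree of `v`. -/
def KeepsRoots (S S' : LCState n) (v : Fin n) : Prop :=
  ∀ t, S.up t = none → ¬ IsAncestor S.up t v → S'.up t = none ∧ ¬ IsAncestor S'.up t v

theorem KeepsRoots.trans {S₁ S₂ : LCState n} {v : Fin n} (h₁ : KeepsRoots S S₁ v)
    (h₂ : KeepsRoots S₁ S₂ v) : KeepsRoots S S₂ v := fun t ht hv =>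
  h₂ t (h₁ t ht hv).1 (h₁ t ht hv).2

theorem Reshaped.keepsRoots (h : Valid S P) {S' : LCState n} {r r' v : Fin n}
    (hr : Reshaped S S' P r r') (hv : IsAncestor S.up r v) : KeepsRoots S S' v := by
  intro t ht htv
  have htr : t ≠ r := by rintro rfl; exact htv hv
  obtain ⟨-, -, h1, -, -, h2, -⟩ := hr.other t (h.sup_of_up_none ht) htr
  refine ⟨h1.trans ht, fun h3 => htv ?_⟩
  rw [← mem_desc, ← h2, mem_desc]; exact h3

/-- The amortized time of a step is a constant plus three times the rank that is gained from `y` to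
its new virtual subtree, which is the old virtual subtree of the splay root. -/
theorem exec_accessStep (hw : n < 2 ^ w) (h : Valid S P) {v y : Fin n} {o : Option (Fin n)} {j : ℕ}
    (hI : AccessInv S v (some y) o j) {σ : Store} (hσ : Rep σ S) (h9 : σ.reg 9 = nodeWord y)
    (h10 : σ.reg 10 = optWord o) :
    ∃ σ' t S' y', Exec w accessStep σ σ' t ∧ Rep σ' S' ∧ Valid S' P ∧
      σ'.reg 9 = optWord y' ∧ σ'.reg 10 = nodeWord y ∧ AccessInv S' v y' (some y) (j + 1) ∧
      KeepsRoots S S' v ∧ S'.up y = y' ∧ (desc S.up y).card ≤ (desc S'.up y).card ∧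
      (t : ℝ) ≤ 300 * (pot S.up - pot S'.up + 3 * (rank S'.up y - rank S.up y)) + 640 ∧
      pot S'.up ≤ pot S.up + 3 * (rank S'.up y - rank S.up y) := by
  obtain ⟨k, r, hk, hr⟩ := h.exists_sup_root y
  have hry : IsAncestor S.sup r y := ⟨k, hk⟩
  have hyv : IsAncestor S.up y v := by
    rcases hI with ⟨-, h1, -⟩ | ⟨c, m, -, h1, h2, -, h3, -⟩
    · cases h1; exact .refl _
    · exact (IsAncestor.of_parent h2).trans (h.isAncestor_up_of_sup ⟨m, h3⟩)
  have hkr : IsAncestor S.up r y := h.isAncestor_up_of_sup hry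
  obtain ⟨σ₁, t₁, S₁, x₁, ht₁, hσ₁, hR, hp1, hp2⟩ := exec_splayProg hw h
    (hσ.setReg 6 (nodeWord y)) (by simp) hk hr
  rw [← hR.rank_root] at hp1 hp2
  have g9 : σ₁.reg 9 = nodeWord y := by rw [x₁.reg_eq (by decide)]; simpa using h9
  have g10 : σ₁.reg 10 = optWord o := by rw [x₁.reg_eq (by decide)]; simpa using h10
  -- the path built so far is not touched by splaying `y`
  have ho₀ : ∀ c, o = some c → S.sup c = none ∧ S.up c = some y ∧ c ≠ r := by
    intro c hc
    rcases hI with ⟨h1, -⟩ | ⟨c', m, h0, h1, h2, -⟩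
    · simp [h1] at hc
    · rw [hc] at h0; cases h0
      refine ⟨h1, h2, ?_⟩
      rintro rfl
      exact h.up_forest.not_isAncestor h2 hkr
  have ho : ∀ c, o = some c → S₁.sup c = none ∧ S₁.up c = some y := by
    intro c hc
    obtain ⟨h1, h2, h3⟩ := ho₀ c hc
    obtain ⟨-, a1, a2, -⟩ := hR.other c h1 h3
    exact ⟨a1, a2.trans h2⟩
  have hR2 := rep_splice hw hR.valid hR.sup_root ho hσ₁ (e := .reg 9) (by simpa [RExp.eval] using g9)
  set σ₂ := σ₁.setArr 2 (nodeWord y) (optWord o) with hσ₂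
  set σ₃ := σ₂.setArr 5 (nodeWord y) ((sizeExp (.reg 9)).eval w σ₂) with hσ₃
  have r9 : σ₃.reg 9 = nodeWord y := by simpa [hσ₃, hσ₂] using g9
  have x : Exec w accessStep σ ((σ₃.setReg 10 (nodeWord y)).setReg 9 (σ₃.arr 3 (nodeWord y))) _ :=
    .assign_cons (by simpa [RExp.eval] using h9) (.cons x₁ (.store_cons (j := nodeWord y)
      (x := optWord o) (by simpa [RExp.eval] using g9) (by simpa [RExp.eval] using g10)
      (.store_cons (j := nodeWord y) (by simpa [RExp.eval] using g9) rfl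
        (.assign_cons (by simpa [RExp.eval] using g9)
          (.assign_cons (by simp [RExp.eval, g9, hσ₂, hσ₃]) (.nil _))))))
  have hup : (S₁.splice y o).up = S₁.up := rfl
  refine ⟨_, _, S₁.splice y o, S₁.up y, x, (hR2.setReg _ _).setReg _ _,
    hR.valid.splice hR.sup_root ho, ?_, ?_, Or.inr ⟨y, j, rfl,
      hR.valid.splice_sup_self hR.sup_root ho, rfl, ?_, ?_, rfl⟩, ?_, rfl, ?_, ?_, ?_⟩
  · rw [← hup, ← hR2.up]; simp
  · simp
  · rcases hI with ⟨rfl, h1, rfl⟩ | ⟨c, m, rfl, h1, h2, h3, h4, rfl⟩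
    · cases h1; simp [LCState.splice]
    · obtain ⟨-, -, -, a3, -⟩ := hR.other c h1 (ho₀ c rfl).2.2
      simp [LCState.splice, a3, h3]
  · rcases hI with ⟨rfl, h1, rfl⟩ | ⟨c, m, rfl, h1, h2, h3, h4, rfl⟩
    · cases h1; rfl
    · obtain ⟨-, a1, a2, -, -, -, a4⟩ := hR.other c h1 (ho₀ c rfl).2.2
      exact hR.valid.climb_splice hR.sup_root a1 (a2.trans h2) (a4 m v h4)
  · exact hR.keepsRoots h (hkr.trans hyv)
  · rw [hup, hR.desc_root]
    exact Finset.card_le_card (desc_subset hkr)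
  · rw [hup]
    have ht : (t₁ : ℝ) ≤ 300 * (k + 1) := by exact_mod_cast ht₁
    simp only [RExp.cost, sizeExp]
    push_cast
    linarith
  · exact hp2

/-- The rank differences of the `i` steps telescope. The constant time per step is not bounded by
them, but `i` is at most one more than the depth `k` of `v` in the final splay tree, and this is
paid for when `v` is splayed. The recursion is on a bound `N` for how much the virtual
subtree can still grow, and `ρ` is the rank already reached. -/
theorem exec_accessLoop (hw : n < 2 ^ w) (N : ℕ) {S : LCState n} (h : Valid S P) {v : Fin n}
    {y o : Option (Fin n)} {j : ℕ} (hI : AccessInv S v y o j) {σ : Store} (hσ : Rep σ S)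
    (h9 : σ.reg 9 = optWord y) (h10 : σ.reg 10 = optWord o)
    (hN : ∀ x, y = some x → n < N + (desc S.up x).card) {ρ : ℝ} (hρ : ρ ≤ Real.logb 2 n)
    (hρ' : ∀ x, y = some x → ρ ≤ rank S.up x) :
    ∃ σ' t S' c k i, Exec w accessLoop σ σ' t ∧ Rep σ' S' ∧ Valid S' P ∧ S'.sup c = none ∧
      S'.up c = none ∧ S'.ext true c = v ∧ climb S'.sup k v = some c ∧ j + i = k + 1 ∧
      KeepsRoots S S' v ∧
      (t : ℝ) ≤ 300 * (pot S.up - pot S'.up + 3 * (Real.logb 2 n - ρ)) + 650 * i + 50 ∧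
      pot S'.up ≤ pot S.up + 3 * (Real.logb 2 n - ρ) := by
  induction N generalizing S y o j σ ρ with
  | zero =>
    cases y with
    | some x => exact absurd (hN x rfl) (by have := card_desc_le (F := S.up) x; omega)
    | none =>
      rcases hI with ⟨-, h1, -⟩ | ⟨c, k, -, h1, h2, h3, h4, h5⟩
      · cases h1
      · refine ⟨σ, _, S, c, k, 0, .loop_false (by simpa [RExp.eval] using h9), hσ, h, h1, h2, h3,
          h4, by omega, fun _ ht hv => ⟨ht, hv⟩, ?_, ?_⟩
        · simp [RExp.cost]; linarith
        · linarith
  | succ N ih =>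
    cases y with
    | none =>
      rcases hI with ⟨-, h1, -⟩ | ⟨c, k, -, h1, h2, h3, h4, h5⟩
      · cases h1
      · refine ⟨σ, _, S, c, k, 0, .loop_false (by simpa [RExp.eval] using h9), hσ, h, h1, h2, h3,
          h4, by omega, fun _ ht hv => ⟨ht, hv⟩, ?_, ?_⟩
        · simp [RExp.cost]; linarith
        · linarith
    | some y =>
      obtain ⟨σ₁, t₁, S₁, y', x₁, hσ₁, h₁, g9, g10, hI₁, hK₁, hy', hc, ht₁, hp₁⟩ :=
        exec_accessStep hw h hI hσ h9 h10
      obtain ⟨σ', t', S', c, k, i, x', hσ', h', a1, a2, a3, a4, a5, a6, ht', hp'⟩ :=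
        ih h₁ hI₁ hσ₁ g9 g10 (ρ := rank S₁.up y) (fun x hx => by
          have h1 := h₁.up_forest.card_lt (hy'.trans hx)
          have h2 := hN y rfl
          omega) (rank_le _)
          (fun x hx => rank_mono (desc_subset (.of_parent (hy'.trans hx))))
      have h3 := hρ' y rfl
      refine ⟨σ', _, S', c, k, i + 1, .loop_true (by simp [RExp.eval, h9]) x₁ x', hσ', h', a1, a2,
        a3, a4, by omega, hK₁.trans a6, ?_, ?_⟩
      · simp only [RExp.cost]; push_cast; linarith
      · linarith

/-- The amortized cost of an operation is at most `c (1 + log n)`; the potential is the sum of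
the ranks, scaled so that it pays for the time units of a program. The factor `950 = 300 + 650`
covers the time of a splay and, in an access, of a switch of a preferred child, per unit of splay
depth. -/
def Amort (t : ℕ) (S S' : LCState n) (c : ℝ) : Prop :=
  (t : ℝ) + 950 * pot S'.up ≤ 950 * pot S.up + c * (1 + Real.logb 2 n)

theorem logb_nonneg_of_node (v : Fin n) : 0 ≤ Real.logb 2 (n : ℝ) :=
  Real.logb_nonneg (by norm_num) (by exact_mod_cast v.pos)

/-- Access to `v` leaves `v` as the root of a virtual tree and as the last node of its
preferred path. -/
theorem exec_accessProg (hw : n < 2 ^ w) (h : Valid S P) {v : Fin n} {σ : Store} (hσ : Rep σ S)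
    (h8 : σ.reg 8 = nodeWord v) :
    ∃ σ' t S', Exec w accessProg σ σ' t ∧ Rep σ' S' ∧ Valid S' P ∧ S'.up v = none ∧
      S'.ext true v = v ∧ KeepsRoots S S' v ∧ Amort t S S' 6000 := by
  have hL := logb_nonneg_of_node v
  obtain ⟨σ₁, t₁, S₁, c, k, i, x₁, hσ₁, h₁, a1, a2, a3, a4, a5, a6, ht₁, hp₁⟩ :=
    exec_accessLoop hw (n + 1) h (v := v) (y := some v) (o := none) (j := 0) (Or.inl ⟨rfl, rfl, rfl⟩)
      (σ := (σ.setReg 9 (nodeWord v)).setReg 10 0) ((hσ.setReg _ _).setReg _ _) (by simp) (by simp)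
      (fun x _ => by omega) (ρ := 0) hL (fun x _ => rank_nonneg x)
  obtain ⟨σ₂, t₂, S₂, x₂, ht₂, hσ₂, hR, hp2, -⟩ := exec_splayProg hw h₁
    (hσ₁.setReg 6 (nodeWord v)) (by simp) a4 a1
  have g8 : σ₁.reg 8 = nodeWord v := by rw [x₁.reg_eq (by decide)]; simpa using h8
  have x : Exec w accessProg σ σ₂ _ :=
    .assign_cons (by simpa [RExp.eval] using h8) (.assign_cons (by simp [RExp.eval]) (.cons x₁
      (.assign_cons (by simpa [RExp.eval] using g8) (.cons x₂ (.nil _)))))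
  refine ⟨σ₂, _, S₂, x, hσ₂, hR.valid, hR.up_root.trans a2, (hR.ext_root true).trans a3,
    a6.trans (hR.keepsRoots h₁ (h₁.isAncestor_up_of_sup ⟨k, a4⟩)), ?_⟩
  have ht2 : (t₂ : ℝ) ≤ 300 * (k + 1) := by exact_mod_cast ht₂
  have hi : (i : ℝ) = k + 1 := by exact_mod_cast (by omega : i = k + 1)
  have r1 := rank_le (F := S₁.up) c
  have r2 := rank_nonneg (F := S₁.up) v
  rw [hi] at ht₁
  unfold Amort
  simp only [RExp.cost]
  push_cast
  linarith

/-! ### Selection by depth -/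

/-- The search moves from the node in register `11` to a child; register `12` is reduced by the
number of nodes that are passed when it moves to the right. -/
def selectStep : Cmd := block [
  .ite (.bin .lt (.reg 12) (.reg 13))
    (.assign 11 (.load 1 (.reg 11)))
    (block [.assign 12 (.bin .sub (.bin .sub (.reg 12) (.reg 13)) (.const 1)),
      .assign 11 (.load 2 (.reg 11))]),
  .assign 13 (.load 5 (.load 1 (.reg 11)))]

/-- The search for the node of `selectProg`, without the splaying. Register `13` holds the size of
the left subtree of the current node, so that the node is found when it agrees with register `12`. -/
def selectLoop : Cmd := .loop (.bin .eq (.bin .eq (.reg 12) (.reg 13)) (.const 0)) selectStep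

/-- In the splay tree of the node in register `11`, the node that follows as many nodes as
register `12` says is found and splayed; it is left in register `11`. -/
def selectProg : Cmd := block [
  .assign 13 (.load 5 (.load 1 (.reg 11))),
  selectLoop,
  .assign 6 (.reg 11),
  splayProg]

theorem run_selectStep (hw : 1 < 2 ^ w) {σ : Store} (hlt : σ.reg 12 < 2 ^ w)
    (hne : σ.reg 12 ≠ σ.reg 13) :
    let σ' := selectStep.run w σ
    let a := if σ.reg 12 < σ.reg 13 then σ.arr 1 (σ.reg 11) else σ.arr 2 (σ.reg 11)
    σ'.arr = σ.arr ∧ σ'.reg 11 = a ∧ σ'.reg 13 = σ.arr 5 (σ.arr 1 a) ∧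
      σ'.reg 12 = if σ.reg 12 < σ.reg 13 then σ.reg 12 else σ.reg 12 - σ.reg 13 - 1 := by
  have h1 : (1 : ℕ) % 2 ^ w = 1 := Nat.mod_eq_of_lt hw
  by_cases h : σ.reg 12 < σ.reg 13
  · simp [selectStep, block, run, RExp.eval, apply_lt hw, h]
  · simp [selectStep, block, run, RExp.eval, apply_lt hw, h, h1,
      apply_sub (w := w) (not_lt.1 h) hlt,
      apply_sub (w := w) (show 1 ≤ σ.reg 12 - σ.reg 13 by omega)
        (show σ.reg 12 - σ.reg 13 < 2 ^ w by omega)]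

/-- The depths in a splay tree increase in order by one, and so the search by position finds a
depth. The time is charged to the splay depth `k` of the node found. -/
theorem exec_selectLoop (hw : n < 2 ^ w) (h : Valid S P) (x : Fin n) {σ : Store} (hσ : Rep σ S)
    (h11 : σ.reg 11 = nodeWord x) {d b : ℕ} (h12 : σ.reg 12 = d)
    (h13 : σ.reg 13 = optSize S.sz (S.ch false x)) (hd : d < S.sz x)
    (hb : HasDepth P (S.ext false x) b) :
    ∃ σ' t u k, Exec w selectLoop σ σ' t ∧ σ'.reg 11 = nodeWord u ∧ HasDepth P u (b + d) ∧
      IsAncestor P u (S.ext true x) ∧ climb S.sup k u = some x ∧ t ≤ 50 * (k + 1) := by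
  have hw1 := one_lt_of_node hw x
  induction x using h.child_induction generalizing σ d b with
  | step x ih =>
  have hx := h.hasDepth_ext x hb
  have hsz := h.sz_eq x
  have hszx := h.sz_le x
  set l := optSize S.sz (S.ch false x) with hl
  by_cases hdl : d = l
  · subst hdl
    refine ⟨σ, _, x, 0, .loop_false ?_, h11, hx.1, (h.isAncestor_ext x).2, rfl, ?_⟩
    · simp [RExp.eval, apply_eq hw1, h12, h13]
    · simp [RExp.cost]
  have hne : σ.reg 12 ≠ σ.reg 13 := by rw [h12, h13]; exact hdl
  obtain ⟨t, ht, xs⟩ := exec_run w (c := selectStep) rfl σ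
  obtain ⟨s1, s2, s3, s4⟩ := run_selectStep hw1 (by rw [h12]; omega) hne
  have htest : (RExp.bin .eq (.bin .eq (.reg 12) (.reg 13)) (.const 0)).eval w σ ≠ 0 := by
    simp [RExp.eval, apply_eq hw1, h12, h13, hdl]
  have ht' : t ≤ 40 := ht.trans (by decide)
  have hσ' := hσ.of_arr s1
  rw [h12, h13, h11, hσ.left, hσ.right] at s2 s3
  rw [h12, h13] at s4
  rcases lt_or_gt_of_ne hdl with hlt | hlt
  · rw [if_pos hlt] at s2 s3 s4
    cases hc : S.ch false x with
    | none => rw [hc] at hl; simp at hl; omega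
    | some c =>
      rw [hc, optSize_some] at hl
      rw [hc, optWord_some] at s2 s3
      rw [hσ.left, hσ.sz_opt] at s3
      obtain ⟨σ₁, t₁, u, k, x₁, a1, a2, a3, a4, a5⟩ := ih false c hc hσ' s2 s4 s3
        (by omega) (h.ext_some hc ▸ hb)
      refine ⟨σ₁, _, u, k + 1, .loop_true htest xs x₁, a1, a2, ?_, ?_, ?_⟩
      · exact (a3.trans (.of_parent (h.parent_eq_ext hc))).trans (h.isAncestor_ext x).2
      · rw [climb_add, a4]; simp [climb, h.sup_of_ch hc]
      · simp only [RExp.cost]; omega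
  · rw [if_neg (by omega)] at s2 s3 s4
    cases hc : S.ch true x with
    | none => rw [hc] at hsz; simp at hsz; omega
    | some c =>
      rw [hc, optSize_some] at hsz
      rw [hc, optWord_some] at s2 s3
      rw [hσ.left, hσ.sz_opt] at s3
      obtain ⟨σ₁, t₁, u, k, x₁, a1, a2, a3, a4, a5⟩ := ih true c hc hσ' s2 s4 s3
        (by omega) ((HasDepth.succ_iff (h.parent_ext hc)).2 hx.1)
      refine ⟨σ₁, _, u, k + 1, .loop_true htest xs x₁, a1, ?_, ?_, ?_, ?_⟩
      · rwa [show b + l + 1 + (d - l - 1) = b + d by omega] at a2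
      · rwa [h.ext_some hc]
      · rw [climb_add, a4]; simp [climb, h.sup_of_ch hc]
      · simp only [RExp.cost]; omega

/-- After an access to `v`, the ancestor of `v` at depth `d` is found and splayed. -/
theorem exec_selectProg (hw : n < 2 ^ w) (h : Valid S P) {v : Fin n} {σ : Store} (hσ : Rep σ S)
    (hv : S.up v = none) (hv' : S.ext true v = v) (h11 : σ.reg 11 = nodeWord v) {d : ℕ}
    (h12 : σ.reg 12 = d) (hd : d < S.sz v) :
    ∃ σ' t S' u, Exec w selectProg σ σ' t ∧ Rep σ' S' ∧ Valid S' P ∧ σ'.reg 11 = nodeWord u ∧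
      HasDepth P u d ∧ IsAncestor P u v ∧ S'.up u = none ∧ S'.ext true u = v ∧
      Amort t S S' 6000 := by
  have hL := logb_nonneg_of_node v
  have hsv := h.sup_of_up_none hv
  have hb : HasDepth P (S.ext false v) 0 := by
    rw [HasDepth.zero_iff, h.root' hsv, hv]
  obtain ⟨σ₁, t₁, u, k, x₁, a1, a2, a3, a4, a5⟩ := exec_selectLoop hw h v
    (σ := σ.setReg 13 (optSize S.sz (S.ch false v))) (hσ.setReg _ _) (by simpa using h11)
    (by simpa using h12) (by simp) hd hb
  have hσ₁ : Rep σ₁ S := by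
    refine hσ.of_arr (funext fun a => ?_)
    rw [x₁.arr_eq (by simp [selectLoop, selectStep, block, arrs])]; rfl
  obtain ⟨σ₂, t₂, S₂, x₂, ht₂, hσ₂, hR, hp2, hp3⟩ := exec_splayProg hw h
    (hσ₁.setReg 6 (nodeWord u)) (by simp) a4 hsv
  have x : Exec w selectProg σ σ₂ _ :=
    .assign_cons (by simp [RExp.eval, h11, hσ.left, hσ.sz_opt]) (.cons x₁
      (.assign_cons (by simpa [RExp.eval] using a1) (.cons x₂ (.nil _))))
  refine ⟨σ₂, _, S₂, u, x, hσ₂, hR.valid, ?_, ?_, ?_, hR.up_root.trans hv,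
    (hR.ext_root true).trans hv', ?_⟩
  · rw [x₂.reg_eq (by decide)]; simpa using a1
  · simpa using a2
  · rwa [hv'] at a3
  have ht2 : (t₂ : ℝ) ≤ 300 * (k + 1) := by exact_mod_cast ht₂
  have ht1 : (t₁ : ℝ) ≤ 50 * (k + 1) := by exact_mod_cast a5
  have r1 := rank_le (F := S.up) v
  have r2 := rank_nonneg (F := S.up) u
  unfold Amort
  simp only [RExp.cost]
  push_cast
  linarith

end DPF

namespace DPF

open RExp Cmd

variable {n w : ℕ} {S : LCState n} {P : Fin n → Option (Fin n)}

/-! ### Ancestors, roots, cuts and links on the machine -/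

theorem Amort.mono {t : ℕ} {S S' : LCState n} {c c' : ℝ} (v : Fin n) (h : Amort t S S' c)
    (hc : c ≤ c') : Amort t S S' c' := by
  have := logb_nonneg_of_node v
  unfold Amort at *
  nlinarith

theorem Amort.of_le {t t' : ℕ} {S S' : LCState n} {c : ℝ} (h : Amort t S S' c) (ht : t' ≤ t) :
    Amort t' S S' c := by
  have : (t' : ℝ) ≤ t := by exact_mod_cast ht
  unfold Amort at *
  linarith

theorem Amort.trans {t₁ t₂ : ℕ} {S₁ S₂ S₃ : LCState n} {c₁ c₂ : ℝ} (h₁ : Amort t₁ S₁ S₂ c₁)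
    (h₂ : Amort t₂ S₂ S₃ c₂) : Amort (t₁ + t₂) S₁ S₃ (c₁ + c₂) := by
  unfold Amort at *
  push_cast
  linarith

theorem Amort.add_time {t s : ℕ} {S S' : LCState n} {c : ℝ} (v : Fin n) (h : Amort t S S' c) :
    Amort (t + s) S S' (c + s) := by
  have := logb_nonneg_of_node v
  unfold Amort at *
  push_cast
  have : (0 : ℝ) ≤ s * Real.logb 2 n := by positivity
  linarith

theorem Amort.refl (v : Fin n) (S : LCState n) (t : ℕ) : Amort t S S t := by
  have := logb_nonneg_of_node v
  unfold Amort
  have : (0 : ℝ) ≤ t * Real.logb 2 n := by positivity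
  linarith

/-- After an access to `v`, its splay tree consists of its ancestors, and `sz v` gives its depth. -/
theorem Valid.hasDepth_accessed (h : Valid S P) {v : Fin n} (hv : S.up v = none)
    (hv' : S.ext true v = v) : HasDepth P v (S.sz v - 1) := by
  have hb : HasDepth P (S.ext false v) 0 := by
    rw [HasDepth.zero_iff, h.root' (h.sup_of_up_none hv), hv]
  simpa [hv'] using (h.hasDepth_ext v hb).2

/-- The ancestor of the node in register `8` at the depth in register `14` is left in
register `11`. -/
def ancestorProg : Cmd := block [accessProg, .assign 11 (.reg 8), .assign 12 (.reg 14), selectProg]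

theorem exec_ancestorProg (hw : n < 2 ^ w) (h : Valid S P) {v : Fin n} {σ : Store} (hσ : Rep σ S)
    (h8 : σ.reg 8 = nodeWord v) {d e : ℕ} (h14 : σ.reg 14 = d) (he : HasDepth P v e)
    (hde : d ≤ e) :
    ∃ σ' t S' u, Exec w ancestorProg σ σ' t ∧ Rep σ' S' ∧ Valid S' P ∧ σ'.reg 11 = nodeWord u ∧
      HasDepth P u d ∧ IsAncestor P u v ∧ S'.up u = none ∧ S'.ext true u = v ∧
      Amort t S S' 12100 := by
  obtain ⟨σ₁, t₁, S₁, x₁, hσ₁, h₁, a1, a2, -, a4⟩ := exec_accessProg hw h hσ h8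
  have hd := he.unique (h₁.hasDepth_accessed a1 a2)
  have hp := h₁.sz_pos v
  have g8 : σ₁.reg 8 = nodeWord v := by rw [x₁.reg_eq (by decide), h8]
  have g14 : σ₁.reg 14 = d := by rw [x₁.reg_eq (by decide), h14]
  obtain ⟨σ₂, t₂, S₂, u, x₂, hσ₂, h₂, b1, b2, b3, b4, b5, b6⟩ := exec_selectProg hw h₁
    (σ := (σ₁.setReg 11 (nodeWord v)).setReg 12 d) ((hσ₁.setReg _ _).setReg _ _) a1 a2 (by simp)
    (by simp) (show d < S₁.sz v by omega)
  have x : Exec w ancestorProg σ σ₂ _ :=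
    .cons x₁ (.assign_cons (by simpa [RExp.eval] using g8)
      (.assign_cons (by simpa [RExp.eval] using g14) (.cons x₂ (.nil _))))
  refine ⟨σ₂, _, S₂, u, x, hσ₂, h₂, b1, b2, b3, b4, b5, ?_⟩
  refine (((a4.trans b6).add_time (s := 5) v).mono v (show _ ≤ (12100 : ℝ) by norm_num)).of_le ?_
  simp only [RExp.cost]; omega

/-- The root of the tree of the node in register `8` is left in register `11`. -/
def rootProg : Cmd := block [.assign 14 (.const 0), ancestorProg]

theorem exec_rootProg (hw : n < 2 ^ w) (h : Valid S P) {v : Fin n} {σ : Store} (hσ : Rep σ S)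
    (h8 : σ.reg 8 = nodeWord v) :
    ∃ σ' t S' r, Exec w rootProg σ σ' t ∧ Rep σ' S' ∧ Valid S' P ∧ σ'.reg 11 = nodeWord r ∧
      P r = none ∧ IsAncestor P r v ∧ Amort t S S' 12200 := by
  obtain ⟨e, he⟩ := h.forest.exists_hasDepth v
  obtain ⟨σ₁, t₁, S₁, r, x₁, hσ₁, h₁, a1, a2, a3, -, -, a4⟩ := exec_ancestorProg hw h
    (hσ.setReg 14 0) (by simpa using h8) (d := 0) (by simp) he (Nat.zero_le e)
  have x : Exec w rootProg σ σ₁ _ := .assign_cons (by simp [RExp.eval]) (.cons x₁ (.nil _))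
  refine ⟨σ₁, _, S₁, r, x, hσ₁, h₁, a1, HasDepth.zero_iff.1 a2, a3, ?_⟩
  refine ((a4.add_time (s := 3) v).mono v (show _ ≤ (12200 : ℝ) by norm_num)).of_le ?_
  simp only [RExp.cost]; omega

/-- The node in register `8`, the root of a virtual tree, is cut off its parent. -/
def cutProg : Cmd := block [
  .store 3 (.load 1 (.reg 8)) (.const 0),
  .store 1 (.reg 8) (.const 0),
  .store 5 (.reg 8) (sizeExp (.reg 8))]

theorem exec_cutProg (hw : n < 2 ^ w) (h : Valid S P) {v : Fin n} (hv : S.up v = none)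
    {σ : Store} (hσ : Rep σ S) (h8 : σ.reg 8 = nodeWord v) :
    ∃ σ', ∃ t ≤ 50, Exec w cutProg σ σ' t ∧ Rep σ' (S.cut v) := by
  obtain ⟨t, ht, x⟩ := exec_run w (c := cutProg) rfl σ
  refine ⟨_, t, ht.trans (by decide), x, ?_⟩
  have h' := h.cut hv
  have hsz : 1 + 0 + optSize S.sz (S.ch true v) ≤ n := by
    have := h'.sz_le v
    simpa [LCState.cut] using this
  have e0 : cutProg.run w σ = ((σ.setArr 3 (optWord (S.ch false v)) 0).setArr 1 (nodeWord v)
      0).setArr 5 (nodeWord v) (1 + 0 + optSize S.sz (S.ch true v)) := by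
    have := eval_sizeExp hw (e := .reg 8) (v := v)
      (σ := (σ.setArr 3 (optWord (S.ch false v)) 0).setArr 1 (nodeWord v) 0)
      (by simpa [RExp.eval] using h8) (a := 0) (b := optSize S.sz (S.ch true v))
      (by simp [hσ.sz_zero]) (by simp [hσ.right, hσ.sz_opt]) hsz
    rw [← this]
    simp [cutProg, block, run, RExp.eval, h8, hσ.left]
  rw [e0]
  constructor
  · intro d x
    by_cases hx : x = v <;> cases d <;> simp [sideArr, hσ.left, hσ.right, LCState.cut, hx]
  · intro x
    by_cases hx : S.ch false v = some x <;> simp [hσ.up, LCState.cut, hx]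
  · intro x; by_cases hx : x = v <;> simp [hσ.sz, LCState.cut, hx]
  · intro d; simp [hσ.side_zero]
  · simp [hσ.sz_zero, (nodeWord_ne_zero v).symm]

/-- The root in register `15` is made a child of the node in register `16` of another tree. -/
def linkProg : Cmd := block [
  .assign 8 (.reg 15),
  accessProg,
  .assign 8 (.reg 16),
  accessProg,
  .store 3 (.reg 15) (.reg 16)]

theorem exec_linkProg (hw : n < 2 ^ w) (h : Valid S P) {a b : Fin n} (ha : P a = none)
    (hab : ¬ IsAncestor P a b) {σ : Store} (hσ : Rep σ S) (h15 : σ.reg 15 = nodeWord a)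
    (h16 : σ.reg 16 = nodeWord b) :
    ∃ σ' t S', Exec w linkProg σ σ' t ∧ Rep σ' S' ∧ Valid S' (Function.update P a (some b)) ∧
      Amort t S S' 13000 := by
  obtain ⟨σ₁, t₁, S₁, x₁, hσ₁, h₁, a1, -, -, a2⟩ := exec_accessProg hw h
    (v := a) (hσ.setReg 8 (nodeWord a)) (by simp)
  have g15 : σ₁.reg 15 = nodeWord a := by rw [x₁.reg_eq (by decide)]; simpa using h15
  have g16 : σ₁.reg 16 = nodeWord b := by rw [x₁.reg_eq (by decide)]; simpa using h16
  obtain ⟨σ₂, t₂, S₂, x₂, hσ₂, h₂, b1, -, b3, b2⟩ := exec_accessProg hw h₁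
    (v := b) (hσ₁.setReg 8 (nodeWord b)) (by simp)
  have k15 : σ₂.reg 15 = nodeWord a := by rw [x₂.reg_eq (by decide)]; simpa using g15
  have k16 : σ₂.reg 16 = nodeWord b := by rw [x₂.reg_eq (by decide)]; simpa using g16
  have hne : a ≠ b := by rintro rfl; exact hab (.refl _)
  -- `a` stays a root of a virtual tree, for `b` lies in another one
  have ha₂ : S₂.up a = none := (b3 a a1 fun hc =>
    hab ((h₁.root_iff_of_isAncestor_up ha hc).1 (.refl a))).1
  have x : Exec w linkProg σ (σ₂.setArr 3 (nodeWord a) (nodeWord b)) _ :=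
    .assign_cons (by simpa [RExp.eval] using h15) (.cons x₁
      (.assign_cons (by simpa [RExp.eval] using g16) (.cons x₂
        (.store_cons (by simpa [RExp.eval] using k15) (by simpa [RExp.eval] using k16) (.nil _)))))
  refine ⟨_, _, S₂.link a b, x, ?_, h₂.link ha ha₂ b1 hab, ?_⟩
  · constructor
    · intro d x; simpa [LCState.link] using hσ₂.side d x
    · intro x; by_cases hx : x = a <;> simp [LCState.link, hx, hσ₂.up]
    · intro x; simpa [LCState.link] using hσ₂.sz x
    · intro d; simpa using hσ₂.side_zero d
    · simpa using hσ₂.sz_zero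
  · have h3 := Valid.link_pot_le S₂ ha₂ b1 hne
    have h4 := logb_nonneg_of_node a
    have h5 := a2.trans b2
    unfold Amort at h5 ⊢
    simp only [RExp.cost]
    push_cast at h5 ⊢
    linarith

/-! ### Functional graphs -/

/-- The forest `P` consists of pointers of `f`, and the pointer of each root leads into its
own tree. -/
structure Encodes (P : Fin n → Option (Fin n)) (f : Fin n → Fin n) : Prop where
  nonroot : ∀ {v u}, P v = some u → f v = u
  root : ∀ {r}, P r = none → IsAncestor P r (f r)

theorem HasDepth.exists_climb {F : Fin n → Option (Fin n)} {x : Fin n} {e j : ℕ}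
    (h : HasDepth F x e) (hj : j ≤ e) : ∃ u, climb F j x = some u ∧ HasDepth F u (e - j) := by
  obtain ⟨i, rfl⟩ := Nat.exists_eq_add_of_le hj
  obtain ⟨r, hr, hr'⟩ := h
  rw [climb_add] at hr
  cases hu : climb F j x with
  | none => simp [hu] at hr
  | some u =>
    refine ⟨u, rfl, r, ?_, hr'⟩
    simpa [hu] using hr

namespace Encodes

variable {f : Fin n → Fin n}

theorem iterate_of_climb (h : Encodes P f) {j : ℕ} {v u : Fin n} (hj : climb P j v = some u) :
    f^[j] v = u := by
  induction j generalizing v with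
  | zero => simpa [climb] using hj
  | succ j ih =>
    cases hv : P v with
    | none => simp [climb, hv] at hj
    | some y =>
      rw [climb_succ_of_some hv] at hj
      rw [Function.iterate_succ_apply, h.nonroot hv, ih hj]

/-- The path from `f r` up to the root `r` is a cycle of `f`. -/
theorem isPeriodicPt (h : Encodes P f) {r : Fin n} (hr : P r = none) {e : ℕ}
    (he : HasDepth P (f r) e) : Function.IsPeriodicPt f (e + 1) (f r) := by
  obtain ⟨r', h1, h2⟩ := he
  obtain rfl := root_unique h2 hr ⟨e, h1⟩ (h.root hr)
  show f^[e + 1] (f r') = f r'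
  rw [Function.iterate_succ_apply', h.iterate_of_climb h1]

theorem mem_periodicPts_iff (h : Encodes P f) (hP : IsForest P) {r v : Fin n} (hr : P r = none)
    (hv : IsAncestor P r v) : v ∈ Function.periodicPts f ↔ IsAncestor P v (f r) := by
  obtain ⟨b, hb⟩ := hv
  have hb' := h.iterate_of_climb hb
  constructor
  · rintro ⟨m, hm, hp⟩
    obtain ⟨e, he⟩ := hP.exists_hasDepth (f r)
    -- going around the cycle of `v` often enough, `v` is met after `r`
    obtain ⟨j, hj⟩ : ∃ j, f^[j] (f r) = v := by
      refine ⟨m * (b + 1) - (b + 1), ?_⟩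
      rw [← hb', ← Function.iterate_succ_apply' f b v, ← Function.iterate_add_apply,
        Nat.sub_add_cancel (Nat.le_mul_of_pos_left _ hm)]
      exact hp.mul_const (b + 1)
    rw [← (h.isPeriodicPt hr he).iterate_mod_apply] at hj
    obtain ⟨u, hu, -⟩ := he.exists_climb (Nat.lt_succ_iff.1 (Nat.mod_lt j (Nat.succ_pos e)))
    rw [h.iterate_of_climb hu] at hj
    exact ⟨_, hj ▸ hu⟩
  · rintro ⟨a, ha⟩
    refine ⟨a + (1 + b), by omega, ?_⟩
    show f^[a + (1 + b)] v = v
    rw [Function.iterate_add_apply, Function.iterate_add_apply, hb', Function.iterate_one,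
      h.iterate_of_climb ha]

end Encodes

/-- The store holds a link-cut tree of a forest that encodes the pointers `f`, and the additional
pointers of the roots. -/
structure Holds (σ : Store) (S : LCState n) (P : Fin n → Option (Fin n)) (f : Fin n → Fin n) :
    Prop where
  rep : Rep σ S
  valid : Valid S P
  encodes : Encodes P f
  extra : ∀ v, σ.arr 4 (nodeWord v) = if P v = none then nodeWord (f v) else 0

theorem Holds.encodesPointers {σ : Store} {f : Fin n → Fin n} (h : Holds σ S P f) :
    EncodesPointers σ P f where
  nonroot v u hv := ⟨h.encodes.nonroot hv, by rw [Store.extra, h.extra, hv]; simp⟩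
  root r hr := ⟨by rw [Store.extra, h.extra, if_pos hr], h.encodes.root hr⟩
  cycle _ _ hr hv := h.encodes.mem_periodicPts_iff h.valid.forest hr hv

/-- As `Holds`, but `v` is a root whose additional pointer is arbitrary. -/
structure HoldsExcept (σ : Store) (S : LCState n) (P : Fin n → Option (Fin n))
    (f : Fin n → Fin n) (v : Fin n) : Prop where
  rep : Rep σ S
  valid : Valid S P
  root_self : P v = none
  nonroot : ∀ {x u}, P x = some u → f x = u
  root : ∀ {r}, r ≠ v → P r = none → IsAncestor P r (f r)
  extra : ∀ x, x ≠ v → σ.arr 4 (nodeWord x) = if P x = none then nodeWord (f x) else 0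

/-- The node in register `0` is made a root. If its old root `r` loses the node `f r` by this, then
`r` is linked to `f r`. -/
def detachProg : Cmd := block [
  .assign 8 (.reg 0),
  rootProg,
  .ite (.bin .eq (.reg 11) (.reg 0)) .skip
    (block [
      .assign 15 (.reg 11),
      .assign 8 (.reg 0),
      accessProg,
      cutProg,
      .assign 16 (.load 4 (.reg 15)),
      .assign 8 (.reg 16),
      rootProg,
      .ite (.bin .eq (.reg 11) (.reg 0)) (block [linkProg, .store 4 (.reg 15) (.const 0)]) .skip])]

theorem Rep.setArr_four {σ : Store} (h : Rep σ S) (i x : ℕ) : Rep (σ.setArr 4 i x) S := by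
  have h1 : ∀ d, sideArr d ≠ 4 := by intro d; cases d <;> simp [sideArr]
  constructor
  · intro d v; simpa [h1] using h.side d v
  · intro v; simpa using h.up v
  · intro v; simpa using h.sz v
  · intro d; simpa [h1] using h.side_zero d
  · simpa using h.sz_zero

theorem exec_detachProg (hw : n < 2 ^ w) {f : Fin n → Fin n} {σ : Store} (h : Holds σ S P f)
    {v : Fin n} (h0 : σ.reg 0 = nodeWord v) :
    ∃ σ' t S' P', Exec w detachProg σ σ' t ∧ HoldsExcept σ' S' P' f v ∧ Amort t S S' 50000 := by
  have hw1 := one_lt_of_node hw v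
  obtain ⟨σ₁, t₁, S₁, r, x₁, hσ₁, h₁, a1, a2, a3, a4⟩ := exec_rootProg hw h.valid
    (v := v) (h.rep.setReg 8 (nodeWord v)) (by simp)
  have g0 : σ₁.reg 0 = nodeWord v := by rw [x₁.reg_eq (by decide)]; simpa using h0
  have f1 : σ₁.arr 4 = σ.arr 4 := x₁.arr_eq (by decide)
  by_cases hrv : r = v
  · subst hrv
    have x : Exec w detachProg σ σ₁ _ := .assign_cons (by simpa [RExp.eval] using h0) (.cons x₁
      (.cons (.ite_true (by simp [RExp.eval, apply_eq hw1, a1, g0]) (.skip _)) (.nil _)))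
    refine ⟨σ₁, _, S₁, P, x, ⟨hσ₁, h₁, a2, h.encodes.nonroot, fun _ => h.encodes.root, ?_⟩, ?_⟩
    · intro x _; rw [f1, h.extra]
    · refine ((a4.add_time (s := 8) r).mono r (show _ ≤ (50000 : ℝ) by norm_num)).of_le ?_
      simp only [RExp.cost]; omega
  set P₁ := Function.update P v none with hP₁
  have hP₁x : ∀ x, x ≠ v → P₁ x = P x := fun x hx => by simp [hP₁, hx]
  have hP₁v : P₁ v = none := by simp [hP₁]
  have hP₁s : ∀ {x u}, P₁ x = some u → P x = some u := by
    intro x u hx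
    by_cases hxv : x = v
    · subst hxv; rw [hP₁v] at hx; cases hx
    · rwa [hP₁x x hxv] at hx
  obtain ⟨σ₂, t₂, S₂, x₂, hσ₂, h₂, b1, -, -, b2⟩ := exec_accessProg hw h₁
    (σ := (σ₁.setReg 15 (nodeWord r)).setReg 8 (nodeWord v)) (v := v)
    ((hσ₁.setReg _ _).setReg _ _) (by simp)
  have g8 : σ₂.reg 8 = nodeWord v := by rw [x₂.reg_eq (by decide)]; simp
  obtain ⟨σ₃, t₃, ht₃, x₃, hσ₃⟩ := exec_cutProg hw h₂ b1 hσ₂ g8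
  have h₃ : Valid (S₂.cut v) P₁ := h₂.cut b1
  have f3 : σ₃.arr 4 = σ.arr 4 := by
    rw [x₃.arr_eq (by decide), x₂.arr_eq (by decide)]; exact f1
  have k15 : σ₃.reg 15 = nodeWord r := by
    rw [x₃.reg_eq (by decide), x₂.reg_eq (by decide)]; simp
  have k0 : σ₃.reg 0 = nodeWord v := by
    rw [x₃.reg_eq (by decide), x₂.reg_eq (by decide)]; simpa using g0
  have hc : σ₃.arr 4 (nodeWord r) = nodeWord (f r) := by rw [f3, h.extra, if_pos a2]
  obtain ⟨σ₄, t₄, S₄, q, x₄, hσ₄, h₄, c1, c2, c3, c4⟩ := exec_rootProg hw h₃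
    (σ := (σ₃.setReg 16 (nodeWord (f r))).setReg 8 (nodeWord (f r)))
    ((hσ₃.setReg _ _).setReg _ _) (v := f r) (by simp)
  have f4 : σ₄.arr 4 = σ.arr 4 := by rw [x₄.arr_eq (by decide)]; exact f3
  have l15 : σ₄.reg 15 = nodeWord r := by rw [x₄.reg_eq (by decide)]; simpa using k15
  have l16 : σ₄.reg 16 = nodeWord (f r) := by rw [x₄.reg_eq (by decide)]; simp
  have l0 : σ₄.reg 0 = nodeWord v := by rw [x₄.reg_eq (by decide)]; simpa using k0
  have hcut : Amort t₃ S₂ (S₂.cut v) 50 := by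
    have h1 := Valid.cut_pot_le S₂ v
    have h2 := Amort.refl v S₂ t₃
    have h3 := logb_nonneg_of_node v
    have h4 : (t₃ : ℝ) ≤ 50 := by exact_mod_cast ht₃
    unfold Amort at *
    nlinarith
  have hA := ((a4.trans b2).trans hcut).trans c4
  -- the roots of the other trees keep the nodes to which they point
  have hroot : ∀ {r'}, r' ≠ v → r' ≠ r → P r' = none → IsAncestor P₁ r' (f r') := by
    intro r' _ hr'r hr'
    have h1 := h.encodes.root hr'
    rcases h1.update_none (v := v) with h2 | h2
    · exact h2
    · exact absurd (root_unique hr' a2 h1 (a3.trans h2.of_update_none)) hr'r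
  have body : ∀ {σ' t}, Exec w (.ite (.bin .eq (.reg 11) (.reg 0))
      (block [linkProg, .store 4 (.reg 15) (.const 0)]) .skip) σ₄ σ' t →
      ∃ s ≤ t₁ + t₂ + t₃ + t₄ + t + 40, Exec w detachProg σ σ' s := by
    intro σ' t x
    have y : Exec w detachProg σ σ' _ := .assign_cons (by simpa [RExp.eval] using h0) (.cons x₁
      (.cons (.ite_false (by simp [RExp.eval, apply_eq hw1, a1, g0, hrv])
        (.assign_cons (by simpa [RExp.eval] using a1) (.assign_cons (x := nodeWord v)
          (by simpa [RExp.eval] using g0) (.cons x₂ (.cons x₃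
          (.assign_cons (x := nodeWord (f r)) (by simp [RExp.eval, k15, hc])
            (.assign_cons (x := nodeWord (f r)) (by simp [RExp.eval])
              (.cons x₄ (.cons x (.nil _))))))))))
        (.nil _)))
    refine ⟨_, ?_, y⟩
    simp only [RExp.cost]; omega
  by_cases hqv : q = v
  · subst hqv
    have hnot : ¬ IsAncestor P₁ r (f r) := fun h1 =>
      hrv (root_unique (by rw [hP₁x r hrv]; exact a2) c2 h1 c3)
    obtain ⟨σ₅, t₅, S₅, x₅, hσ₅, h₅, d1⟩ := exec_linkProg hw h₄
      (by rw [hP₁x r hrv]; exact a2) hnot hσ₄ l15 l16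
    have m15 : σ₅.reg 15 = nodeWord r := by rw [x₅.reg_eq (by decide)]; exact l15
    have f5 : σ₅.arr 4 = σ.arr 4 := by rw [x₅.arr_eq (by decide)]; exact f4
    obtain ⟨s, hs, y⟩ := body (.ite_true
      (by simp [RExp.eval, apply_eq hw1, c1, l0]) (.cons x₅ (.store_cons
        (by simpa [RExp.eval] using m15) (x := 0) (by simp [RExp.eval]) (.nil _))))
    simp only [RExp.cost] at hs
    refine ⟨σ₅.setArr 4 (nodeWord r) 0, s, S₅, _, y, ⟨hσ₅.setArr_four _ _, h₅, ?_, ?_, ?_, ?_⟩, ?_⟩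
    · simp [Ne.symm hrv, hP₁v]
    · intro x u hx
      by_cases hxr : x = r
      · subst hxr; simpa using hx
      · exact h.encodes.nonroot (hP₁s (by simpa [hxr] using hx))
    · intro r' hr'v hr'
      have hr'r : r' ≠ r := by rintro rfl; simp at hr'
      have h1 : P r' = none := by
        rw [Function.update_of_ne hr'r, hP₁x r' hr'v] at hr'; exact hr'
      exact (hroot hr'v hr'r h1).update_root (by rw [hP₁x r hrv]; exact a2)
    · intro x hx
      by_cases hxr : x = r
      · subst hxr; simp
      · simp [hxr, f5, h.extra, hP₁x x hx]
    · refine (((hA.trans d1).add_time (s := 60) q).mono q (show _ ≤ (50000 : ℝ) by norm_num)).of_le ?_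
      omega
  · obtain ⟨s, hs, y⟩ := body (.ite_false (by simp [RExp.eval, apply_eq hw1, c1, l0, hqv])
      (.skip _))
    simp only [RExp.cost] at hs
    refine ⟨σ₄, s, S₄, P₁, y, ⟨hσ₄, h₄, hP₁v, fun hx => h.encodes.nonroot (hP₁s hx), ?_, ?_⟩, ?_⟩
    · intro r' hr'v hr'
      rw [hP₁x r' hr'v] at hr'
      by_cases hr'r : r' = r
      · subst hr'r
        rcases (h.encodes.root hr').update_none (v := v) with h2 | h2
        · exact h2
        · exact absurd (root_unique c2 hP₁v c3 h2) hqv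
      · exact hroot hr'v hr'r hr'
    · intro x hx
      rw [f4, h.extra, hP₁x x hx]
    · refine ((hA.add_time (s := 60) v).mono v (show _ ≤ (50000 : ℝ) by norm_num)).of_le ?_
      omega

end DPF

namespace DPF

open RExp Cmd

variable {n w : ℕ} {S : LCState n} {P : Fin n → Option (Fin n)} {f : Fin n → Fin n}

/-! ### The operations -/

/-- The root in register `0` gets the pointer in register `1`: an additional pointer if this leads
into its own tree, otherwise a parent pointer. -/
def attachProg : Cmd := block [
  .assign 8 (.reg 1),
  rootProg,
  .ite (.bin .eq (.reg 11) (.reg 0)) (.store 4 (.reg 0) (.reg 1))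
    (block [
      .assign 15 (.reg 0),
      .assign 16 (.reg 1),
      linkProg,
      .store 4 (.reg 0) (.const 0)])]

theorem exec_attachProg (hw : n < 2 ^ w) {σ : Store} {v u : Fin n} (h : HoldsExcept σ S P f v)
    (h0 : σ.reg 0 = nodeWord v) (h1 : σ.reg 1 = nodeWord u) :
    ∃ σ' t S' P', Exec w attachProg σ σ' t ∧ Holds σ' S' P' (Function.update f v u) ∧
      Amort t S S' 26000 := by
  have hw1 := one_lt_of_node hw v
  obtain ⟨σ₁, t₁, S₁, q, x₁, hσ₁, h₁, a1, a2, a3, a4⟩ := exec_rootProg hw h.valid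
    (v := u) (h.rep.setReg 8 (nodeWord u)) (by simp)
  have g0 : σ₁.reg 0 = nodeWord v := by rw [x₁.reg_eq (by decide)]; simpa using h0
  have g1 : σ₁.reg 1 = nodeWord u := by rw [x₁.reg_eq (by decide)]; simpa using h1
  have f1 : σ₁.arr 4 = σ.arr 4 := x₁.arr_eq (by decide)
  have hne : ∀ {x y}, P x = some y → x ≠ v := by
    rintro x y hx rfl; rw [h.root_self] at hx; cases hx
  by_cases hqv : q = v
  · subst hqv
    have x : Exec w attachProg σ (σ₁.setArr 4 (nodeWord q) (nodeWord u)) _ :=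
      .assign_cons (by simpa [RExp.eval] using h1) (.cons x₁ (.cons
        (.ite_true (by simp [RExp.eval, apply_eq hw1, a1, g0])
          (by simpa only [RExp.eval, g0, g1] using Exec.store (w := w) σ₁ 4 (.reg 0) (.reg 1)))
        (.nil _)))
    refine ⟨_, _, S₁, P, x, ⟨hσ₁.setArr_four _ _, h₁, ⟨?_, ?_⟩, ?_⟩, ?_⟩
    · intro x y hx
      rw [Function.update_of_ne (hne hx)]; exact h.nonroot hx
    · intro r hr
      by_cases hrq : r = q
      · subst hrq; simpa using a3
      · rw [Function.update_of_ne hrq]; exact h.root hrq hr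
    · intro x
      by_cases hxq : x = q
      · subst hxq; simp [a2]
      · simp [hxq, f1, h.extra x hxq]
    · refine ((a4.add_time (s := 60) q).mono q (show _ ≤ (26000 : ℝ) by norm_num)).of_le ?_
      simp only [RExp.cost]; omega
  · have hnot : ¬ IsAncestor P v u := fun h2 => hqv (root_unique a2 h.root_self a3 h2)
    obtain ⟨σ₂, t₂, S₂, x₂, hσ₂, h₂, b1⟩ := exec_linkProg hw h₁ h.root_self hnot
      (σ := (σ₁.setReg 15 (nodeWord v)).setReg 16 (nodeWord u)) ((hσ₁.setReg _ _).setReg _ _)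
      (by simp) (by simp)
    have k0 : σ₂.reg 0 = nodeWord v := by rw [x₂.reg_eq (by decide)]; simpa using g0
    have f2 : σ₂.arr 4 = σ.arr 4 := by rw [x₂.arr_eq (by decide)]; exact f1
    have x : Exec w attachProg σ (σ₂.setArr 4 (nodeWord v) 0) _ :=
      .assign_cons (by simpa [RExp.eval] using h1) (.cons x₁ (.cons
        (.ite_false (by simp [RExp.eval, apply_eq hw1, a1, g0, hqv])
          (.assign_cons (by simpa [RExp.eval] using g0) (.assign_cons
            (by simpa [RExp.eval] using g1) (.cons x₂ (.store_cons
              (by simpa [RExp.eval] using k0) (by simp [RExp.eval]) (.nil _))))))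
        (.nil _)))
    refine ⟨_, _, S₂, _, x, ⟨hσ₂.setArr_four _ _, h₂, ⟨?_, ?_⟩, ?_⟩, ?_⟩
    · intro x y hx
      by_cases hxv : x = v
      · subst hxv; simpa using hx
      · rw [Function.update_of_ne hxv] at hx ⊢
        exact h.nonroot hx
    · intro r hr
      have hrv : r ≠ v := by rintro rfl; simp at hr
      rw [Function.update_of_ne hrv] at hr ⊢
      exact (h.root hrv hr).update_root h.root_self
    · intro x
      by_cases hxv : x = v
      · subst hxv; simp
      · simp [hxv, f2, h.extra x hxv]
    · refine (((a4.trans b1).add_time (s := 60) v).mono v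
        (show _ ≤ (26000 : ℝ) by norm_num)).of_le ?_
      simp only [RExp.cost]; omega

/-- The pointer of the node in register `0` is set to the node in register `1`; NULL stands for
a pointer to itself. -/
def updateProg : Cmd := block [
  .ite (.reg 1) .skip (.assign 1 (.reg 0)),
  detachProg,
  attachProg]

theorem exec_updateProg (hw : n < 2 ^ w) {σ : Store} (h : Holds σ S P f) {v u : Fin n}
    (h0 : σ.reg 0 = nodeWord v)
    (h1 : σ.reg 1 = nodeWord u ∨ σ.reg 1 = 0 ∧ u = v) :
    ∃ σ' t S' P', Exec w updateProg σ σ' t ∧ Holds σ' S' P' (Function.update f v u) ∧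
      Amort t S S' 80000 := by
  obtain ⟨σ₀, t₀, x₀, ht₀, r0, r1, hσ₀⟩ : ∃ σ₀ t₀, Exec w (.ite (.reg 1) .skip (.assign 1 (.reg 0)))
      σ σ₀ t₀ ∧ t₀ ≤ 10 ∧ σ₀.reg 0 = nodeWord v ∧ σ₀.reg 1 = nodeWord u ∧ σ₀.arr = σ.arr := by
    rcases h1 with h1 | ⟨h1, rfl⟩
    · exact ⟨σ, _, .ite_true (by simp [RExp.eval, h1]) (.skip _), by simp [RExp.cost], h0, h1, rfl⟩
    · exact ⟨_, _, .ite_false (by simp [RExp.eval, h1]) (.assign σ 1 (.reg 0)), by simp [RExp.cost],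
        by simpa using h0, by simpa [RExp.eval] using h0, rfl⟩
  obtain ⟨σ₁, t₁, S₁, P₁, x₁, a1, a2⟩ := exec_detachProg hw (σ := σ₀)
    ⟨h.rep.of_arr hσ₀, h.valid, h.encodes, by rw [hσ₀]; exact h.extra⟩ r0
  obtain ⟨σ₂, t₂, S₂, P₂, x₂, b1, b2⟩ := exec_attachProg hw a1
    ((x₁.reg_eq (by decide)).trans r0) ((x₁.reg_eq (by decide)).trans r1)
  have x : Exec w updateProg σ σ₂ _ := .cons x₀ (.cons x₁ (.cons x₂ (.nil _)))
  refine ⟨σ₂, _, S₂, P₂, x, b1, ?_⟩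
  refine (((a2.trans b2).add_time (s := 20) v).mono v (show _ ≤ (80000 : ℝ) by norm_num)).of_le ?_
  omega

/-- The ancestor of the node in register `0` at the depth in register `1`. -/
def levelQueryProg : Cmd := block [
  .assign 8 (.reg 0),
  .assign 14 (.reg 1),
  ancestorProg,
  .assign 0 (.reg 11)]

theorem exec_levelQueryProg (hw : n < 2 ^ w) {σ : Store} (h : Holds σ S P f) {v : Fin n} {d e : ℕ}
    (h0 : σ.reg 0 = nodeWord v) (h1 : σ.reg 1 = d) (he : HasDepth P v e) (hd : d ≤ e) :
    ∃ σ' t S' u, Exec w levelQueryProg σ σ' t ∧ Holds σ' S' P f ∧ σ'.reg 0 = nodeWord u ∧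
      HasDepth P u d ∧ IsAncestor P u v ∧ S'.up u = none ∧ S'.ext true u = v ∧
      Amort t S S' 80000 := by
  obtain ⟨σ₁, t₁, S₁, u, x₁, hσ₁, h₁, a1, a2, a3, a4, a5, a6⟩ := exec_ancestorProg hw h.valid
    (σ := (σ.setReg 8 (nodeWord v)).setReg 14 d) (v := v) (d := d)
    ((h.rep.setReg _ _).setReg _ _) (by simp) (by simp) he hd
  have x : Exec w levelQueryProg σ (σ₁.setReg 0 (nodeWord u)) _ :=
    .assign_cons (by simpa [RExp.eval] using h0) (.assign_cons (by simpa [RExp.eval] using h1)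
      (.cons x₁ (.assign_cons (by simpa [RExp.eval] using a1) (.nil _))))
  have f1 : σ₁.arr 4 = σ.arr 4 := x₁.arr_eq (by decide)
  refine ⟨_, _, S₁, u, x, ⟨hσ₁.setReg _ _, h₁, h.encodes, ?_⟩, by simp, a2, a3, a4, a5, ?_⟩
  · simpa [f1] using h.extra
  · refine ((a6.add_time (s := 20) v).mono v (show _ ≤ (80000 : ℝ) by norm_num)).of_le ?_
    simp only [RExp.cost]; omega

/-- The depth of the node in register `8` after an access to it. -/
def depthExp : RExp := .bin .sub (.load 5 (.reg 8)) (.const 1)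

/-- The node `v` in register `8` has been accessed, register `14` holds its depth. If the steps
in register `1` lead beyond the root `r`, then `v` is replaced by `f r`, and the number of
remaining steps is reduced modulo the length of the cycle through `f r`. -/
def reduceProg : Cmd := .ite (.bin .lt (.reg 14) (.reg 1))
  (block [
    .assign 1 (.bin .sub (.bin .sub (.reg 1) (.reg 14)) (.const 1)),
    rootProg,
    .assign 8 (.load 4 (.reg 11)),
    accessProg,
    .assign 14 depthExp,
    .assign 1 (.bin .mod (.reg 1) (.load 5 (.reg 8)))]) .skip

/-- The node `f^k(v)` for `v` in register `0` and `k` in register `1`. -/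
def pointerQueryProg : Cmd := block [
  .assign 8 (.reg 0),
  accessProg,
  .assign 14 depthExp,
  reduceProg,
  .assign 14 (.bin .sub (.reg 14) (.reg 1)),
  ancestorProg,
  .assign 0 (.reg 11)]

theorem eval_depthExp (hw : n < 2 ^ w) (h : Valid S P) {σ : Store} (hσ : Rep σ S) {v : Fin n}
    (h8 : σ.reg 8 = nodeWord v) : depthExp.eval w σ = S.sz v - 1 := by
  have h1 : (1 : ℕ) % 2 ^ w = 1 := Nat.mod_eq_of_lt (one_lt_of_node hw v)
  have h2 := h.sz_le v
  have h3 := h.sz_pos v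
  simp only [depthExp, RExp.eval, h8, hσ.sz, h1]
  rw [apply_sub (by omega) (by omega)]

/-- Past the root `r` the pointers run around the cycle through `f r`, whose nodes are the ancestors
of `f r`; its length is the size of the splay tree after an access to `f r`. -/
theorem exec_reduceProg (hw : n < 2 ^ w) {σ : Store} (h : Holds σ S P f) {v : Fin n} {k e : ℕ}
    (hk : k < 2 ^ w) (h8 : σ.reg 8 = nodeWord v) (h14 : σ.reg 14 = e) (h1 : σ.reg 1 = k)
    (he : HasDepth P v e) (hen : e < n) :
    ∃ σ' t S' y k' e', Exec w reduceProg σ σ' t ∧ Holds σ' S' P f ∧ σ'.reg 8 = nodeWord y ∧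
      σ'.reg 14 = e' ∧ σ'.reg 1 = k' ∧ HasDepth P y e' ∧ e' < n ∧ k' ≤ e' ∧ f^[k'] y = f^[k] v ∧
      Amort t S S' 20000 := by
  have hw1 := one_lt_of_node hw v
  by_cases hlt : e < k
  · obtain ⟨σ₁, t₁, S₁, r, x₁, hσ₁, h₁, a1, a2, a3, a4⟩ := exec_rootProg hw h.valid
      (σ := σ.setReg 1 (k - e - 1)) (v := v) (h.rep.setReg _ _) (by simpa using h8)
    have f1 : σ₁.arr 4 = σ.arr 4 := x₁.arr_eq (by decide)
    have g1 : σ₁.reg 1 = k - e - 1 := by rw [x₁.reg_eq (by decide)]; simp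
    have hc : σ₁.arr 4 (nodeWord r) = nodeWord (f r) := by rw [f1, h.extra, if_pos a2]
    obtain ⟨σ₂, t₂, S₂, x₂, hσ₂, h₂, b1, b2, -, b4⟩ := exec_accessProg hw h₁
      (σ := σ₁.setReg 8 (nodeWord (f r))) (v := f r) (hσ₁.setReg _ _) (by simp)
    have f2 : σ₂.arr 4 = σ.arr 4 := by rw [x₂.arr_eq (by decide)]; exact f1
    have k1 : σ₂.reg 1 = k - e - 1 := by rw [x₂.reg_eq (by decide)]; simpa using g1
    have k8 : σ₂.reg 8 = nodeWord (f r) := by rw [x₂.reg_eq (by decide)]; simp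
    have hd := h₂.hasDepth_accessed b1 b2
    have hp := h₂.sz_pos (f r)
    have hle := h₂.sz_le (f r)
    have hone : (1 : ℕ) % 2 ^ w = 1 := Nat.mod_eq_of_lt hw1
    have x : Exec w reduceProg σ ((σ₂.setReg 14 (S₂.sz (f r) - 1)).setReg 1
        ((k - e - 1) % S₂.sz (f r))) _ :=
      .ite_true (by simp [RExp.eval, apply_lt hw1, h14, h1, hlt])
        (.assign_cons (by
            simp only [RExp.eval, h1, h14, hone]
            rw [apply_sub hlt.le hk, apply_sub (by omega) (by omega)])
          (.cons x₁ (.assign_cons (x := nodeWord (f r)) (by simp [RExp.eval, a1, hc])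
            (.cons x₂ (.assign_cons (eval_depthExp hw h₂ hσ₂ k8) (.assign_cons (by
              have e1 : (σ₂.setReg 14 (S₂.sz (f r) - 1)).reg 1 = k - e - 1 := by simpa using k1
              have e8 : (σ₂.setReg 14 (S₂.sz (f r) - 1)).reg 8 = nodeWord (f r) := by
                simpa using k8
              have e5 := (hσ₂.setReg 14 (S₂.sz (f r) - 1)).sz (f r)
              simp only [RExp.eval, BinOp.apply, e1, e8, e5]
              exact Nat.mod_eq_of_lt ((Nat.mod_le _ _).trans_lt (by omega))) (.nil _)))))))
    obtain ⟨r', hr, hr'⟩ := he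
    obtain rfl := root_unique hr' a2 ⟨e, hr⟩ a3
    refine ⟨_, _, S₂, f r', (k - e - 1) % S₂.sz (f r'), S₂.sz (f r') - 1, x,
      ⟨(hσ₂.setReg _ _).setReg _ _, h₂, h.encodes, by simpa [f2] using h.extra⟩,
      by simpa using k8, by simp, by simp, hd, by omega, ?_, ?_, ?_⟩
    · have := Nat.mod_lt (k - e - 1) hp
      omega
    · have h3 := h.encodes.isPeriodicPt a2 hd
      rw [Nat.sub_add_cancel hp] at h3
      rw [h3.iterate_mod_apply, ← h.encodes.iterate_of_climb hr, ← Function.iterate_succ_apply' f,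
        ← Function.iterate_add_apply]
      congr 2; omega
    · refine (((a4.trans b4).add_time (s := 60) v).mono v
        (show _ ≤ (20000 : ℝ) by norm_num)).of_le ?_
      simp only [RExp.cost, depthExp]; omega
  · refine ⟨σ, _, S, v, k, e, .ite_false (by simp [RExp.eval, apply_lt hw1, h14, h1, hlt]) (.skip _),
      h, h8, h14, h1, he, hen, not_lt.1 hlt, rfl, ?_⟩
    refine ((Amort.refl v S 20).mono v (by norm_num)).of_le ?_
    simp [RExp.cost]

theorem exec_pointerQueryProg (hw : n < 2 ^ w) {σ : Store} (h : Holds σ S P f) {v : Fin n} {k : ℕ}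
    (hk : k < 2 ^ w) (h0 : σ.reg 0 = nodeWord v) (h1 : σ.reg 1 = k) :
    ∃ σ' t S', Exec w pointerQueryProg σ σ' t ∧ Holds σ' S' P f ∧
      σ'.reg 0 = nodeWord (f^[k] v) ∧ Amort t S S' 80000 := by
  obtain ⟨σ₁, t₁, S₁, x₁, hσ₁, h₁, a1, a2, -, a4⟩ := exec_accessProg hw h.valid
    (σ := σ.setReg 8 (nodeWord v)) (v := v) (h.rep.setReg _ _) (by simp)
  have f1 : σ₁.arr 4 = σ.arr 4 := x₁.arr_eq (by decide)
  have g1 : σ₁.reg 1 = k := by rw [x₁.reg_eq (by decide)]; simpa using h1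
  have g8 : σ₁.reg 8 = nodeWord v := by rw [x₁.reg_eq (by decide)]; simp
  have hp := h₁.sz_pos v
  have hle := h₁.sz_le v
  obtain ⟨σ₂, t₂, S₂, y, k', e', x₂, H₂, k8, k14, k1, b1, b2, b3, b4, b5⟩ := exec_reduceProg hw
    (σ := σ₁.setReg 14 (S₁.sz v - 1)) (S := S₁) (P := P) (f := f)
    ⟨hσ₁.setReg _ _, h₁, h.encodes, by simpa [f1] using h.extra⟩ hk (by simpa using g8) (by simp)
    (by simpa using g1) (h₁.hasDepth_accessed a1 a2) (by omega)
  obtain ⟨σ₃, t₃, S₃, u, x₃, hσ₃, h₃, c1, c2, c3, -, -, c6⟩ := exec_ancestorProg hw H₂.valid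
    (σ := σ₂.setReg 14 (e' - k')) (v := y) (d := e' - k') (H₂.rep.setReg _ _) (by simpa using k8)
    (by simp) b1 (Nat.sub_le _ _)
  have f3 : σ₃.arr 4 = σ₂.arr 4 := x₃.arr_eq (by decide)
  have hu : u = f^[k] v := by
    obtain ⟨j, hj⟩ := c3
    have h3 := (HasDepth.of_climb hj c2).unique b1
    obtain rfl : j = k' := by omega
    rw [← b4, h.encodes.iterate_of_climb hj]
  have x : Exec w pointerQueryProg σ (σ₃.setReg 0 (nodeWord u)) _ :=
    .assign_cons (by simpa [RExp.eval] using h0) (.cons x₁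
      (.assign_cons (eval_depthExp hw h₁ hσ₁ g8) (.cons x₂ (.assign_cons (by
          simp only [RExp.eval, k14, k1]
          exact apply_sub b3 (by omega))
        (.cons x₃ (.assign_cons (by simpa [RExp.eval] using c1) (.nil _)))))))
  refine ⟨_, _, S₃, x, ⟨hσ₃.setReg _ _, h₃, h.encodes, by simpa [f3] using H₂.extra⟩,
    by simp [hu], ?_⟩
  refine ((((a4.trans b5).trans c6).add_time (s := 60) v).mono v
    (show _ ≤ (80000 : ℝ) by norm_num)).of_le ?_
  simp only [RExp.cost, depthExp]; omega

end DPF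

namespace DPF

open RExp Cmd Finset

variable {n w : ℕ} {S : LCState n} {P : Fin n → Option (Fin n)} {f : Fin n → Fin n}

/-! ### Initialization -/

/-- Each node is a path of its own. -/
def LCState.singletons (n : ℕ) : LCState n where
  ch _ _ := none
  up _ := none
  sz _ := 1
  ext _ v := v

theorem isForest_none : IsForest fun _ : Fin n => none := fun _ => ⟨1, rfl⟩

theorem valid_singletons : Valid (LCState.singletons n) fun _ => none where
  forest := isForest_none
  up_forest := isForest_none
  up_ch := by simp [LCState.singletons]
  ch_inj := by simp [LCState.singletons]
  sz_eq := by simp [LCState.singletons]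
  ext_none := by simp [LCState.singletons]
  ext_some := by simp [LCState.singletons]
  adj := by simp [LCState.singletons]
  root := by simp [LCState.singletons]

theorem pot_singletons : pot (LCState.singletons n).up = 0 := by
  refine sum_eq_zero fun v _ => ?_
  have : desc (LCState.singletons n).up v = {v} := by
    ext x
    rw [mem_desc, isAncestor_of_none rfl, mem_singleton, eq_comm]
  simp [rank, this]

/-- A loop that counts the register `r` down to `0`. The invariant `I i t σ` speaks of the value
`i` of the register, the time `t` that has passed and the store `σ`. -/
theorem exec_countdown {p : Cmd} {r m : ℕ} {I : ℕ → ℕ → Store → Prop}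
    (step : ∀ i t σ, i < m → I (i + 1) t σ → σ.reg r = i + 1 →
      ∃ σ' t', Exec w p σ σ' t' ∧ σ'.reg r = i ∧ I i (t + (t' + 2)) σ')
    {i : ℕ} (hi : i ≤ m) {t : ℕ} {σ : Store} (hI : I i t σ) (hr : σ.reg r = i) :
    ∃ σ' t' s, Exec w (.loop (.reg r) p) σ σ' t' ∧ I 0 s σ' ∧ t + t' = s + 2 := by
  induction i generalizing t σ with
  | zero => exact ⟨σ, _, t, .loop_false hr, hI, by simp [RExp.cost]⟩
  | succ i ih =>
    obtain ⟨σ₁, t₁, x₁, h₁, I₁⟩ := step i t σ hi hI hr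
    obtain ⟨σ₂, t₂, s, x₂, I₂, h₂⟩ := ih (by omega) I₁ h₁
    refine ⟨σ₂, _, s, .loop_true (by simp [RExp.eval, hr]) x₁ x₂, I₂, ?_⟩
    simp only [RExp.cost]
    omega

/-- The node in register `20` becomes a path of its own, with a pointer to itself. -/
def singletonProg : Cmd := block [
  .store 4 (.reg 20) (.reg 20),
  .store 5 (.reg 20) (.const 1),
  .assign 20 (.bin .sub (.reg 20) (.const 1))]

/-- The node in register `21` receives the pointer from array `0`, if this is neither NULL nor a
pointer to the node itself. -/
def insertProg : Cmd := block [
  .ite (.load 0 (.reg 21))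
    (.ite (.bin .eq (.load 0 (.reg 21)) (.reg 21)) .skip
      (block [.assign 0 (.reg 21), .assign 1 (.load 0 (.reg 21)), updateProg])) .skip,
  .assign 21 (.bin .sub (.reg 21) (.const 1))]

/-- Initialization: starting from `n` self-loops, the input pointers are inserted one by one. -/
def buildProg : Cmd := block [
  .assign 20 (.reg 0),
  .assign 21 (.reg 0),
  .loop (.reg 20) singletonProg,
  .loop (.reg 21) insertProg]

/-- The array `a` contains zeros but for the cells `i + 1, …, n`, where it agrees with `h`. -/
def FilledAbove (n i : ℕ) (a h : ℕ → ℕ) : Prop :=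
  ∀ x, a x = if i < x ∧ x ≤ n then h x else 0

theorem FilledAbove.update {i : ℕ} (hi : i < n) {a a' h : ℕ → ℕ} (ha : FilledAbove n (i + 1) a h)
    (ha' : ∀ x, a' x = if x = i + 1 then h (i + 1) else a x) : FilledAbove n i a' h := by
  intro x
  rw [ha', ha]
  by_cases hx : x = i + 1
  · subst hx
    rw [if_pos rfl, if_pos (by omega)]
  · rw [if_neg hx]
    exact if_congr (by omega) rfl rfl

theorem inputStore_arr_zero (g : Fin n → Option (Fin n)) (v : Fin n) :
    (inputStore g).arr 0 (nodeWord v) = optWord (g v) := by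
  have h : (0 : ℕ) = 0 ∧ 1 ≤ nodeWord v ∧ nodeWord v ≤ n := ⟨rfl, by simp [nodeWord], nodeWord_le v⟩
  exact dif_pos h

theorem exec_loop_singletonProg (hn : 1 ≤ n) (hw : n < 2 ^ w) {σ : Store}
    (h20 : σ.reg 20 = n) (hz : ∀ a, a ≠ 0 → σ.arr a = 0) :
    ∃ σ' t, Exec w (.loop (.reg 20) singletonProg) σ σ' t ∧ t ≤ 30 * n + 2 ∧
      σ'.arr 0 = σ.arr 0 ∧
      Holds σ' (LCState.singletons n) (fun _ => none) id := by
  have h1 : (1 : ℕ) % 2 ^ w = 1 := Nat.mod_eq_of_lt (by omega)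
  obtain ⟨σ', t, s, x, ⟨hs, H4, H5⟩, hts⟩ := exec_countdown (w := w) (p := singletonProg) (r := 20)
    (m := n) (I := fun i t σ => t + 30 * i ≤ 30 * n ∧ FilledAbove n i (σ.arr 4) id ∧
      FilledAbove n i (σ.arr 5) fun _ => 1) (σ := σ) (t := 0)
    (fun i t σ hi ⟨ht, H4, H5⟩ hr => by
      refine ⟨((σ.setArr 4 (i + 1) (i + 1)).setArr 5 (i + 1) 1).setReg 20 i, _,
        .store_cons (by simpa [RExp.eval] using hr) (by simpa [RExp.eval] using hr)
        (.store_cons (by simpa [RExp.eval] using hr) (by simpa [RExp.eval] using h1)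
        (.assign_cons (by
          simp only [RExp.eval, Store.setArr_reg, hr, h1]
          rw [apply_sub (by omega) (by omega), Nat.add_sub_cancel]) (.nil _))), by simp,
        ?_, H4.update hi (by simp), H5.update hi (by simp)⟩
      simp only [RExp.cost]
      omega) le_rfl
    (by
      refine ⟨by omega, fun x => ?_, fun x => ?_⟩ <;>
      · rw [hz _ (by norm_num), if_neg (by omega)]
        rfl) h20
  have hne : ∀ a, a ∉ [4, 5] → a ≠ 0 → σ'.arr a = 0 := fun a ha h0 => by
    rw [x.arr_eq (by simpa [singletonProg, Cmd.arrs, block] using ha), hz a h0]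
  have hv : ∀ v : Fin n, 0 < nodeWord v ∧ nodeWord v ≤ n := fun v =>
    ⟨Nat.succ_pos _, nodeWord_le v⟩
  refine ⟨σ', t, x, by omega, x.arr_eq (by decide), ⟨?_, ?_, ?_, ?_, ?_⟩, valid_singletons,
    ⟨by simp, fun _ => .refl _⟩, fun v => ?_⟩
  · intro d v
    rw [hne (sideArr d) (by cases d <;> simp [sideArr]) (by cases d <;> simp [sideArr])]; rfl
  · intro v
    rw [hne 3 (by simp) (by simp)]; rfl
  · intro v
    rw [H5, if_pos (hv v)]; rfl
  · intro d
    rw [hne (sideArr d) (by cases d <;> simp [sideArr]) (by cases d <;> simp [sideArr])]; rfl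
  · rw [H5]; rfl
  · rw [H4, if_pos (hv v)]; simp

/-- The inserted pointers: those of the nodes with index at least `i`. -/
def pointersFrom (f : Fin n → Fin n) (i : ℕ) (x : Fin n) : Fin n := if i ≤ x then f x else x

/-- The nodes with index at least `i` whose pointer is not a self-loop. -/
def movedFrom (f : Fin n → Fin n) (i : ℕ) : Finset (Fin n) :=
  univ.filter fun x => i ≤ x ∧ f x ≠ x

theorem pointersFrom_eq_update (f : Fin n → Fin n) (v : Fin n) :
    pointersFrom f v = Function.update (pointersFrom f (v + 1)) v (f v) := by
  funext x
  by_cases hx : x = v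
  · simp [hx, pointersFrom]
  · have : (v : ℕ) ≠ x := fun h => hx (Fin.ext h.symm)
    rw [Function.update_of_ne hx]
    exact if_congr (by omega) rfl rfl

theorem movedFrom_succ_of_eq {f : Fin n → Fin n} {v : Fin n} (hv : f v = v) :
    movedFrom f v = movedFrom f (v + 1) := by
  ext x
  simp only [movedFrom, mem_filter, mem_univ, true_and]
  refine and_congr_left fun hx => ?_
  have : (v : ℕ) ≠ x := fun h => hx (by rw [← Fin.ext h, hv])
  omega

theorem card_movedFrom_of_ne {f : Fin n → Fin n} {v : Fin n} (hv : f v ≠ v) :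
    (movedFrom f v).card = (movedFrom f (v + 1)).card + 1 := by
  rw [← card_insert_of_notMem (a := v) (by simp [movedFrom])]
  congr 1
  ext x
  simp only [movedFrom, mem_filter, mem_univ, true_and, mem_insert]
  by_cases hx : x = v
  · simp [hx, hv]
  · have : (v : ℕ) ≠ x := fun h => hx (Fin.ext h.symm)
    simp only [hx, false_or]
    refine and_congr_left fun _ => ?_
    omega

theorem exec_insertProg (hw : n < 2 ^ w) {g : Fin n → Option (Fin n)}
    (hf : ∀ v, f v = (g v).getD v) {v : Fin n} {σ : Store}
    (h0 : ∀ v, σ.arr 0 (nodeWord v) = optWord (g v)) (h21 : σ.reg 21 = nodeWord v)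
    (h : Holds σ S P (pointersFrom f (v + 1))) :
    ∃ σ' t S' P', Exec w insertProg σ σ' t ∧ Holds σ' S' P' (pointersFrom f v) ∧
      σ'.reg 21 = v ∧ σ'.arr 0 = σ.arr 0 ∧
      (t : ℝ) + 950 * pot S'.up ≤ 950 * pot S.up + 60 + 80000 * (1 + Real.logb 2 n) *
        ((movedFrom f v).card - (movedFrom f (v + 1)).card) ∧
      950 * pot S'.up ≤ 950 * pot S.up + 80000 * (1 + Real.logb 2 n) *
        ((movedFrom f v).card - (movedFrom f (v + 1)).card) := by
  have hw1 := one_lt_of_node hw v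
  have h1 : (1 : ℕ) % 2 ^ w = 1 := Nat.mod_eq_of_lt hw1
  have hvn := nodeWord_le v
  have hsub : ∀ {σ : Store}, σ.reg 21 = nodeWord v →
      (RExp.bin .sub (.reg 21) (.const 1)).eval w σ = v := fun {σ} h => by
    simp only [RExp.eval, h, h1]
    rw [apply_sub (a := nodeWord v) (by simp [nodeWord]) (by omega), nodeWord, Nat.add_sub_cancel]
  have skip_case : f v = v → ∀ {t : ℕ}, t ≤ 40 →
      Exec w (.ite (.load 0 (.reg 21)) (.ite (.bin .eq (.load 0 (.reg 21)) (.reg 21)) .skip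
        (block [.assign 0 (.reg 21), .assign 1 (.load 0 (.reg 21)), updateProg])) .skip) σ σ t →
      ∃ σ' t S' P', Exec w insertProg σ σ' t ∧ Holds σ' S' P' (pointersFrom f v) ∧
      σ'.reg 21 = v ∧ σ'.arr 0 = σ.arr 0 ∧
      (t : ℝ) + 950 * pot S'.up ≤ 950 * pot S.up + 60 + 80000 * (1 + Real.logb 2 n) *
        ((movedFrom f v).card - (movedFrom f (v + 1)).card) ∧
      950 * pot S'.up ≤ 950 * pot S.up + 80000 * (1 + Real.logb 2 n) *
        ((movedFrom f v).card - (movedFrom f (v + 1)).card) := by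
    intro hv t ht x
    refine ⟨σ.setReg 21 v, _, S, P, .cons x (.assign_cons (hsub h21) (.nil _)),
      ⟨h.rep.setReg _ _, h.valid, ?_, ?_⟩, by simp, rfl, ?_, ?_⟩
    any_goals have hup : pointersFrom f v = pointersFrom f (v + 1) := by
                rw [pointersFrom_eq_update, Function.update_eq_self_iff]
                simp [pointersFrom, hv]
    · rw [hup]; exact h.encodes
    · rw [hup]; exact h.extra
    · rw [movedFrom_succ_of_eq hv]
      have : (t : ℝ) ≤ 40 := by exact_mod_cast ht
      simp only [RExp.cost]
      push_cast
      linarith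
    · rw [movedFrom_succ_of_eq hv, sub_self, mul_zero, add_zero]
  cases hg : g v with
  | none =>
    exact skip_case (by simp [hf, hg]) (t := 4) (by norm_num)
      (.ite_false (by simp [RExp.eval, h21, h0, hg]) (.skip _))
  | some u =>
    have hld : (RExp.load 0 (.reg 21)).eval w σ = nodeWord u := by simp [RExp.eval, h21, h0, hg]
    have hld' : (RExp.load 0 (.reg 21)).eval w σ ≠ 0 := by simp [hld]
    have heq : (RExp.bin .eq (.load 0 (.reg 21)) (.reg 21)).eval w σ = if u = v then 1 else 0 := by
      rw [RExp.eval, apply_eq hw1, hld]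
      simp [RExp.eval, h21]
    by_cases huv : u = v
    · exact skip_case (by simp [hf, hg, huv]) (t := 9) (by norm_num)
        (.ite_true hld' (.ite_true (by simp [heq, huv]) (.skip _)))
    · have hfv : f v = u := by simp [hf, hg]
      obtain ⟨σ₁, t₁, S₁, P₁, x₁, a1, a2⟩ := exec_updateProg hw
        (σ := (σ.setReg 0 (nodeWord v)).setReg 1 (nodeWord u)) (v := v) (u := u)
        ⟨(h.rep.setReg _ _).setReg _ _, h.valid, h.encodes, h.extra⟩ (by simp) (by simp)
      have g21 : σ₁.reg 21 = nodeWord v := by rw [x₁.reg_eq (by decide)]; simpa using h21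
      have x : Exec w insertProg σ (σ₁.setReg 21 v) _ :=
        .cons (.ite_true hld' (.ite_false (by simp [heq, huv])
          (.assign_cons (x := nodeWord v) (by simpa [RExp.eval] using h21)
            (.assign_cons (x := nodeWord u) (by simp [RExp.eval, h21, h0, hg])
              (.cons x₁ (.nil _)))))) (.assign_cons (hsub g21) (.nil _))
      refine ⟨_, _, S₁, P₁, x, ⟨a1.rep.setReg _ _, a1.valid, ?_, ?_⟩, by simp,
        by simpa using x₁.arr_eq (a := 0) (by decide), ?_, ?_⟩
      · rw [pointersFrom_eq_update, hfv]; exact a1.encodes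
      · rw [pointersFrom_eq_update, hfv]; exact a1.extra
      · rw [card_movedFrom_of_ne (hfv ▸ huv)]
        unfold Amort at a2
        simp only [RExp.cost]
        push_cast
        linarith
      · rw [card_movedFrom_of_ne (hfv ▸ huv)]
        unfold Amort at a2
        have := Nat.cast_nonneg (α := ℝ) t₁
        push_cast
        linarith

theorem exec_buildProg (hn : 1 ≤ n) (hw : n < 2 ^ w) {g : Fin n → Option (Fin n)}
    (hf : ∀ v, f v = (g v).getD v) :
    ∃ σ t S P, Exec w buildProg (inputStore g) σ t ∧ Holds σ S P f ∧
      (t : ℝ) ≤ 100000 * n * (1 + Real.logb 2 n) ∧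
      950 * pot S.up ≤ 80000 * {v | f v ≠ v}.ncard * (1 + Real.logb 2 n) := by
  have hL : 0 ≤ Real.logb 2 n := Real.logb_nonneg (by norm_num) (by exact_mod_cast hn)
  set L := Real.logb 2 n with hL'
  obtain ⟨σ₁, t₁, x₁, ht₁, h0, H⟩ := exec_loop_singletonProg hn hw
    (σ := ((inputStore g).setReg 20 n).setReg 21 n) (by simp)
    (fun a ha => funext fun i => by simp [inputStore, ha])
  have h0' : ∀ v, σ₁.arr 0 (nodeWord v) = optWord (g v) := fun v => by
    rw [h0]; exact inputStore_arr_zero g v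
  have h21 : σ₁.reg 21 = n := by rw [x₁.reg_eq (by decide)]; simp
  obtain ⟨σ₂, t₂, s, x₂, ⟨-, S, P, H₂, b1, b2⟩, hs⟩ := exec_countdown (w := w) (p := insertProg)
    (r := 21) (m := n) (I := fun i t σ => σ.arr 0 = σ₁.arr 0 ∧ ∃ S P,
      Holds σ S P (pointersFrom f i) ∧
      (t : ℝ) + 950 * pot S.up + 62 * i ≤ 62 * n + 80000 * (1 + L) * (movedFrom f i).card ∧
      950 * pot S.up ≤ 80000 * (1 + L) * (movedFrom f i).card) (σ := σ₁) (t := 0)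
    (fun i t σ hi ⟨e0, S, P, H, b1, b2⟩ hr => by
      obtain ⟨σ', t', S', P', x, H', r1, r0, b, b'⟩ := exec_insertProg hw hf (v := ⟨i, hi⟩) (σ := σ)
        (by rw [e0]; exact h0') hr H
      refine ⟨σ', t', x, r1, r0.trans e0, S', P', H', ?_, ?_⟩
      · push_cast at b1 ⊢
        simp only at b
        linarith
      · simp only at b'
        linarith) le_rfl
    (by
      have e : pointersFrom f n = id := funext fun x => if_neg (by have := x.2; omega)
      refine ⟨rfl, _, _, by rw [e]; exact H, ?_, ?_⟩
      · rw [pot_singletons]; simp; positivity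
      · rw [pot_singletons]; simp; positivity) h21
  have x : Exec w buildProg (inputStore g) σ₂ _ :=
    .assign_cons (x := n) (by simp [RExp.eval, inputStore])
      (.assign_cons (x := n) (by simp [RExp.eval, inputStore]) (.cons x₁ (.cons x₂ (.nil _))))
  have ef : pointersFrom f 0 = f := funext fun x => if_pos (Nat.zero_le _)
  have hcard : {v | f v ≠ v}.ncard = (movedFrom f 0).card := by
    rw [← Set.ncard_coe_finset]
    congr 1
    ext v
    simp [movedFrom]
  refine ⟨_, _, S, P, x, ef ▸ H₂, ?_, by rw [hcard]; linarith⟩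
  have hc : ((movedFrom f 0).card : ℝ) ≤ n := by
    exact_mod_cast (card_le_univ _).trans_eq (Fintype.card_fin n)
  have hp : 0 ≤ pot S.up := pot_nonneg
  have h1 : (t₁ : ℝ) ≤ 30 * n + 2 := by exact_mod_cast ht₁
  have h2 : (t₂ : ℝ) = s + 2 := by exact_mod_cast (Nat.zero_add t₂).symm.trans hs
  have h3 : 80000 * (1 + L) * ((movedFrom f 0).card : ℝ) ≤ 80000 * (1 + L) * n :=
    mul_le_mul_of_nonneg_left hc (by positivity)
  have h4 : (1 : ℝ) ≤ n := by exact_mod_cast hn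
  have h5 : 0 ≤ n * L := by positivity
  simp only [RExp.cost]
  push_cast at b1 ⊢
  nlinarith

end DPF

namespace DPF

variable {n w : ℕ} {S : LCState n} {P : Fin n → Option (Fin n)} {f : Fin n → Fin n}

/-! ### Sequences of operations -/

/-- The data structure for level ancestors. -/
def levelStructure : DataStructure := ⟨buildProg, updateProg, levelQueryProg⟩

/-- The data structure for pointer following. -/
def pointerStructure : DataStructure := ⟨buildProg, updateProg, pointerQueryProg⟩

theorem Holds.call {σ : Store} (h : Holds σ S P f) (x y : ℕ) : Holds (σ.call x y) S P f :=
  ⟨(h.rep.setReg _ _).setReg _ _, h.valid, h.encodes, h.extra⟩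

theorem exists_pointerRun (hw : n < 2 ^ w) (ops : List (PointerOp n)) (hops : PointerLegal w ops)
    {σ : Store} (h : Holds σ S P f) :
    ∃ f' σ' t S' P', PointerRun pointerStructure w f σ ops f' σ' t ∧ Holds σ' S' P' f' ∧
      Amort t S S' (80000 * ops.length) := by
  induction ops generalizing σ S P f with
  | nil => exact ⟨f, σ, 0, S, P, .nil f σ, h, by simp [Amort]⟩
  | cons op ops ih =>
    have hops' : PointerLegal w ops := fun v k hk => hops v k (List.mem_cons_of_mem _ hk)
    have hlen : (80000 : ℝ) * (op :: ops).length = 80000 + 80000 * ops.length := by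
      push_cast [List.length_cons]
      ring
    rw [hlen]
    cases op with
    | update v u =>
      obtain ⟨σ₁, t₁, S₁, P₁, x₁, h₁, a₁⟩ := exec_updateProg hw (h.call (nodeWord v) (nodeWord u))
        (v := v) (u := u) (by simp [Store.call]) (by simp [Store.call])
      obtain ⟨f', σ', t, S', P', x, h', a⟩ := ih hops' h₁
      exact ⟨f', σ', _, S', P', .update x₁ x, h', a₁.trans a⟩
    | query v k =>
      obtain ⟨σ₁, t₁, S₁, x₁, h₁, r, a₁⟩ := exec_pointerQueryProg hw (h.call (nodeWord v) k)
        (v := v) (k := k) (hops v k List.mem_cons_self) (by simp [Store.call]) (by simp [Store.call])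
      obtain ⟨f', σ', t, S', P', x, h', a⟩ := ih hops' h₁
      exact ⟨f', σ', _, S', P', .query x₁ r x, h', a₁.trans a⟩

/-- The pointers of a forest, each root pointing to itself. -/
def parentOrSelf (P : Fin n → Option (Fin n)) (v : Fin n) : Fin n := (P v).getD v

theorem parentOrSelf_update (v : Fin n) (x : Option (Fin n)) :
    parentOrSelf (Function.update P v x) = Function.update (parentOrSelf P) v (x.getD v) := by
  funext y
  by_cases hy : y = v
  · subst hy; simp [parentOrSelf]
  · simp [parentOrSelf, hy]

/-- A forest is determined by its pointers: no forest but `P` itself encodes them. -/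
theorem Encodes.eq_of_parentOrSelf {Q : Fin n → Option (Fin n)} (hP : IsForest P)
    (hQ : IsForest Q) (h : Encodes Q (parentOrSelf P)) : Q = P := by
  have hsome : ∀ {x y}, Q x = some y → P x = some y := fun {x y} hy => by
    have h1 : (P x).getD x = y := h.nonroot hy
    cases hp : P x with
    | none =>
      rw [hp] at h1
      exact absurd h1 (hQ.ne_of_some hy)
    | some z =>
      rw [hp] at h1
      exact congrArg some h1
  funext x
  cases hq : Q x with
  | some y => exact (hsome hq).symm
  | none =>
    cases hp : P x with
    | none => rfl
    | some y =>
      obtain ⟨j, hj⟩ := h.root hq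
      have hy : parentOrSelf P x = y := by simp [parentOrSelf, hp]
      rw [hy] at hj
      refine absurd ⟨j, ?_⟩ (hP.not_isAncestor hp)
      clear hq hp hy
      induction j generalizing y with
      | zero => exact hj
      | succ j ih =>
        cases hz : Q y with
        | none => simp [climb, hz] at hj
        | some z =>
          rw [climb_succ_of_some hz] at hj
          rw [climb_succ_of_some (hsome hz)]
          exact ih z hj

theorem parentOrSelf_ne_iff (hP : IsForest P) (v : Fin n) : parentOrSelf P v ≠ v ↔ P v ≠ none := by
  cases hp : P v with
  | none => simp [parentOrSelf, hp]
  | some u => simpa [parentOrSelf, hp] using (hP.ne_of_some hp).symm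

theorem exists_levelRun (hw : n < 2 ^ w) (ops : List (LevelOp n)) (hP : IsForest P)
    (hops : LevelLegal P ops) {σ : Store} (h : Holds σ S P (parentOrSelf P)) :
    ∃ P' σ' t S', LevelRun levelStructure w P σ ops P' σ' t ∧ Holds σ' S' P' (parentOrSelf P') ∧
      Amort t S S' (80000 * ops.length) ∧
      ∀ v d, ops.getLast? = some (.query v d) → ∃ u, S'.up u = none ∧ S'.ext true u = v := by
  induction ops generalizing σ S P with
  | nil => exact ⟨P, σ, 0, S, .nil P σ, h, by simp [Amort], by simp⟩
  | cons op ops ih =>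
    have hlen : (80000 : ℝ) * (op :: ops).length = 80000 + 80000 * ops.length := by
      push_cast [List.length_cons]
      ring
    rw [hlen]
    cases op with
    | update v x =>
      obtain ⟨σ₁, t₁, S₁, P₁, x₁, h₁, a₁⟩ := exec_updateProg hw (h.call (nodeWord v) (optWord x))
        (v := v) (u := x.getD v) (by simp [Store.call]) (by cases x <;> simp [Store.call])
      rw [← parentOrSelf_update] at h₁
      obtain rfl := h₁.encodes.eq_of_parentOrSelf hops.1 h₁.valid.forest
      obtain ⟨P', σ', t, S', y, h', a, hl⟩ := ih hops.1 hops.2 h₁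
      refine ⟨P', σ', _, S', .update x₁ y, h', a₁.trans a, fun u d hu => ?_⟩
      cases ops with
      | nil => simp at hu
      | cons o os => exact hl u d (by simpa using hu)
    | query v d =>
      obtain ⟨⟨e, he, hd⟩, hops'⟩ := hops
      obtain ⟨σ₁, t₁, S₁, u, x₁, h₁, r, b1, b2, b3, b4, a₁⟩ := exec_levelQueryProg hw
        (h.call (nodeWord v) d) (v := v) (d := d) (by simp [Store.call]) (by simp [Store.call]) he hd
      obtain ⟨P', σ', t, S', y, h', a, hl⟩ := ih hP hops' h₁
      cases ops with
      | nil =>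
        refine ⟨P, σ₁, t₁ + 0, S₁, .query x₁ b2 b1 r (.nil _ _), h₁, by simpa using a₁, ?_⟩
        intro v' d' hv
        obtain ⟨rfl, -⟩ : v = v' ∧ d = d' := by simpa using hv
        exact ⟨u, b3, b4⟩
      | cons o os =>
        exact ⟨P', σ', _, S', .query x₁ b2 b1 r y, h', a₁.trans a,
          fun v' d' hv => hl v' d' (by simpa using hv)⟩

/-- The potential after the initialization is paid for by the initial pointers. -/
theorem Amort.total_le {t l s : ℕ} {S S' : LCState n} (h : Amort t S S' (80000 * l))
    (hs : 950 * pot S.up ≤ 80000 * s * (1 + Real.logb 2 n)) (hn : 1 ≤ n) :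
    (t : ℝ) ≤ 100000 * (l + s) * (1 + Real.logb 2 n) := by
  have hL : 0 ≤ Real.logb 2 n := Real.logb_nonneg (by norm_num) (by exact_mod_cast hn)
  have hp : 0 ≤ pot S'.up := pot_nonneg
  have : 0 ≤ ((l : ℝ) + s) * (1 + Real.logb 2 n) := by positivity
  unfold Amort at h
  linarith

end DPF

theorem mainTheorem1 :
    -- fully dynamic level ancestors
    (∃ (D : DPF.DataStructure) (C : ℝ), ∀ n w : ℕ, 1 ≤ n → n < 2 ^ w →
      ∀ P₀ : Fin n → Option (Fin n), DPF.IsForest P₀ →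
      ∃ (σ₀ : DPF.Store) (t₀ : ℕ),
        DPF.Exec w D.build (DPF.inputStore P₀) σ₀ t₀ ∧
        (t₀ : ℝ) ≤ C * n * (1 + Real.logb 2 n) ∧
        ∀ ops : List (DPF.LevelOp n), DPF.LevelLegal P₀ ops →
          ∃ (P : Fin n → Option (Fin n)) (σ : DPF.Store) (t : ℕ)
            (ts : List (BinaryTree (Fin n))),
            DPF.LevelRun D w P₀ σ₀ ops P σ t ∧
            (t : ℝ) ≤ C * (ops.length + {v | P₀ v ≠ none}.ncard) * (1 + Real.logb 2 n) ∧
            DPF.IsLinkCut σ P ts ∧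
            ∀ v d, ops.getLast? = some (.query v d) → DPF.IsAccessed P ts v) ∧
    -- dynamic pointer following
    (∃ (D : DPF.DataStructure) (C : ℝ), ∀ n w : ℕ, 1 ≤ n → n < 2 ^ w →
      ∀ f₀ : Fin n → Fin n,
      ∃ (σ₀ : DPF.Store) (t₀ : ℕ),
        DPF.Exec w D.build (DPF.inputStore (fun v => some (f₀ v))) σ₀ t₀ ∧
        (t₀ : ℝ) ≤ C * n * (1 + Real.logb 2 n) ∧
        ∀ ops : List (DPF.PointerOp n), DPF.PointerLegal w ops →
          ∃ (f : Fin n → Fin n) (σ : DPF.Store) (t : ℕ)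
            (P : Fin n → Option (Fin n)) (ts : List (BinaryTree (Fin n))),
            DPF.PointerRun D w f₀ σ₀ ops f σ t ∧
            (t : ℝ) ≤ C * (ops.length + {v | f₀ v ≠ v}.ncard) * (1 + Real.logb 2 n) ∧
            DPF.IsLinkCut σ P ts ∧ DPF.EncodesPointers σ P f) := by
  refine ⟨⟨DPF.levelStructure, 100000, fun n w hn hw P₀ hP₀ => ?_⟩,
    ⟨DPF.pointerStructure, 100000, fun n w hn hw f₀ => ?_⟩⟩
  · obtain ⟨σ₀, t₀, S₀, P₁, x₀, h₀, ht₀, hp₀⟩ := DPF.exec_buildProg hn hw (g := P₀)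
      (f := DPF.parentOrSelf P₀) fun _ => rfl
    obtain rfl := h₀.encodes.eq_of_parentOrSelf hP₀ h₀.valid.forest
    refine ⟨σ₀, t₀, x₀, ht₀, fun ops hops => ?_⟩
    obtain ⟨P, σ, t, S, x, h, a, hl⟩ := DPF.exists_levelRun hw ops hP₀ hops h₀
    obtain ⟨ts, hts, hacc⟩ := h.valid.isLinkCut h.rep
    simp only [DPF.parentOrSelf_ne_iff hP₀] at hp₀
    refine ⟨P, σ, t, ts, x, a.total_le hp₀ hn, hts, fun v d hv => ?_⟩
    obtain ⟨u, hu, rfl⟩ := hl v d hv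
    exact hacc u hu
  · obtain ⟨σ₀, t₀, S₀, P₁, x₀, h₀, ht₀, hp₀⟩ := DPF.exec_buildProg hn hw
      (g := fun v => some (f₀ v)) (f := f₀) fun _ => rfl
    refine ⟨σ₀, t₀, x₀, ht₀, fun ops hops => ?_⟩
    obtain ⟨f, σ, t, S, P, x, h, a⟩ := DPF.exists_pointerRun hw ops hops h₀
    obtain ⟨ts, hts, -⟩ := h.valid.isLinkCut h.rep
    exact ⟨f, σ, t, P, ts, x, a.total_le hp₀ hn, hts, h.encodesPointers⟩
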